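/- Let $(K,\mathcal K)$ be a measurable space whose one-point sets are measurable, $T>0$, and let $\nu(t,x,dy)$ be a transition measure from $[0,\infty)\times K$ to $K$ with $\sup_{t\in[0,T],x\in K}\nu(t,x,K)<\infty$ and $\nu(t,x,\{x\})=0$ for all $t,x$. Put $\lambda(t,x)=\nu(t,x,K)$, $\pi(t,x,\cdot)=\nu(t,x,\cdot)/\lambda(t,x)$ if $\lambda(t,x)>0$ and $\pi(t,x,\cdot)=\delta_x$ if $\lambda(t,x)=0$. Let $X:\Omega\times[0,\infty)\to K$, let $\mathcal F_I=\sigma(X_s,\ s\in I)$ for $I\subset[0,\infty)$, and for all $t\ge 0$, $x\in K$ let $\mathbb P^{t,x}$ be a probability on $(\Omega,\mathcal F_{[t,\infty)})$. Assume that 1. $\mathbb P^{t,x}(X_t=x)=1$; $x\mapsto\mathbb P^{t,x}(X_s\in A)$ is measurable for $t\le s$, $A\in\mathcal K$; and $\mathbb P^{u,x}(X_s\in A\mid\mathcal F_{[u,t]})=\mathbb P^{t,X_t}(X_s\in A)$, $\mathbb P^{u,x}$-a.s., for $u\le t\le s$, $A\in\mathcal K$; 2. for all $\omega$ and $t\ge0$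 there is $\delta>0$ with $X_s(\omega)=X_t(\omega)$ for $s\in[t,t+\delta]$, and every trajectory has finitely many jumps on bounded intervals; 3. for every $t\ge 0$ the first jump time $T_1^t=\inf\{s>t: X_s\ne X_t\}$ (with $\inf\emptyset=\infty$) is $\mathcal F_{[t,\infty)}$-measurable, and for $t\le a<b\le\infty$, $x\in K$, $A\in\mathcal K$, $$\mathbb P^{t,x}\big(T^t_1\in(a,b),\,X_{T^t_1}\in A\big)=\int_a^b\pi(s,x,A)\,\lambda(s,x)\exp\Big(-\int_t^s\lambda(r,x)\,dr\Big)ds .$$ Fix $(t,x)\in[0,T]\times K$. Let $T_0=t$, $T_{n+1}=\inf\{s>T_n: X_s\neq X_{T_n}\}$, $p(ds\,dy)=\sum_{n\ge1,\,T_n<\infty}\delta_{(T_n,X_{T_n})}$ and $q(ds\,dy)=p(ds\,dy)-\nu(s,X_s,dy)\,ds$; integrals $\int_s^T$ are over $(s,T]$. Let $\mathbb M^{t,x}$ be the space of pairs $(Y,Z)$ on $[t,T]$ with $Y$ real-valued and progressive for the filtration $(\mathcal F_{[t,s]})_{s\ge t}$, $Z:\Omega\times[t,T]\times K\to\mathbb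 R$ measurable for the product of the predictable $\sigma$-algebra of that filtration and $\mathcal K$, and $$\|(Y,Z)\|^2_{\mathbb M^{t,x}}=\mathbb E^{t,x}\int_t^T|Y_s|^2ds+\mathbb E^{t,x}\int_t^T\!\int_K|Z_s(y)|^2\,\nu(s,X_s,dy)\,ds<\infty .$$ Let $L,L'\ge0$. Data $(f,g)$ are called admissible for $(t,x)$ and $L,L'$ if $g:K\to\mathbb R$ is measurable with $\mathbb E^{t,x}|g(X_T)|^2<\infty$; $f(s,x',r,\cdot)$ maps $L^2(K,\mathcal K,\nu(s,x',dy))$ to $\mathbb R$ for $s\in[0,T]$, $x'\in K$, $r\in\mathbb R$; $(s,x',r)\mapsto f(s,x',r,z(\cdot))$ is measurable on $[0,T]\times K\times\mathbb R$ for every bounded measurable $z:K\to\mathbb R$; $$|f(s,x',r,z)-f(s,x',r',z')|\le L'|r-r'|+L\Big(\int_K|z(y)-z'(y)|^2\,\nu(s,x',dy)\Big)^{1/2}$$ for all $s\in[0,T]$, $x'\in K$, $r,r'\in\mathbb R$, $z,z'\in L^2(K,\mathcal K,\nu(s,x',dy))$; and $\mathbb E^{t,x}\int_t^T|f(s,X_s,0,0)|^2ds<\infty$.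 A pair $(Y,Z)\in\mathbb M^{t,x}$ is a solution of the BSDE with data $(f,g)$ if, $\mathbb P^{t,x}$-a.s., $$Y_s+\int_s^T\!\int_KZ_r(y)\,q(dr\,dy)=g(X_T)+\int_s^Tf(r,X_r,Y_r,Z_r(\cdot))\,dr,\qquad s\in[t,T].$$ **Proposition.** There is a constant $C>0$ depending only on $T,L,L'$ such that the following holds in every such setting. (a) If $(f^1,g^1)$ and $(f^2,g^2)$ are admissible and $(Y^1,Z^1),(Y^2,Z^2)\in\mathbb M^{t,x}$ are solutions of the corresponding BSDEs, then with $\overline Y=Y^1-Y^2$, $\overline Z=Z^1-Z^2$, $\overline g_T=g^1(X_T)-g^2(X_T)$ and $\overline f_s=f^1(s,X_s,Y^2_s,Z^2_s(\cdot))-f^2(s,X_s,Y^2_s,Z^2_s(\cdot))$, $$\sup_{s\in[t,T]}\mathbb E^{t,x}|\overline Y_s|^2+\mathbb E^{t,x}\int_t^T|\overline Y_s|^2ds+\mathbb E^{t,x}\int_t^T\!\int_K|\overline Z_s(y)|^2\,\nu(s,X_s,dy)\,ds\le C\Big(\mathbb E^{t,x}|\overline g_T|^2+\mathbb E^{t,x}\int_t^T|\overline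 f_s|^2ds\Big).$$ (b) If $(f,g)$ is admissible and $(Y,Z)\in\mathbb M^{t,x}$ is a solution of the BSDE with data $(f,g)$, then $$\mathbb E^{t,x}\int_t^T|Y_s|^2ds+\mathbb E^{t,x}\int_t^T\!\int_K|Z_s(y)|^2\,\nu(s,X_s,dy)\,ds\le C\Big(\mathbb E^{t,x}|g(X_T)|^2+\mathbb E^{t,x}\int_t^T|f(s,X_s,0,0)|^2ds\Big).$$ -/

import Mathlib

open MeasureTheory ProbabilityTheory Set Filter Topology
open scoped NNReal ENNReal

noncomputable section

namespace JumpBSDE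

/-- Lebesgue measure on the time axis `[0,∞)`. -/
def leb : Measure ℝ≥0 := (volume.restrict (Ici (0 : ℝ))).map Real.toNNReal

/-! ### Jump Markov processes -/

section Setup

variable {K Ω : Type*} [MeasurableSpace K]

/-- The σ-algebra `𝓕_I = σ(X_s, s ∈ I)` on `Ω`. -/
@[reducible]
def sigmaAlg (X : ℝ≥0 → Ω → K) (I : Set ℝ≥0) : MeasurableSpace Ω :=
  ⨆ s ∈ I, MeasurableSpace.comap (X s) inferInstance

theorem sigmaAlg_mono (X : ℝ≥0 → Ω → K) {I J : Set ℝ≥0} (h : I ⊆ J) :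
    sigmaAlg X I ≤ sigmaAlg X J :=
  biSup_mono h

/-- The filtration `(𝓕_{[t,s]})_{s ∈ [t,∞)}` on `(Ω, 𝓕_{[t,∞)})`. It is not completed. -/
def natFiltration (X : ℝ≥0 → Ω → K) (t : ℝ≥0) :
    Filtration (Ici t) (sigmaAlg X (Ici t)) where
  seq s := sigmaAlg X (Icc t s)
  mono' _ _ h := sigmaAlg_mono X (Icc_subset_Icc_right h)
  le' _ := sigmaAlg_mono X Icc_subset_Ici_self

/-- The jump times after `t`: `T_0 = t` and `T_{n+1} = inf {s > T_n : X_s ≠ X_{T_n}}`, with the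
infimum of the empty set equal to `∞`. -/
def jumpTime (X : ℝ≥0 → Ω → K) (t : ℝ≥0) (ω : Ω) : ℕ → ℝ≥0∞
  | 0 => t
  | n + 1 => sInf {s : ℝ≥0∞ | ∃ r : ℝ≥0, s = r ∧ jumpTime X t ω n < r ∧
      X r ω ≠ X (jumpTime X t ω n).toNNReal ω}

/-- The jump rate function `λ(s,x) = ν(s,x,K)`. -/
def jumpRate (ν : Kernel (ℝ≥0 × K) K) (s : ℝ≥0) (x : K) : ℝ≥0∞ := ν (s, x) univ

open Classical in
/-- The jump measure `π(s,x,·)`: it is `ν(s,x,·) / λ(s,x)` if `λ(s,x) > 0`, and the Dirac measure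
at `x` if `λ(s,x) = 0`. -/
def jumpLaw (ν : Kernel (ℝ≥0 × K) K) (s : ℝ≥0) (x : K) : Measure K :=
  if jumpRate ν s x = 0 then Measure.dirac x else (jumpRate ν s x)⁻¹ • ν (s, x)

/-- `ν` is a rate measure: it is a transition measure from `[0,∞) × K` to `K` whose total mass is
bounded on `[0,T] × K` and with `ν(s,x,{x}) = 0`. -/
structure IsRateMeasure (ν : Kernel (ℝ≥0 × K) K) (T : ℝ≥0) : Prop where
  bounded : ∃ Λ : ℝ≥0, ∀ s ≤ T, ∀ x, jumpRate ν s x ≤ Λ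
  self_eq_zero : ∀ s x, ν (s, x) {x} = 0

/-- `(Ω, X, (P^{t,x}))` is a normal, non-explosive, pure jump Markov process with rate
measure `ν`. Each `P t x` is a measure on `𝓕_{[t,∞)}`. -/
structure IsJumpMarkov (X : ℝ≥0 → Ω → K)
    (P : (t : ℝ≥0) → K → @Measure Ω (sigmaAlg X (Ici t)))
    (ν : Kernel (ℝ≥0 × K) K) : Prop where
  isProbabilityMeasure : ∀ t x, IsProbabilityMeasure (P t x)
  normal : ∀ t x, P t x {ω | X t ω = x} = 1
  measurable_transition : ∀ t s, t ≤ s → ∀ A : Set K, MeasurableSet A →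
    Measurable fun x => P t x {ω | X s ω ∈ A}
  markov : ∀ u t s, u ≤ t → t ≤ s → ∀ A : Set K, MeasurableSet A → ∀ x,
    (P u x)[Set.indicator {ω | X s ω ∈ A} (fun _ => (1 : ℝ)) | sigmaAlg X (Icc u t)]
      =ᵐ[P u x] fun ω => (P t (X t ω) {ω' | X s ω' ∈ A}).toReal
  /-- Trajectories are right-continuous for the discrete topology on `K`. -/
  right_const : ∀ ω t, ∃ δ : ℝ≥0, 0 < δ ∧ ∀ s ∈ Icc t (t + δ), X s ω = X t ω
  /-- Trajectories have finitely many jumps on bounded intervals; a jump takes place at `s > 0` if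
  the trajectory is not equal to `X_s` throughout some left neighbourhood of `s`. -/
  finite_jumps : ∀ ω (b : ℝ≥0),
    {s : ℝ≥0 | 0 < s ∧ s ≤ b ∧ ¬ ∀ᶠ r in 𝓝[<] s, X r ω = X s ω}.Finite
  /-- The first jump time after `t` is a random variable on `(Ω, 𝓕_{[t,∞)})`. -/
  measurable_firstJump : ∀ t, Measurable[sigmaAlg X (Ici t)] fun ω => jumpTime X t ω 1
  /-- The joint law of the first jump time `T_1` after `t` and of the position `X_{T_1}`. -/
  firstJump_law : ∀ (t a : ℝ≥0) (b : ℝ≥0∞) (x : K) (A : Set K), t ≤ a → a < b → MeasurableSet A →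
    P t x {ω | a < jumpTime X t ω 1 ∧ jumpTime X t ω 1 < b ∧
        X (jumpTime X t ω 1).toNNReal ω ∈ A} =
      ∫⁻ s in {s : ℝ≥0 | a < s ∧ (s : ℝ≥0∞) < b},
        jumpLaw ν s x A * jumpRate ν s x *
          EReal.exp (-((∫⁻ r in Ioc t s, jumpRate ν r x ∂leb : ℝ≥0∞) : EReal)) ∂leb

/-! ### The jump random measure and the compensated stochastic integral -/

/-- The random measure `p^t(ds dy) = ∑_{n ≥ 1} δ_{(T_n, X_{T_n})}`, the sum being over the finite
jump times after `t`. -/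
def jumpPointMeasure (X : ℝ≥0 → Ω → K) (t : ℝ≥0) (ω : Ω) : Measure (ℝ≥0 × K) :=
  Measure.sum fun n : ℕ =>
    if jumpTime X t ω (n + 1) < ∞ then
      Measure.dirac ((jumpTime X t ω (n + 1)).toNNReal, X (jumpTime X t ω (n + 1)).toNNReal ω)
    else 0

/-- `∫_a^b ∫_K H_r(y) q^t(dr dy)`, the integral over `(a,b] × K` with respect to the compensated
measure `q^t(dr dy) = p^t(dr dy) - ν(r,X_r,dy) dr`. -/
def compensatedIntegral (X : ℝ≥0 → Ω → K) (ν : Kernel (ℝ≥0 × K) K) (t : ℝ≥0)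
    (H : ℝ≥0 → Ω → K → ℝ) (a b : ℝ≥0) (ω : Ω) : ℝ :=
  (∫ q in Ioc a b ×ˢ univ, H q.1 ω q.2 ∂(jumpPointMeasure X t ω)) -
    ∫ r in Ioc a b, (∫ y, H r ω y ∂(ν (r, X r ω))) ∂leb

/-! ### The space of solutions -/

/-- `E^{t,x} ∫_t^T |Y_s|² ds + E^{t,x} ∫_t^T ∫_K |Z_s(y)|² ν(s,X_s,dy) ds`, the square of the norm
of `(Y,Z)`; `μ` is the probability `P^{t,x}`. -/
def normSq (X : ℝ≥0 → Ω → K) (ν : Kernel (ℝ≥0 × K) K) (t T : ℝ≥0)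
    (μ : @Measure Ω (sigmaAlg X (Ici t))) (Y : ℝ≥0 → Ω → ℝ) (Z : ℝ≥0 → Ω → K → ℝ) : ℝ≥0∞ :=
  (∫⁻ ω, (∫⁻ s in Icc t T, ‖Y s ω‖ₑ ^ 2 ∂leb) ∂μ) +
    ∫⁻ ω, (∫⁻ s in Icc t T, (∫⁻ y, ‖Z s ω y‖ₑ ^ 2 ∂(ν (s, X s ω))) ∂leb) ∂μ

/-- `(Y,Z)` belongs to the space `𝕄^{t,x}`: `Y` is progressive, `Z` is measurable for the product
of the predictable σ-algebra and the σ-algebra of `K`, and the norm is finite. A process on `[t,T]`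
is represented by an extension to `[t,∞)`, for instance by zero, with the same measurability; its
values outside `[t,T]` play no role anywhere. -/
structure MemM (X : ℝ≥0 → Ω → K) (ν : Kernel (ℝ≥0 × K) K) (t T : ℝ≥0)
    (μ : @Measure Ω (sigmaAlg X (Ici t))) (Y : ℝ≥0 → Ω → ℝ) (Z : ℝ≥0 → Ω → K → ℝ) : Prop where
  progressive : IsStronglyProgressive (natFiltration X t) fun s : Ici t => Y s
  predictable :
    Measurable[(natFiltration X t).predictable.prod inferInstance]
      fun q : (Ici t × Ω) × K => Z q.1.1 q.1.2 q.2
  normSq_lt_top : normSq X ν t T μ Y Z < ∞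

/-! ### The backward equation -/

/-- Standing assumptions on the generator `f` and the final condition `g`. A map on
`L²(K, ν(s,x,dy))` is represented by a map on functions `z : K → ℝ`, of which only the values at
square integrable `z` matter; by the Lipschitz condition these depend on the class of `z` only. -/
structure IsData (X : ℝ≥0 → Ω → K) (ν : Kernel (ℝ≥0 × K) K) (t T : ℝ≥0)
    (μ : @Measure Ω (sigmaAlg X (Ici t))) (L L' : ℝ≥0)
    (f : ℝ≥0 → K → ℝ → (K → ℝ) → ℝ) (g : K → ℝ) : Prop where
  measurable_final : Measurable g
  final_sq_integrable : ∫⁻ ω, ‖g (X T ω)‖ₑ ^ 2 ∂μ < ∞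
  measurable_generator : ∀ z : K → ℝ, Measurable z → (∃ B : ℝ, ∀ y, |z y| ≤ B) →
    Measurable fun q : Icc (0 : ℝ≥0) T × K × ℝ => f q.1 q.2.1 q.2.2 z
  lipschitz : ∀ s ≤ T, ∀ (x : K) (r r' : ℝ) (z z' : K → ℝ),
    MemLp z 2 (ν (s, x)) → MemLp z' 2 (ν (s, x)) →
    |f s x r z - f s x r' z'| ≤
      L' * |r - r'| + L * Real.sqrt (∫ y, |z y - z' y| ^ 2 ∂(ν (s, x)))
  generator_sq_integrable : ∫⁻ ω, (∫⁻ s in Icc t T, ‖f s (X s ω) 0 0‖ₑ ^ 2 ∂leb) ∂μ < ∞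

/-- `(Y,Z) ∈ 𝕄^{t,x}` solves, almost surely,
`Y_s + ∫_s^T ∫_K Z_r(y) q(dr dy) = g(X_T) + ∫_s^T f(r,X_r,Y_r,Z_r(·)) dr` for all `s ∈ [t,T]`. -/
structure IsSolution (X : ℝ≥0 → Ω → K) (ν : Kernel (ℝ≥0 × K) K) (t T : ℝ≥0)
    (μ : @Measure Ω (sigmaAlg X (Ici t)))
    (f : ℝ≥0 → K → ℝ → (K → ℝ) → ℝ) (g : K → ℝ)
    (Y : ℝ≥0 → Ω → ℝ) (Z : ℝ≥0 → Ω → K → ℝ) : Prop where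
  memM : MemM X ν t T μ Y Z
  equation : ∀ᵐ ω ∂μ, ∀ s ∈ Icc t T,
    Y s ω + compensatedIntegral X ν t Z s T ω =
      g (X T ω) + ∫ r in Ioc s T, f r (X r ω) (Y r ω) (Z r ω) ∂leb

end Setup

end JumpBSDE

end

open JumpBSDE

/-! The estimate is an energy method. The difference `U` of two solutions solves a backward equation
whose driver `D` is a given process. Each path of `U` is an absolutely continuous function plus
finitely many jumps, so an elementary chain rule (`IsFiniteVariation.sq_eq`) expands `U²`; a jump of
size `z` raises the square by `2 U₋ z + z²`. The integrand `2 U₋ H + H²` is predictable, so in mean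
the sum over the jumps becomes an integral against `ν(r,X_r,dy) dr`. The terms `2 U ∫ H dν` cancel
against the compensator in the equation, which leaves (`IsLinearSolution.energy`) `E U_s² + E ∫_s^T
∫ H² dν dr = E ξ² + 2 E ∫_s^T U D dr`. The Lipschitz condition bounds `2 U D` by `F² + c U² + ½ ∫ H²
dν`, where `c = 1 + 2L' + 2L²` and `F` is the difference of the generators along the second
solution. The half is absorbed on the left and a backward Gronwall inequality concludes
(`IsLinearSolution.apriori`). The bound `Λ` on the jump rate enters only qualitatively, so the
constant depends on `T`, `L`, `L'` alone. Part (b) is part (a) with the zero solution as the second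
one.

Two facts have to be extracted from the hypotheses. One is that `ν(s,X_s,dy) ds` compensates the
jump measure on the predictable σ-algebra (`map_jumpKernel_eq`). On a short interval `(c,d]` the
Markov property at `c` and the law of the first jump give the mean number of first jumps into `A` up
to a factor `exp(-Λ(d-c))`; summing over finer and finer grids gives the exact formula on
rectangles, and a π-λ argument extends it. The other is that `f(s,X_s,Y_s,Z_s(·))` is measurable
(`aemeasurable_generator`), although `f` is assumed measurable only for fixed bounded `z`: `Z` is
approximated in mean square by integrands with countably many sections, and the Lipschitz condition
passes to the limit. -/

noncomputable section

namespace JumpBSDE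

/-! ### Step paths and the enumeration of their jumps. -/

section Paths

variable {K Ω : Type*}

/-- The set of jump times of a path. -/
def pathJumps (x : ℝ≥0 → K) : Set ℝ≥0 := {s | 0 < s ∧ ¬ ∀ᶠ r in 𝓝[<] s, x r = x s}

/-- Piecewise constant right-continuous paths with finitely many jumps on bounded intervals. -/
structure IsStepPath (x : ℝ≥0 → K) : Prop where
  right_const : ∀ t, ∃ δ : ℝ≥0, 0 < δ ∧ ∀ s ∈ Icc t (t + δ), x s = x t
  finite_jumps : ∀ b : ℝ≥0, {s : ℝ≥0 | 0 < s ∧ s ≤ b ∧ ¬ ∀ᶠ r in 𝓝[<] s, x r = x s}.Finite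

theorem IsStepPath.finite_inter {x : ℝ≥0 → K} (hx : IsStepPath x) (a b : ℝ≥0) :
    (pathJumps x ∩ Ioc a b).Finite :=
  (hx.finite_jumps b).subset fun _ hs => ⟨hs.1.1, hs.2.2, hs.1.2⟩

theorem IsStepPath.eventually_right {x : ℝ≥0 → K} (hx : IsStepPath x) (t : ℝ≥0) :
    ∀ᶠ r in 𝓝[≥] t, x r = x t := by
  obtain ⟨δ, hδ, h⟩ := hx.right_const t
  filter_upwards [Icc_mem_nhdsGE (lt_add_of_pos_right t hδ)] with r hr using h r hr

theorem IsStepPath.eventually_eq {x : ℝ≥0 → K} (hx : IsStepPath x) {t : ℝ≥0}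
    (ht : t ∉ pathJumps x) : ∀ᶠ r in 𝓝 t, x r = x t := by
  have h2 : ∀ᶠ r in 𝓝[<] t, x r = x t := by
    rcases eq_or_ne t 0 with rfl | h0
    · simp
    · by_contra hcon
      exact ht ⟨pos_iff_ne_zero.2 h0, hcon⟩
  have : 𝓝 t = 𝓝[<] t ⊔ 𝓝[≥] t := by rw [← nhdsWithin_union, Iio_union_Ici, nhdsWithin_univ]
  rw [this]
  exact Filter.eventually_sup.2 ⟨h2, hx.eventually_right t⟩

variable {X : ℝ≥0 → Ω → K} {ω : Ω}

theorem jumpTime_one (u : ℝ≥0) : jumpTime X u ω 1 =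
    sInf {s : ℝ≥0∞ | ∃ r : ℝ≥0, s = r ∧ u < r ∧ X r ω ≠ X u ω} := by
  simp [jumpTime]

theorem jumpTime_succ_of_eq {t u : ℝ≥0} {n : ℕ} (h : jumpTime X t ω n = u) :
    jumpTime X t ω (n + 1) = jumpTime X u ω 1 := by
  rw [jumpTime_one]
  conv_lhs => unfold jumpTime
  simp [h]

theorem jumpTime_succ_of_eq_top {t : ℝ≥0} {n : ℕ} (h : jumpTime X t ω n = ∞) :
    jumpTime X t ω (n + 1) = ∞ := by
  conv_lhs => unfold jumpTime
  simp [h]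

theorem eq_of_lt_firstJump {u s : ℝ≥0} (hus : u ≤ s) (hs : (s : ℝ≥0∞) < jumpTime X u ω 1) :
    X s ω = X u ω := by
  rcases hus.eq_or_lt with rfl | hlt
  · rfl
  by_contra hne
  rw [jumpTime_one] at hs
  exact absurd hs (not_lt.2 (sInf_le ⟨s, rfl, hlt, hne⟩))

theorem firstJump_le_of_mem {u s : ℝ≥0} (hs : s ∈ pathJumps (X · ω)) (hus : u < s) :
    jumpTime X u ω 1 ≤ s := by
  by_contra! hcon
  refine hs.2 ?_
  filter_upwards [Ioo_mem_nhdsLT hus] with r hr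
  exact (eq_of_lt_firstJump hr.1.le ((ENNReal.coe_lt_coe.2 hr.2).trans hcon)).trans
    (eq_of_lt_firstJump hus.le hcon).symm

theorem lt_firstJump (hx : IsStepPath (X · ω)) (u : ℝ≥0) : (u : ℝ≥0∞) < jumpTime X u ω 1 := by
  obtain ⟨δ, hδ, hc⟩ := hx.right_const u
  refine lt_of_lt_of_le (b := ((u + δ : ℝ≥0) : ℝ≥0∞))
    (ENNReal.coe_lt_coe.2 (lt_add_of_pos_right u hδ)) ?_
  rw [jumpTime_one]
  refine le_sInf ?_
  rintro _ ⟨r, rfl, hr, hne⟩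
  by_contra! hcon
  exact hne (hc r ⟨hr.le, (ENNReal.coe_lt_coe.1 hcon).le⟩)

/-- The infimum is attained: had the path its old value at `r`, right-constancy would preserve that
value up to `r + δ` and the first departure would come later than `r`. -/
theorem firstJump_ne (hx : IsStepPath (X · ω)) {u r : ℝ≥0} (h : jumpTime X u ω 1 = r) :
    X r ω ≠ X u ω := by
  intro heq
  have hur : u < r := by simpa [h] using lt_firstJump hx u
  obtain ⟨δ, hδ, hc⟩ := hx.right_const r
  have : ((r + δ : ℝ≥0) : ℝ≥0∞) ≤ jumpTime X u ω 1 := by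
    rw [jumpTime_one]
    refine le_sInf ?_
    rintro _ ⟨q, rfl, hq, hne⟩
    by_contra! hcon
    rcases lt_or_ge q r with hqr | hqr
    · exact hne (eq_of_lt_firstJump hq.le (h ▸ ENNReal.coe_lt_coe.2 hqr))
    · exact hne ((hc q ⟨hqr, (ENNReal.coe_lt_coe.1 hcon).le⟩).trans heq)
  rw [h, ENNReal.coe_le_coe] at this
  exact absurd this (not_le.2 (lt_add_of_pos_right r hδ))

theorem firstJump_mem (hx : IsStepPath (X · ω)) {u r : ℝ≥0} (h : jumpTime X u ω 1 = r) :
    r ∈ pathJumps (X · ω) := by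
  have hur : u < r := by simpa [h] using lt_firstJump hx u
  refine ⟨(zero_le).trans_lt hur, fun hev => ?_⟩
  have : (𝓝[<] r).NeBot := nhdsLT_neBot_of_exists_lt ⟨u, hur⟩
  obtain ⟨q, hq1, hq2⟩ := (hev.and (Ioo_mem_nhdsLT hur)).exists
  exact firstJump_ne hx h
    (hq1.symm.trans (eq_of_lt_firstJump hq2.1.le (h ▸ ENNReal.coe_lt_coe.2 hq2.2)))

/-- The first departure after `v` is a genuine jump of the path, and it lies beyond `u`; the path
cannot stay constant from `u` across it. -/
theorem firstJump_mono (hx : IsStepPath (X · ω)) {u v : ℝ≥0} (huv : u ≤ v) :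
    jumpTime X u ω 1 ≤ jumpTime X v ω 1 := by
  rcases eq_or_ne (jumpTime X v ω 1) ∞ with h | h
  · simp [h]
  lift jumpTime X v ω 1 to ℝ≥0 using h with r hr
  refine firstJump_le_of_mem (firstJump_mem hx hr.symm) (huv.trans_lt ?_)
  simpa [← hr] using lt_firstJump hx v

theorem firstJump_eq_of_lt (hx : IsStepPath (X · ω)) {u v : ℝ≥0} (huv : u ≤ v)
    (hv : (v : ℝ≥0∞) < jumpTime X u ω 1) : jumpTime X v ω 1 = jumpTime X u ω 1 := by
  refine le_antisymm ?_ (firstJump_mono hx huv)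
  rcases eq_or_ne (jumpTime X u ω 1) ∞ with h | h
  · simp [h]
  have h' := h
  lift jumpTime X u ω 1 to ℝ≥0 using h with r hr
  exact firstJump_le_of_mem (firstJump_mem hx hr.symm) (by simpa using hv)

variable (t : ℝ≥0)

theorem le_jumpTime (hx : IsStepPath (X · ω)) (n : ℕ) : (t : ℝ≥0∞) ≤ jumpTime X t ω n := by
  induction n with
  | zero => simp [jumpTime]
  | succ n ih =>
    rcases eq_or_ne (jumpTime X t ω n) ∞ with h | h
    · simp [jumpTime_succ_of_eq_top h]
    · lift jumpTime X t ω n to ℝ≥0 using h with r hr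
      rw [jumpTime_succ_of_eq hr.symm]
      exact ih.trans (lt_firstJump hx r).le

theorem jumpTime_lt_succ (hx : IsStepPath (X · ω)) {n : ℕ} (h : jumpTime X t ω n ≠ ∞) :
    jumpTime X t ω n < jumpTime X t ω (n + 1) := by
  lift jumpTime X t ω n to ℝ≥0 using h with r hr
  rw [jumpTime_succ_of_eq hr.symm]
  exact lt_firstJump hx r

theorem jumpTime_monotone (hx : IsStepPath (X · ω)) : Monotone (jumpTime X t ω) := by
  refine monotone_nat_of_le_succ fun n => ?_
  rcases eq_or_ne (jumpTime X t ω n) ∞ with h | h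
  · simp [jumpTime_succ_of_eq_top h]
  · exact (jumpTime_lt_succ t hx h).le

theorem jumpTime_lt (hx : IsStepPath (X · ω)) {m n : ℕ} (hmn : m < n)
    (h : jumpTime X t ω m ≠ ∞) : jumpTime X t ω m < jumpTime X t ω n :=
  (jumpTime_lt_succ t hx h).trans_le (jumpTime_monotone t hx hmn)

theorem jumpTime_succ_mem (hx : IsStepPath (X · ω)) {n : ℕ} {r : ℝ≥0}
    (h : jumpTime X t ω (n + 1) = r) : r ∈ pathJumps (X · ω) ∩ Ioi t := by
  have hn : jumpTime X t ω n ≠ ∞ := by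
    intro hn
    simp [jumpTime_succ_of_eq_top hn] at h
  have h1 := jumpTime_lt_succ t hx hn
  have h2 := le_jumpTime t hx n
  refine ⟨?_, ?_⟩
  · lift jumpTime X t ω n to ℝ≥0 using hn with u hu
    rw [jumpTime_succ_of_eq hu.symm] at h
    exact firstJump_mem hx h
  · rw [h] at h1
    simpa using h2.trans_lt h1

/-- Non-explosion: otherwise the strictly increasing jump times would give infinitely many jumps in
`(t,b]`. -/
theorem exists_lt_jumpTime (hx : IsStepPath (X · ω)) (b : ℝ≥0) :
    ∃ n, (b : ℝ≥0∞) < jumpTime X t ω n := by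
  by_contra! hcon
  have hne : ∀ n, jumpTime X t ω n ≠ ∞ := fun n => ne_top_of_le_ne_top ENNReal.coe_ne_top (hcon n)
  have hinj : Function.Injective fun n => (jumpTime X t ω (n + 1)).toNNReal := by
    intro m n hmn
    simp only at hmn
    rw [ENNReal.toNNReal_eq_toNNReal_iff' (hne _) (hne _)] at hmn
    by_contra hne'
    rcases lt_or_gt_of_ne hne' with h | h
    · exact (jumpTime_lt t hx (Nat.succ_lt_succ h) (hne _)).ne hmn
    · exact (jumpTime_lt t hx (Nat.succ_lt_succ h) (hne _)).ne' hmn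
  refine (Set.infinite_range_of_injective hinj) ((hx.finite_inter t b).subset ?_)
  rintro _ ⟨n, rfl⟩
  have h := jumpTime_succ_mem t hx (n := n) (ENNReal.coe_toNNReal (hne _)).symm
  refine ⟨h.1, h.2, ?_⟩
  have := hcon (n + 1)
  rw [← ENNReal.coe_toNNReal (hne (n + 1))] at this
  simpa using this

/-- The least index with `T_n ≥ s` works: from the preceding jump time, which is below `s`, the path
cannot remain constant across the jump at `s`. -/
theorem exists_jumpTime_eq (hx : IsStepPath (X · ω)) {s : ℝ≥0}
    (hs : s ∈ pathJumps (X · ω) ∩ Ioi t) : ∃ n, jumpTime X t ω (n + 1) = s := by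
  classical
  have hex : ∃ n, (s : ℝ≥0∞) ≤ jumpTime X t ω n := by
    obtain ⟨n, hn⟩ := exists_lt_jumpTime t hx s
    exact ⟨n, hn.le⟩
  have h1 := Nat.find_spec hex
  rcases h0 : Nat.find hex with _ | m
  · rw [h0] at h1
    simp only [jumpTime, ENNReal.coe_le_coe] at h1
    exact absurd hs.2 (not_lt.2 h1)
  · rw [h0] at h1
    have h2 : jumpTime X t ω m < s := by
      by_contra! hcon
      exact Nat.find_min hex (h0 ▸ Nat.lt_succ_self m) hcon
    refine ⟨m, le_antisymm ?_ h1⟩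
    have h3 := h2.ne_top
    lift jumpTime X t ω m to ℝ≥0 using h3 with u hu
    rw [jumpTime_succ_of_eq hu.symm]
    exact firstJump_le_of_mem hs.1 (by simpa using h2)

/-- The jump times in `(a,b]`. -/
def jumpFinset (hx : IsStepPath (X · ω)) (a b : ℝ≥0) : Finset ℝ≥0 := (hx.finite_inter a b).toFinset

theorem mem_jumpFinset (hx : IsStepPath (X · ω)) {a b s : ℝ≥0} :
    s ∈ jumpFinset hx a b ↔ s ∈ pathJumps (X · ω) ∧ a < s ∧ s ≤ b := by
  simp [jumpFinset]

end Paths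

/-! ### The jump measure as a counting measure, and its approximation by first jumps. -/

section PointMeasure

variable {K Ω : Type*} [MeasurableSpace K] {X : ℝ≥0 → Ω → K} {ω : Ω} (t : ℝ≥0)

/-- The jump times enumerate the jumps after `t` without repetition. The resulting sum no longer
involves the recursion from `t`, so it can be compared with first jumps after other times. -/
theorem jumpPointMeasure_apply (hx : IsStepPath (X · ω)) {S : Set (ℝ≥0 × K)}
    (hS : MeasurableSet S) :
    jumpPointMeasure X t ω S =
      ∑' r : ↥(pathJumps (X · ω) ∩ Ioi t), S.indicator 1 ((r : ℝ≥0), X r ω) := by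
  let N : Set ℕ := {n | jumpTime X t ω (n + 1) < ∞}
  let φ : N → ↥(pathJumps (X · ω) ∩ Ioi t) := fun n =>
    ⟨(jumpTime X t ω (n + 1)).toNNReal,
      jumpTime_succ_mem t hx (n := n) (ENNReal.coe_toNNReal n.2.ne).symm⟩
  have hφ : Function.Bijective φ := by
    constructor
    · rintro ⟨m, hm⟩ ⟨n, hn⟩ hmn
      have h := congrArg Subtype.val hmn
      simp only [φ] at h
      rw [ENNReal.toNNReal_eq_toNNReal_iff' hm.ne hn.ne] at h
      by_contra hne'
      have hne' : m ≠ n := fun h => hne' (Subtype.ext h)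
      rcases lt_or_gt_of_ne hne' with h' | h'
      · exact (jumpTime_lt t hx (Nat.succ_lt_succ h') hm.ne).ne h
      · exact (jumpTime_lt t hx (Nat.succ_lt_succ h') hn.ne).ne' h
    · rintro ⟨s, hs⟩
      obtain ⟨n, hn⟩ := exists_jumpTime_eq t hx hs
      exact ⟨⟨n, by simp [N, hn]⟩, Subtype.ext (by simp [φ, hn])⟩
  rw [← (Equiv.ofBijective φ hφ).tsum_eq, jumpPointMeasure, Measure.sum_apply _ hS]
  rw [← tsum_subtype_eq_of_support_subset (s := N)]
  · refine tsum_congr fun n => ?_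
    have hn : jumpTime X t ω (n + 1) < ∞ := n.2
    simp only [hn, if_true, Measure.dirac_apply' _ hS]
    rfl
  · intro n hn
    by_contra h
    have h' : ¬ jumpTime X t ω (n + 1) < ∞ := h
    simp [h'] at hn

theorem jumpPointMeasure_restrict (hx : IsStepPath (X · ω)) {a b : ℝ≥0} (hta : t ≤ a) :
    (jumpPointMeasure X t ω).restrict (Ioc a b ×ˢ univ) =
      ∑ r ∈ jumpFinset hx a b, Measure.dirac (r, X r ω) := by
  ext S hS
  have hI : MeasurableSet (Ioc a b ×ˢ (univ : Set K)) := measurableSet_Ioc.prod .univ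
  rw [Measure.restrict_apply hS, jumpPointMeasure_apply t hx (hS.inter hI), Measure.finsetSum_apply]
  simp only [Measure.dirac_apply' _ hS]
  rw [tsum_subtype (pathJumps (X · ω) ∩ Ioi t)
    (fun r : ℝ≥0 => (S ∩ Ioc a b ×ˢ univ).indicator (1 : ℝ≥0 × K → ℝ≥0∞) (r, X r ω))]
  rw [tsum_eq_sum (s := jumpFinset hx a b)]
  · refine Finset.sum_congr rfl fun r hr => ?_
    rw [mem_jumpFinset] at hr
    rw [indicator_of_mem (show r ∈ pathJumps (X · ω) ∩ Ioi t from ⟨hr.1, hta.trans_lt hr.2.1⟩)]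
    by_cases h : (r, X r ω) ∈ S <;> simp [indicator, h, hr.2.1, hr.2.2]
  · intro r hr
    rw [mem_jumpFinset] at hr
    by_cases h : r ∈ pathJumps (X · ω) ∩ Ioi t
    · rw [indicator_of_mem h, indicator_of_notMem]
      rintro ⟨-, h', -⟩
      exact hr ⟨h.1, h'.1, h'.2⟩
    · rw [indicator_of_notMem h]

theorem jumpPointMeasure_rect (hx : IsStepPath (X · ω)) {a b : ℝ≥0} (hta : t ≤ a) {A : Set K}
    (hA : MeasurableSet A) :
    jumpPointMeasure X t ω (Ioc a b ×ˢ A) = ∑ r ∈ jumpFinset hx a b, A.indicator 1 (X r ω) := by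
  have h1 : jumpPointMeasure X t ω (Ioc a b ×ˢ A) =
      (jumpPointMeasure X t ω).restrict (Ioc a b ×ˢ univ) (univ ×ˢ A) := by
    rw [Measure.restrict_apply (MeasurableSet.univ.prod hA), prod_inter_prod]
    simp
  rw [h1, jumpPointMeasure_restrict t hx hta, Measure.finsetSum_apply]
  refine Finset.sum_congr rfl fun r _ => ?_
  rw [Measure.dirac_apply' _ (MeasurableSet.univ.prod hA)]
  by_cases h : X r ω ∈ A <;> simp [indicator, h]

open Classical in
/-- The indicator of a first jump after `c` that occurs up to `d` and leads to `A`. -/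
def cellCount (X : ℝ≥0 → Ω → K) (A : Set K) (c d : ℝ≥0) (ω : Ω) : ℝ≥0∞ :=
  if c < jumpTime X c ω 1 ∧ jumpTime X c ω 1 ≤ d ∧ X (jumpTime X c ω 1).toNNReal ω ∈ A then 1 else 0

theorem cellCount_le (hx : IsStepPath (X · ω)) {c d : ℝ≥0} (htc : t ≤ c) {A : Set K}
    (hA : MeasurableSet A) : cellCount X A c d ω ≤ jumpPointMeasure X t ω (Ioc c d ×ˢ A) := by
  rw [cellCount]
  split_ifs with h
  · rw [jumpPointMeasure_rect t hx htc hA]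
    have hr : jumpTime X c ω 1 = ((jumpTime X c ω 1).toNNReal : ℝ≥0∞) :=
      (ENNReal.coe_toNNReal (ne_top_of_le_ne_top ENNReal.coe_ne_top h.2.1)).symm
    set r := (jumpTime X c ω 1).toNNReal
    have hmem : r ∈ jumpFinset hx c d := by
      rw [mem_jumpFinset]
      rw [hr] at h
      exact ⟨firstJump_mem hx hr, by simpa using h.1, by simpa using h.2.1⟩
    refine le_trans ?_ (Finset.single_le_sum (fun _ _ => zero_le) hmem)
    simp [h.2.2]
  · exact zero_le

/-- `cellCount` misses only the second and later jumps in the interval, and here there are none. -/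
theorem cellCount_eq (hx : IsStepPath (X · ω)) {c d : ℝ≥0} (htc : t ≤ c) {A : Set K}
    (hA : MeasurableSet A) (hs : (pathJumps (X · ω) ∩ Ioc c d).Subsingleton) :
    cellCount X A c d ω = jumpPointMeasure X t ω (Ioc c d ×ˢ A) := by
  refine le_antisymm (cellCount_le t hx htc hA) ?_
  rw [jumpPointMeasure_rect t hx htc hA]
  rcases hs.eq_empty_or_singleton with h | ⟨s, h⟩
  · have : jumpFinset hx c d = ∅ := by
      ext r; simp [jumpFinset, h]
    simp [this]
  · have h1 : jumpFinset hx c d = {s} := by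
      ext r; simp [jumpFinset, h]
    have hsm : s ∈ pathJumps (X · ω) ∩ Ioc c d := h ▸ mem_singleton s
    have h2 : jumpTime X c ω 1 ≤ s := firstJump_le_of_mem hsm.1 hsm.2.1
    have h3 : jumpTime X c ω 1 = ((jumpTime X c ω 1).toNNReal : ℝ≥0∞) :=
      (ENNReal.coe_toNNReal (ne_top_of_le_ne_top ENNReal.coe_ne_top h2)).symm
    have h4 := lt_firstJump hx c
    have h5 : (jumpTime X c ω 1).toNNReal = s := by
      have : (jumpTime X c ω 1).toNNReal ∈ pathJumps (X · ω) ∩ Ioc c d := by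
        rw [h3] at h2 h4
        exact ⟨firstJump_mem hx h3, by simpa using h4, le_trans (by simpa using h2) hsm.2.2⟩
      rw [h] at this
      exact this
    rw [h1, Finset.sum_singleton, cellCount]
    by_cases hA' : X s ω ∈ A
    · rw [if_pos ⟨h4, h2.trans (by simpa using hsm.2.2), h5 ▸ hA'⟩]
      simp [hA']
    · simp [hA']

end PointMeasure

/-! ### Measurability of paths, jump times and the jump measure. -/

section Measurability

theorem measurable_apply_nat {Θ E : Type*} [MeasurableSpace Θ] [MeasurableSpace E] {ι : Θ → ℕ}
    (hι : Measurable ι) {F : ℕ → Θ → E} (hF : ∀ k, Measurable (F k)) :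
    Measurable fun θ => F (ι θ) θ := by
  have : Measurable fun q : ℕ × Θ => F q.1 q.2 := measurable_from_prod_countable_right hF
  exact this.comp (hι.prodMk measurable_id)

/-- Only first jump times after deterministic times are known to be measurable. A point of the dense
sequence lying strictly between `T_n` and `T_{n+1}` has `T_{n+1}` as its first jump time, and later
points can only give larger values. -/
theorem jumpTime_succ_eq_iInf {K Ω : Type*} {X : ℝ≥0 → Ω → K} {t : ℝ≥0} {ω : Ω} (hx : IsStepPath (X · ω)) (n : ℕ) :
    jumpTime X t ω (n + 1) = ⨅ k : ℕ,
      if jumpTime X t ω n < (TopologicalSpace.denseSeq ℝ≥0 k : ℝ≥0) then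
        jumpTime X (TopologicalSpace.denseSeq ℝ≥0 k) ω 1 else ∞ := by
  rcases eq_or_ne (jumpTime X t ω n) ∞ with h | h
  · simp [jumpTime_succ_of_eq_top h, h]
  lift jumpTime X t ω n to ℝ≥0 using h with u hu
  rw [jumpTime_succ_of_eq hu.symm]
  refine le_antisymm (le_iInf fun k => ?_) ?_
  · split_ifs with h
    · exact firstJump_mono hx (by simpa using h.le)
    · exact le_top
  · obtain ⟨v, huv, hv⟩ := ENNReal.lt_iff_exists_nnreal_btwn.1 (lt_firstJump hx u)
    obtain ⟨k, hk⟩ := (TopologicalSpace.denseRange_denseSeq ℝ≥0).exists_mem_open isOpen_Ioo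
      (nonempty_Ioo.2 (ENNReal.coe_lt_coe.1 huv))
    refine (iInf_le _ k).trans ?_
    rw [if_pos (by simpa using hk.1)]
    exact (firstJump_eq_of_lt hx hk.1.le ((ENNReal.coe_lt_coe.2 hk.2).trans hv)).le

variable {K Ω : Type*} [MeasurableSpace K] [MeasurableSpace Ω] {X : ℝ≥0 → Ω → K} {t : ℝ≥0}

theorem tendsto_floor_grid (s : ℝ≥0) :
    Tendsto (fun m : ℕ => ((⌊(m + 1) * s⌋₊ + 1 : ℕ) : ℝ≥0) / (m + 1)) atTop (𝓝[≥] s) := by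
  refine tendsto_nhdsWithin_iff.2 ⟨?_, Eventually.of_forall fun m => ?_⟩
  · have h1 : Tendsto (fun m : ℕ => s + 1 / ((m : ℝ≥0) + 1)) atTop (𝓝 (s + 0)) :=
      tendsto_const_nhds.add (by
        have := tendsto_one_div_add_atTop_nhds_zero_nat (𝕜 := ℝ)
        rw [← NNReal.tendsto_coe]
        simpa using this)
    rw [add_zero] at h1
    refine tendsto_of_tendsto_of_tendsto_of_le_of_le tendsto_const_nhds h1 (fun m => ?_)
      (fun m => ?_)
    · have hm : (0 : ℝ≥0) < m + 1 := by positivity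
      simp only [le_div_iff₀ hm, Nat.cast_add, Nat.cast_one]
      rw [mul_comm]
      exact (Nat.lt_floor_add_one _).le
    · have hm : (0 : ℝ≥0) < m + 1 := by positivity
      simp only [Nat.cast_add, Nat.cast_one, add_div]
      gcongr
      rw [div_le_iff₀ hm, mul_comm s]
      exact Nat.floor_le zero_le
  · have hm : (0 : ℝ≥0) < m + 1 := by positivity
    simp only [mem_Ici, le_div_iff₀ hm, Nat.cast_add, Nat.cast_one]
    rw [mul_comm]
    exact (Nat.lt_floor_add_one _).le

/-- Time is discretised from the right. As `K` carries no topology, convergence is replaced by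
eventual equality, which right-constancy supplies. The maximum with `t` keeps to times at which `X`
is known to be measurable. -/
theorem measurable_path (hx : ∀ ω, IsStepPath (X · ω)) (hX : ∀ s, t ≤ s → Measurable (X s)) :
    Measurable fun θ : Ω × ℝ≥0 => X (max t θ.2) θ.1 := by
  let d : ℕ → ℝ≥0 → ℝ≥0 := fun m s => ((⌊(m + 1) * max t s⌋₊ + 1 : ℕ) : ℝ≥0) / (m + 1)
  let F : ℕ → Ω × ℝ≥0 → K := fun m θ => X (max t (d m θ.2)) θ.1
  have hF : ∀ m, Measurable (F m) := by
    intro m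
    have hι : Measurable fun θ : Ω × ℝ≥0 => ⌊((m : ℝ≥0) + 1) * max t θ.2⌋₊ :=
      Nat.measurable_floor.comp (by fun_prop)
    exact measurable_apply_nat (F := fun k (θ : Ω × ℝ≥0) =>
        X (max t (((k + 1 : ℕ) : ℝ≥0) / (m + 1))) θ.1) hι
      fun k => (hX _ (le_max_left _ _)).comp measurable_fst
  have hev : ∀ θ : Ω × ℝ≥0, ∀ᶠ m in atTop, F m θ = X (max t θ.2) θ.1 := by
    intro θ
    have h1 := (tendsto_floor_grid (max t θ.2)).eventually ((hx θ.1).eventually_right _)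
    filter_upwards [h1, (tendsto_floor_grid (max t θ.2)).eventually self_mem_nhdsWithin] with m hm hm'
    have : t ≤ d m θ.2 := (le_max_left _ _).trans hm'
    simp only [F, max_eq_right this]
    exact hm
  intro A hA
  have : (fun θ : Ω × ℝ≥0 => X (max t θ.2) θ.1) ⁻¹' A = ⋃ N : ℕ, ⋂ m ≥ N, F m ⁻¹' A := by
    ext θ
    have : (∀ᶠ m in atTop, F m θ ∈ A) ↔ X (max t θ.2) θ.1 ∈ A := by
      constructor
      · intro h
        obtain ⟨m, h1, h2⟩ := (h.and (hev θ)).exists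
        exact h2 ▸ h1
      · intro h
        filter_upwards [hev θ] with m hm
        rwa [hm]
    simp only [mem_preimage, mem_iUnion, mem_iInter, ← this, eventually_atTop]
  rw [this]
  exact .iUnion fun N => .iInter fun m => .iInter fun _ => hF m hA

theorem measurable_jumpTime {K : Type*} {X : ℝ≥0 → Ω → K} (hx : ∀ ω, IsStepPath (X · ω))
    (hτ : ∀ u, t ≤ u → Measurable fun ω => jumpTime X u ω 1) (n : ℕ) :
    Measurable fun ω => jumpTime X t ω n := by
  induction n with
  | zero => simp [jumpTime]
  | succ n ih =>
    simp_rw [fun ω => jumpTime_succ_eq_iInf (t := t) (hx ω) n]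
    refine Measurable.iInf fun k => ?_
    by_cases hk : t ≤ TopologicalSpace.denseSeq ℝ≥0 k
    · exact Measurable.ite (measurableSet_lt ih measurable_const) (hτ _ hk) measurable_const
    -- Dense points below `t` never contribute, because `T_n ≥ t`; measurability of their first jump
    -- times is not available.
    · have : ∀ ω, ¬ jumpTime X t ω n < (TopologicalSpace.denseSeq ℝ≥0 k : ℝ≥0) := fun ω h =>
        hk (by simpa using (le_jumpTime t (hx ω) n).trans h.le)
      simp [this]

theorem measurable_path_at (hx : ∀ ω, IsStepPath (X · ω)) (hX : ∀ s, t ≤ s → Measurable (X s))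
    {τ : Ω → ℝ≥0} (hτ : Measurable τ) : Measurable fun ω => X (max t (τ ω)) ω :=
  (measurable_path hx hX).comp (measurable_id.prodMk hτ)

theorem measurable_cellCount (hx : ∀ ω, IsStepPath (X · ω)) (hX : ∀ s, t ≤ s → Measurable (X s))
    (hτ : ∀ u, t ≤ u → Measurable fun ω => jumpTime X u ω 1) {A : Set K} (hA : MeasurableSet A)
    {c d : ℝ≥0} (htc : t ≤ c) : Measurable fun ω => cellCount X A c d ω := by
  classical
  have h1 := hτ c htc
  have heq : ∀ ω, (c < jumpTime X c ω 1 ∧ jumpTime X c ω 1 ≤ d ∧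
      X (jumpTime X c ω 1).toNNReal ω ∈ A) ↔ (c < jumpTime X c ω 1 ∧ jumpTime X c ω 1 ≤ d ∧
      X (max t (jumpTime X c ω 1).toNNReal) ω ∈ A) := by
    intro ω
    refine and_congr_right fun h2 => and_congr_right fun h3 => ?_
    rw [max_eq_right]
    rw [← ENNReal.coe_le_coe, ENNReal.coe_toNNReal (ne_top_of_le_ne_top ENNReal.coe_ne_top h3)]
    exact (ENNReal.coe_le_coe.2 htc).trans h2.le
  unfold cellCount
  simp_rw [heq]
  refine Measurable.ite ?_ measurable_const measurable_const
  refine (measurableSet_lt measurable_const h1).inter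
    ((measurableSet_le h1 measurable_const).inter ?_)
  exact measurable_path_at hx hX h1.ennreal_toNNReal hA

variable (X t) in
/-- The mark of the jump measure carried by the `n`-th jump, if it occurs up to time `T`. -/
def jumpKernelAux (T : ℝ≥0) (n : ℕ) (hm : Measurable fun ω => jumpTime X t ω (n + 1))
    (hp : Measurable fun ω => X (max t (jumpTime X t ω (n + 1)).toNNReal) ω) :
    Kernel Ω (ℝ≥0 × K) :=
  open Classical in
  Kernel.piecewise (measurableSet_le hm (measurable_const (a := (T : ℝ≥0∞))))
    (Kernel.deterministic (fun ω => ((jumpTime X t ω (n + 1)).toNNReal,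
      X (max t (jumpTime X t ω (n + 1)).toNNReal) ω)) (hm.ennreal_toNNReal.prodMk hp)) 0

/-- The jump measure on `(t,T] × K` as a kernel. -/
theorem exists_jumpKernel (hx : ∀ ω, IsStepPath (X · ω)) (hX : ∀ s, t ≤ s → Measurable (X s))
    (hτ : ∀ u, t ≤ u → Measurable fun ω => jumpTime X u ω 1) (T : ℝ≥0) :
    ∃ κ : Kernel Ω (ℝ≥0 × K), IsSFiniteKernel κ ∧
      ∀ ω, κ ω = (jumpPointMeasure X t ω).restrict (Ioc t T ×ˢ univ) := by
  classical
  have hm := measurable_jumpTime hx hτ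
  have hp : ∀ n, Measurable fun ω => X (max t (jumpTime X t ω (n + 1)).toNNReal) ω := fun n =>
    measurable_path_at hx hX (hm (n + 1)).ennreal_toNNReal
  have hs : ∀ n, IsSFiniteKernel (jumpKernelAux X t T n (hm (n + 1)) (hp n)) := fun n => by
    unfold jumpKernelAux
    infer_instance
  refine ⟨Kernel.sum fun n => jumpKernelAux X t T n (hm (n + 1)) (hp n), inferInstance,
    fun ω => ?_⟩
  · rw [Kernel.sum_apply, jumpPointMeasure, Measure.restrict_sum _ (measurableSet_Ioc.prod .univ)]
    congr 1
    ext1 n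
    rw [jumpKernelAux, Kernel.piecewise_apply]
    have h0 := le_jumpTime t (hx ω) (n + 1)
    by_cases h : jumpTime X t ω (n + 1) ≤ T
    · have hne : jumpTime X t ω (n + 1) ≠ ∞ := ne_top_of_le_ne_top ENNReal.coe_ne_top h
      have hr := (ENNReal.coe_toNNReal hne).symm
      have hlt := (jumpTime_succ_mem t (hx ω) hr).2
      rw [if_pos (show ω ∈ {a | jumpTime X t a (n + 1) ≤ (T : ℝ≥0∞)} from h),
        if_pos (lt_top_iff_ne_top.2 hne), Kernel.deterministic_apply,
        Measure.restrict_eq_self_of_ae_mem, max_eq_right (le_of_lt hlt)]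
      refine (ae_dirac_iff (p := (· ∈ Ioc t T ×ˢ univ)) (measurableSet_Ioc.prod .univ)).2 ?_
      refine ⟨⟨hlt, ?_⟩, mem_univ _⟩
      rw [hr] at h
      simpa using h
    · rw [if_neg (show ω ∉ {a | jumpTime X t a (n + 1) ≤ (T : ℝ≥0∞)} from h)]
      split_ifs with h'
      · symm
        simp only [zero_apply]
        rw [Measure.restrict_eq_zero, Measure.dirac_apply' _ (measurableSet_Ioc.prod .univ)]
        refine indicator_of_notMem ?_ _
        rintro ⟨⟨-, h''⟩, -⟩
        refine h ?_
        rw [← ENNReal.coe_toNNReal h'.ne]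
        simpa using h''
      · simp

end Measurability

/-! ### Lebesgue measure on the half-line. -/

section TimeMeasure

instance : SFinite leb := by unfold leb; infer_instance

theorem leb_apply {s : Set ℝ≥0} (hs : MeasurableSet s) :
    leb s = volume (Real.toNNReal ⁻¹' s ∩ Ici 0) := by
  rw [leb, Measure.map_apply measurable_real_toNNReal hs,
    Measure.restrict_apply (measurable_real_toNNReal hs)]

theorem leb_Ioc (a b : ℝ≥0) : leb (Ioc a b) = (b - a : ℝ≥0) := by
  have : Real.toNNReal ⁻¹' Ioc a b ∩ Ici 0 = Ioc (a : ℝ) b := by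
    ext x
    simp only [mem_inter_iff, mem_preimage, mem_Ioc, mem_Ici]
    constructor
    · rintro ⟨⟨h1, h2⟩, h3⟩
      rw [← NNReal.coe_lt_coe, Real.coe_toNNReal x h3] at h1
      rw [← NNReal.coe_le_coe, Real.coe_toNNReal x h3] at h2
      exact ⟨h1, h2⟩
    · rintro ⟨h1, h2⟩
      have h3 : 0 ≤ x := a.2.trans h1.le
      rw [← NNReal.coe_lt_coe, ← NNReal.coe_le_coe, Real.coe_toNNReal x h3]
      exact ⟨⟨h1, h2⟩, h3⟩
  rw [leb_apply measurableSet_Ioc, this, Real.volume_Ioc, ENNReal.ofReal, ← NNReal.sub_def]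

instance : NullSingletonClass leb where
  measure_singleton a := by
    have : Real.toNNReal ⁻¹' {a} ∩ Ici 0 ⊆ {(a : ℝ)} := by
      rintro x ⟨h1, h2⟩
      simp only [mem_preimage, mem_singleton_iff] at h1 ⊢
      rw [← h1, Real.coe_toNNReal x h2]
    rw [leb_apply (measurableSet_singleton a)]
    exact measure_mono_null this (by simp)

instance (a b : ℝ≥0) : IsFiniteMeasure (leb.restrict (Ioc a b)) :=
  ⟨by rw [Measure.restrict_apply_univ, leb_Ioc]; exact ENNReal.coe_lt_top⟩

theorem leb_restrict_Icc (a b : ℝ≥0) : leb.restrict (Icc a b) = leb.restrict (Ioc a b) :=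
  Measure.restrict_congr_set Ioc_ae_eq_Icc.symm

end TimeMeasure

/-! ### The Markov property for all events of the future. -/

section Markov

variable {K Ω : Type*} [MeasurableSpace K] {X : ℝ≥0 → Ω → K}
  {P : (t : ℝ≥0) → K → @Measure Ω (sigmaAlg X (Ici t))} {ν : Kernel (ℝ≥0 × K) K}

theorem measurable_sigmaAlg {I : Set ℝ≥0} {s : ℝ≥0} (hs : s ∈ I) : Measurable[sigmaAlg X I] (X s) :=
  Measurable.of_comap_le (le_iSup₂_of_le s hs le_rfl)

theorem IsJumpMarkov.isStepPath (h : IsJumpMarkov X P ν) (ω : Ω) : IsStepPath (X · ω) :=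
  ⟨h.right_const ω, h.finite_jumps ω⟩

theorem IsJumpMarkov.measure_inter (h : IsJumpMarkov X P ν) {u t s : ℝ≥0} (hut : u ≤ t)
    (hts : t ≤ s) (x : K) {A : Set K} (hA : MeasurableSet A) {G : Set Ω}
    (hG : MeasurableSet[sigmaAlg X (Icc u t)] G) :
    P u x (G ∩ X s ⁻¹' A) = ∫⁻ ω in G, P t (X t ω) (X s ⁻¹' A) ∂(P u x) := by
  have hle : sigmaAlg X (Icc u t) ≤ sigmaAlg X (Ici u) := sigmaAlg_mono X Icc_subset_Ici_self
  have := h.isProbabilityMeasure u x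
  have hP := h.isProbabilityMeasure t
  have hS : MeasurableSet[sigmaAlg X (Ici u)] (X s ⁻¹' A) :=
    measurable_sigmaAlg (hut.trans hts) hA
  have hint : Integrable ((X s ⁻¹' A).indicator fun _ => (1 : ℝ)) (P u x) :=
    (integrable_const _).indicator hS
  have h1 := setIntegral_condExp hle hint hG
  have h2 : (P u x)[(X s ⁻¹' A).indicator fun _ => (1 : ℝ) | sigmaAlg X (Icc u t)] =ᵐ[P u x]
      fun ω => (P t (X t ω) (X s ⁻¹' A)).toReal := h.markov u t s hut hts A hA x
  rw [setIntegral_congr_ae (hle _ hG)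
    (h2.mono fun ω hω _ => hω), setIntegral_indicator hS, setIntegral_const] at h1
  have hm : Measurable[sigmaAlg X (Ici u)] fun ω => P t (X t ω) (X s ⁻¹' A) :=
    (h.measurable_transition t s hts A hA).comp (measurable_sigmaAlg hut)
  rw [integral_toReal hm.aemeasurable.restrict
    (Eventually.of_forall fun ω => measure_lt_top _ _)] at h1
  simp only [smul_eq_mul, mul_one, Measure.real] at h1
  refine ((ENNReal.toReal_eq_toReal_iff' ?_ (measure_ne_top _ _)).1 h1).symm
  refine ne_top_of_le_ne_top (measure_ne_top (P u x) G) ?_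
  calc _ ≤ ∫⁻ ω in G, 1 ∂(P u x) := lintegral_mono fun ω => prob_le_one
    _ = _ := by simp

/-- The transition kernel from time `t` to time `s`. -/
def transitionKernel (h : IsJumpMarkov X P ν) {t s : ℝ≥0} (hts : t ≤ s) : Kernel K K where
  toFun y := @Measure.map _ _ (sigmaAlg X (Ici t)) _ (X s) (P t y)
  measurable' := by
    refine Measure.measurable_of_measurable_coe _ fun A hA => ?_
    simp_rw [@Measure.map_apply _ _ (sigmaAlg X (Ici t)) _ _ _ (measurable_sigmaAlg hts) _ hA]
    exact h.measurable_transition t s hts A hA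

/-- The law of `X s` on `G` is the law of `X t` on `G` followed by the transition kernel: this is
`measure_inter` on sets, and integrals of `φ` follow. -/
theorem IsJumpMarkov.lintegral_comp (h : IsJumpMarkov X P ν) {u t s : ℝ≥0} (hut : u ≤ t)
    (hts : t ≤ s) (x : K) {φ : K → ℝ≥0∞} (hφ : Measurable φ) {G : Set Ω}
    (hG : MeasurableSet[sigmaAlg X (Icc u t)] G) :
    ∫⁻ ω in G, φ (X s ω) ∂(P u x) =
      ∫⁻ ω in G, ∫⁻ ω', φ (X s ω') ∂(P t (X t ω)) ∂(P u x) := by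
  have hXs : Measurable[sigmaAlg X (Ici u)] (X s) := measurable_sigmaAlg (hut.trans hts)
  have hXt : Measurable[sigmaAlg X (Ici u)] (X t) := measurable_sigmaAlg hut
  have hXs' : Measurable[sigmaAlg X (Ici t)] (X s) := measurable_sigmaAlg hts
  have hGm : MeasurableSet[sigmaAlg X (Ici u)] G := sigmaAlg_mono X Icc_subset_Ici_self _ hG
  let _ : MeasurableSpace Ω := sigmaAlg X (Ici u)
  have key : ((P u x).restrict G).map (X s) =
      (((P u x).restrict G).map (X t)).bind (transitionKernel h hts) := by
    ext A hA
    rw [Measure.map_apply hXs hA, Measure.bind_apply hA (Kernel.aemeasurable _),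
      lintegral_map (Kernel.measurable_coe _ hA) hXt, Measure.restrict_apply (hXs hA), inter_comm,
      h.measure_inter hut hts x hA hG]
    refine lintegral_congr fun ω => ?_
    exact (@Measure.map_apply _ _ (sigmaAlg X (Ici t)) _ _ _ hXs' _ hA).symm
  rw [← lintegral_map hφ hXs, key, Measure.lintegral_bind (Kernel.aemeasurable _) hφ.aemeasurable,
    lintegral_map hφ.lintegral_kernel hXt]
  exact lintegral_congr fun ω => @lintegral_map _ _ (sigmaAlg X (Ici t)) _ _ _ _ hφ hXs'

/-- The Markov property at time `t` for an event `B`. -/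
def IsMarkovEvent (X : ℝ≥0 → Ω → K) (P : (t : ℝ≥0) → K → @Measure Ω (sigmaAlg X (Ici t)))
    (t : ℝ≥0) (B : Set Ω) : Prop :=
  (Measurable fun y => P t y B) ∧ ∀ u ≤ t, ∀ x, ∀ G, MeasurableSet[sigmaAlg X (Icc u t)] G →
    P u x (G ∩ B) = ∫⁻ ω in G, P t (X t ω) B ∂(P u x)

theorem IsJumpMarkov.isMarkovEvent_univ (h : IsJumpMarkov X P ν) (t : ℝ≥0) :
    IsMarkovEvent X P t univ := by
  have := h.isProbabilityMeasure
  exact ⟨by simp, fun u _ x G _ => by simp⟩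

/-- Conditioning at time `s` turns the event into the function `ψ` of the single coordinate `X s`,
to which the Markov property between `t` and `s` applies. -/
theorem IsJumpMarkov.isMarkovEvent_inter (h : IsJumpMarkov X P ν) {t s : ℝ≥0} (hts : t ≤ s)
    {A : Set K} (hA : MeasurableSet A) {B : Set Ω} (hB : IsMarkovEvent X P s B) :
    IsMarkovEvent X P t (X s ⁻¹' A ∩ B) := by
  let ψ : K → ℝ≥0∞ := A.indicator fun y => P s y B
  have hψ : Measurable ψ := hB.1.indicator hA
  have h0 : ∀ u ≤ s, ∀ x, ∀ G, MeasurableSet[sigmaAlg X (Icc u s)] G →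
      P u x (G ∩ (X s ⁻¹' A ∩ B)) = ∫⁻ ω in G, ψ (X s ω) ∂(P u x) := by
    intro u hu x G hG
    have hA' : MeasurableSet[sigmaAlg X (Icc u s)] (X s ⁻¹' A) :=
      measurable_sigmaAlg (right_mem_Icc.2 hu) hA
    have hA'' : MeasurableSet[sigmaAlg X (Ici u)] (X s ⁻¹' A) := measurable_sigmaAlg hu hA
    rw [← inter_assoc, hB.2 u hu x _ (hG.inter hA')]
    rw [inter_comm G, ← Measure.restrict_restrict hA'', ← lintegral_indicator hA'']
    rfl
  have h1 : ∀ y, P t y (X s ⁻¹' A ∩ B) = ∫⁻ z, ψ z ∂(transitionKernel h hts y) := by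
    intro y
    have := h0 t hts y univ MeasurableSet.univ
    rw [univ_inter, Measure.restrict_univ] at this
    rw [this]
    exact (@lintegral_map _ _ (sigmaAlg X (Ici t)) _ _ _ _ hψ (measurable_sigmaAlg hts)).symm
  refine ⟨?_, fun u hu x G hG => ?_⟩
  · simp_rw [h1]
    exact hψ.lintegral_kernel
  · rw [h0 u (hu.trans hts) x G (sigmaAlg_mono X (Icc_subset_Icc_right hts) _ hG),
      h.lintegral_comp hu hts x hψ hG]
    refine lintegral_congr fun ω => ?_
    rw [h1]
    exact (@lintegral_map _ _ (sigmaAlg X (Ici t)) _ _ _ _ hψ (measurable_sigmaAlg hts)).symm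

theorem IsJumpMarkov.isMarkovEvent_cylinder (h : IsJumpMarkov X P ν) (f : ℝ≥0 → Set Ω)
    (S : Finset ℝ≥0) (hf : ∀ s ∈ S, MeasurableSet[MeasurableSpace.comap (X s) inferInstance] (f s))
    (t : ℝ≥0) (ht : ∀ s ∈ S, t ≤ s) : IsMarkovEvent X P t (⋂ s ∈ S, f s) := by
  classical
  induction S using Finset.induction_on_min generalizing t with
  | empty => simpa using h.isMarkovEvent_univ t
  | insert a S ha ih =>
    obtain ⟨A, hA, hfa⟩ := hf a (Finset.mem_insert_self a S)
    rw [Finset.set_biInter_insert, ← hfa]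
    exact h.isMarkovEvent_inter (ht a (Finset.mem_insert_self a S)) hA
      (ih (fun s hs => hf s (Finset.mem_insert_of_mem hs)) a fun s hs => (ha s hs).le)

/-- A π-λ argument from cylinders. The general form is needed because events about the first jump
time involve uncountably many coordinates. -/
theorem IsJumpMarkov.isMarkovEvent (h : IsJumpMarkov X P ν) (t : ℝ≥0) (B : Set Ω)
    (hB : MeasurableSet[sigmaAlg X (Ici t)] B) : IsMarkovEvent X P t B := by
  have hP := h.isProbabilityMeasure
  have hXt : ∀ u ≤ t, Measurable[sigmaAlg X (Ici u)] (X t) := fun u hu => measurable_sigmaAlg hu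
  have hle : ∀ u ≤ t, sigmaAlg X (Ici t) ≤ sigmaAlg X (Ici u) := fun u hu =>
    sigmaAlg_mono X (Ici_subset_Ici.2 hu)
  have hle' : ∀ u ≤ t, sigmaAlg X (Icc u t) ≤ sigmaAlg X (Ici u) := fun u hu =>
    sigmaAlg_mono X Icc_subset_Ici_self
  induction B, hB using MeasurableSpace.induction_on_inter
    (generateFrom_piiUnionInter_measurableSet (fun s => MeasurableSpace.comap (X s) inferInstance)
      (Ici t)).symm
    (isPiSystem_piiUnionInter _ (fun s =>
      @MeasurableSpace.isPiSystem_measurableSet Ω (MeasurableSpace.comap (X s) inferInstance)) _) with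
  | empty => exact ⟨by simp, by simp⟩
  | basic B hB =>
    obtain ⟨S, hS, f, hf, rfl⟩ := hB
    exact h.isMarkovEvent_cylinder f S hf t hS
  | compl B hB ih =>
    have hc : ∀ y, P t y Bᶜ = 1 - P t y B := by
      let _ : MeasurableSpace Ω := sigmaAlg X (Ici t)
      exact fun y => prob_compl_eq_one_sub hB
    refine ⟨?_, fun u hu x G hG => ?_⟩
    · simp_rw [hc]
      exact measurable_const.sub ih.1
    · have h1 := ih.2 u hu x G hG
      have h2 : P u x (G ∩ B) + P u x (G ∩ Bᶜ) = P u x G := by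
        rw [← sdiff_eq]; exact measure_inter_add_sdiff G (hle u hu _ hB)
      have h3 : ∫⁻ ω in G, P t (X t ω) B ∂(P u x) + ∫⁻ ω in G, P t (X t ω) Bᶜ ∂(P u x) =
          P u x G := by
        have hm : Measurable[sigmaAlg X (Ici u)] fun ω => P t (X t ω) B := ih.1.comp (hXt u hu)
        rw [← lintegral_add_left hm]
        have hadd : ∀ y, P t y B + P t y Bᶜ = 1 := fun y =>
          by
          rw [hc, add_tsub_cancel_of_le]
          exact prob_le_one
        simp [hadd]
      rw [h1, ← h3] at h2
      -- The complement is obtained by cancelling the finite term of `B` from two decompositions of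
      -- `P u x G`.
      refine (ENNReal.add_right_inj ?_).1 h2
      rw [← h1]
      exact measure_ne_top _ _
  | iUnion f hd hf ih =>
    refine ⟨?_, fun u hu x G hG => ?_⟩
    · simp_rw [fun y => measure_iUnion (μ := P t y) hd hf]
      exact Measurable.tsum fun i => (ih i).1
    · have hGm := hle' u hu _ hG
      rw [inter_iUnion, measure_iUnion (fun i j hij => (hd hij).mono inter_subset_right
        inter_subset_right) fun i => hGm.inter (hle u hu _ (hf i))]
      simp_rw [fun y => measure_iUnion (μ := P t y) hd hf]
      have hm : ∀ i, Measurable[sigmaAlg X (Ici u)] fun ω => P t (X t ω) (f i) := fun i =>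
        (ih i).1.comp (hXt u hu)
      rw [lintegral_tsum fun i => (hm i).aemeasurable]
      exact tsum_congr fun i => (ih i).2 u hu x G hG

end Markov

/-! ### Two-sided bounds for the first jump in a short interval. -/

section FirstJump

variable {K Ω : Type*} [MeasurableSpace K] {X : ℝ≥0 → Ω → K}
  {P : (t : ℝ≥0) → K → @Measure Ω (sigmaAlg X (Ici t))} {ν : Kernel (ℝ≥0 × K) K}

/-- Multiplication by the rate removes the convention made for rate zero. Finiteness is needed to
cancel the normalisation in `ℝ≥0∞`. -/
theorem jumpLaw_mul_jumpRate {s : ℝ≥0} {y : K} (h : jumpRate ν s y ≠ ∞) (A : Set K) :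
    jumpLaw ν s y A * jumpRate ν s y = ν (s, y) A := by
  rw [jumpLaw]
  split_ifs with h0
  · rw [h0, mul_zero]
    exact (measure_mono_null (subset_univ A) h0).symm
  · rw [Measure.smul_apply, smul_eq_mul, mul_right_comm, ENNReal.inv_mul_cancel h0 h, one_mul]

/-- The law is given on open intervals; the half-open one is the difference of `(c,∞)` and `(d,∞)`,
all masses being finite. -/
theorem IsJumpMarkov.firstJump_Ioc (h : IsJumpMarkov X P ν) {c d : ℝ≥0} (hcd : c ≤ d) (y : K)
    {A : Set K} (hA : MeasurableSet A) :
    P c y {ω | c < jumpTime X c ω 1 ∧ jumpTime X c ω 1 ≤ d ∧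
        X (jumpTime X c ω 1).toNNReal ω ∈ A} =
      ∫⁻ s in Ioc c d, jumpLaw ν s y A * jumpRate ν s y *
          EReal.exp (-((∫⁻ r in Ioc c s, jumpRate ν r y ∂leb : ℝ≥0∞) : EReal)) ∂leb := by
  have := h.isProbabilityMeasure
  have h1 := h.firstJump_law c c ∞ y A le_rfl ENNReal.coe_lt_top hA
  have h2 := h.firstJump_law c d ∞ y A hcd ENNReal.coe_lt_top hA
  have hm := h.measurable_firstJump c
  have hT : ∀ (r : ℝ≥0), {s : ℝ≥0 | r < s ∧ (s : ℝ≥0∞) < ∞} = Ioi r := fun r => by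
    ext; simp
  rw [hT] at h1 h2
  have hsplit : {ω | c < jumpTime X c ω 1 ∧ jumpTime X c ω 1 < ∞ ∧
        X (jumpTime X c ω 1).toNNReal ω ∈ A} =
      {ω | c < jumpTime X c ω 1 ∧ jumpTime X c ω 1 ≤ d ∧
        X (jumpTime X c ω 1).toNNReal ω ∈ A} ∪ {ω | d < jumpTime X c ω 1 ∧
        jumpTime X c ω 1 < ∞ ∧ X (jumpTime X c ω 1).toNNReal ω ∈ A} := by
    ext ω
    simp only [mem_ofPred_eq, mem_union]
    constructor
    · rintro ⟨h1, h2, h3⟩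
      rcases le_or_gt (jumpTime X c ω 1) d with h4 | h4
      · exact Or.inl ⟨h1, h4, h3⟩
      · exact Or.inr ⟨h4, h2, h3⟩
    · rintro (⟨h1, h2, h3⟩ | ⟨h1, h2, h3⟩)
      · exact ⟨h1, h2.trans_lt ENNReal.coe_lt_top, h3⟩
      · exact ⟨(ENNReal.coe_le_coe.2 hcd).trans_lt h1, h2, h3⟩
  have hmeas : ∀ ω, (d < jumpTime X c ω 1 ∧ jumpTime X c ω 1 < ∞ ∧
        X (jumpTime X c ω 1).toNNReal ω ∈ A) ↔ (d < jumpTime X c ω 1 ∧ jumpTime X c ω 1 < ∞ ∧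
        X (max c (jumpTime X c ω 1).toNNReal) ω ∈ A) := by
    intro ω
    refine and_congr_right fun h3 => and_congr_right fun h4 => ?_
    rw [max_eq_right]
    rw [← ENNReal.coe_le_coe, ENNReal.coe_toNNReal h4.ne]
    exact (ENNReal.coe_le_coe.2 hcd).trans h3.le
  have hE : MeasurableSet[sigmaAlg X (Ici c)] {ω | d < jumpTime X c ω 1 ∧
        jumpTime X c ω 1 < ∞ ∧ X (jumpTime X c ω 1).toNNReal ω ∈ A} := by
    simp_rw [hmeas]
    let _ : MeasurableSpace Ω := sigmaAlg X (Ici c)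
    exact (measurableSet_lt measurable_const hm).inter ((measurableSet_lt hm measurable_const).inter
      (measurable_path_at h.isStepPath (fun s hs => measurable_sigmaAlg hs)
        hm.ennreal_toNNReal hA))
  rw [hsplit, measure_union _ hE, h2, ← Ioc_union_Ioi_eq_Ioi hcd,
    lintegral_union measurableSet_Ioi (Ioc_disjoint_Ioi le_rfl)] at h1
  · exact (ENNReal.add_left_inj (h2 ▸ measure_ne_top _ _)).1 h1
  · rw [Set.disjoint_left]
    rintro ω ⟨-, h3, -⟩ ⟨h4, -, -⟩
    exact absurd h4 (not_lt.2 h3)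

theorem IsJumpMarkov.firstJump_Ioc_le (h : IsJumpMarkov X P ν) {c d T Λ : ℝ≥0} (hcd : c ≤ d)
    (hd : d ≤ T) (hΛ : ∀ s ≤ T, ∀ x, jumpRate ν s x ≤ Λ) (y : K)
    {A : Set K} (hA : MeasurableSet A) :
    P c y {ω | c < jumpTime X c ω 1 ∧ jumpTime X c ω 1 ≤ d ∧
        X (jumpTime X c ω 1).toNNReal ω ∈ A} ≤ ∫⁻ s in Ioc c d, ν (s, y) A ∂leb := by
  rw [h.firstJump_Ioc hcd y hA]
  refine setLIntegral_mono' measurableSet_Ioc fun s hs => ?_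
  rw [jumpLaw_mul_jumpRate (ne_top_of_le_ne_top ENNReal.coe_ne_top (hΛ s (hs.2.trans hd) y))]
  refine mul_le_of_le_one_right' ?_
  rw [EReal.exp_le_one_iff, EReal.neg_le_zero]
  exact EReal.coe_ennreal_nonneg _

/-- On `(c,d]` the survival factor lies between `exp(-Λ(d-c))` and `1`. With `firstJump_Ioc_le` this
pins the first-jump probability to the integrated rate, with a ratio tending to `1` with the mesh.
-/
theorem IsJumpMarkov.le_firstJump_Ioc (h : IsJumpMarkov X P ν) {c d T Λ : ℝ≥0} (hcd : c ≤ d)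
    (hd : d ≤ T) (hΛ : ∀ s ≤ T, ∀ x, jumpRate ν s x ≤ Λ) (y : K)
    {A : Set K} (hA : MeasurableSet A) :
    ENNReal.ofReal (Real.exp (-(Λ * (d - c : ℝ≥0)))) * ∫⁻ s in Ioc c d, ν (s, y) A ∂leb ≤
    P c y {ω | c < jumpTime X c ω 1 ∧ jumpTime X c ω 1 ≤ d ∧
        X (jumpTime X c ω 1).toNNReal ω ∈ A} := by
  rw [h.firstJump_Ioc hcd y hA, ← lintegral_const_mul' _ _ ENNReal.ofReal_ne_top]
  refine setLIntegral_mono' measurableSet_Ioc fun s hs => ?_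
  rw [jumpLaw_mul_jumpRate (ne_top_of_le_ne_top ENNReal.coe_ne_top (hΛ s (hs.2.trans hd) y)),
    mul_comm]
  gcongr
  rw [← EReal.exp_coe]
  refine EReal.exp_monotone ?_
  rw [EReal.coe_neg, EReal.neg_le_neg_iff]
  have : ∫⁻ r in Ioc c s, jumpRate ν r y ∂leb ≤ ((Λ * (d - c) : ℝ≥0) : ℝ≥0∞) := by
    calc _ ≤ ∫⁻ r in Ioc c s, (Λ : ℝ≥0∞) ∂leb :=
          setLIntegral_mono' measurableSet_Ioc fun r hr => hΛ r (hr.2.trans (hs.2.trans hd)) y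
      _ = Λ * (s - c : ℝ≥0) := by simp [leb_Ioc]
      _ ≤ _ := by
        rw [ENNReal.coe_mul]
        gcongr
        exact hs.2
  refine (EReal.coe_ennreal_le_coe_ennreal_iff.2 this).trans (le_of_eq ?_)
  push_cast
  rfl

/-- Conditioning on the past at the left endpoint of the cell: a first jump after `c` is an event of
the future of `c`. -/
theorem setLIntegral_cellCount (h : IsJumpMarkov X P ν) {u c d : ℝ≥0} (huc : u ≤ c)
    (x : K) {A : Set K} (hA : MeasurableSet A) {G : Set Ω}
    (hG : MeasurableSet[sigmaAlg X (Icc u c)] G) :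
    ∫⁻ ω in G, cellCount X A c d ω ∂(P u x) =
      ∫⁻ ω in G, P c (X c ω) {ω | c < jumpTime X c ω 1 ∧ jumpTime X c ω 1 ≤ d ∧
        X (jumpTime X c ω 1).toNNReal ω ∈ A} ∂(P u x) := by
  set B := {ω | c < jumpTime X c ω 1 ∧ jumpTime X c ω 1 ≤ d ∧
        X (jumpTime X c ω 1).toNNReal ω ∈ A} with hB
  have this : ∀ ω, cellCount X A c d ω = B.indicator 1 ω := fun ω => by
    classical
    simp only [cellCount, indicator_apply, Pi.one_apply, hB, mem_ofPred_eq]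
  have hBm : MeasurableSet[sigmaAlg X (Ici c)] B := by
    let _ : MeasurableSpace Ω := sigmaAlg X (Ici c)
    have h1 := measurable_cellCount (t := c) (d := d) h.isStepPath
      (fun s hs => measurable_sigmaAlg hs)
      (fun u hu => (h.measurable_firstJump u).mono (sigmaAlg_mono X (Ici_subset_Ici.2 hu)) le_rfl)
      hA le_rfl (measurableSet_singleton 1)
    have h2 : B = (fun ω => cellCount X A c d ω) ⁻¹' {1} := by
      ext ω
      rw [mem_preimage, mem_singleton_iff, this]
      by_cases hω : ω ∈ B <;> simp [hω]
    rw [h2]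
    exact h1
  have hBm' : MeasurableSet[sigmaAlg X (Ici u)] B := sigmaAlg_mono X (Ici_subset_Ici.2 huc) _ hBm
  rw [← (h.isMarkovEvent c B hBm).2 u huc x G hG]
  simp_rw [this]
  rw [lintegral_indicator_one hBm', Measure.restrict_apply hBm', inter_comm]

end FirstJump

/-! ### Time grids. -/

section Grid

/-- The largest point of the grid `a + ℕ / (m + 1)` strictly to the left of `s`. -/
def leftGrid (a : ℝ≥0) (m : ℕ) (s : ℝ≥0) : ℝ≥0 :=
  -- The ceiling minus one, instead of the floor, stays strictly below `s` when `s` is itself a grid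
  -- point; left limits and predictability depend on this.
  a + ((⌈(m + 1) * (s - a)⌉₊ - 1 : ℕ) : ℝ≥0) / (m + 1)

theorem ceil_pos_of_lt {a s : ℝ≥0} (m : ℕ) (h : a < s) : 0 < ⌈((m : ℝ≥0) + 1) * (s - a)⌉₊ :=
  Nat.ceil_pos.2 (mul_pos (by positivity) (tsub_pos_of_lt h))

theorem leftGrid_lt {a s : ℝ≥0} (m : ℕ) (h : a < s) : leftGrid a m s < s := by
  have hm : (0 : ℝ≥0) < m + 1 := by positivity
  have h1 := ceil_pos_of_lt m h
  have h2 : ((⌈((m : ℝ≥0) + 1) * (s - a)⌉₊ - 1 : ℕ) : ℝ≥0) < (m + 1) * (s - a) :=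
    Nat.lt_ceil.1 (Nat.sub_lt h1 one_pos)
  rw [leftGrid, ← lt_tsub_iff_left, div_lt_iff₀ hm, mul_comm (s - a)]
  exact h2

theorem le_leftGrid_add {a s : ℝ≥0} (m : ℕ) (h : a < s) : s ≤ leftGrid a m s + 1 / (m + 1) := by
  have hm : (0 : ℝ≥0) < m + 1 := by positivity
  have h1 := ceil_pos_of_lt m h
  have h2 : ((m : ℝ≥0) + 1) * (s - a) ≤ ((⌈((m : ℝ≥0) + 1) * (s - a)⌉₊ - 1 : ℕ) : ℝ≥0) + 1 := by
    have := Nat.le_ceil (((m : ℝ≥0) + 1) * (s - a))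
    refine this.trans ?_
    exact_mod_cast (Nat.sub_add_cancel h1).ge
  rw [leftGrid, add_assoc, ← add_div, ← tsub_le_iff_left, le_div_iff₀ hm, mul_comm]
  exact h2

theorem tendsto_one_div_nnreal : Tendsto (fun m : ℕ => 1 / ((m : ℝ≥0) + 1)) atTop (𝓝 0) := by
  have := tendsto_one_div_add_atTop_nhds_zero_nat (𝕜 := ℝ)
  rw [← NNReal.tendsto_coe]
  simpa using this

theorem tendsto_leftGrid {a s : ℝ≥0} (h : a < s) :
    Tendsto (fun m => leftGrid a m s) atTop (𝓝[<] s) := by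
  refine tendsto_nhdsWithin_iff.2 ⟨?_, Eventually.of_forall fun m => leftGrid_lt m h⟩
  have h1 : Tendsto (fun m : ℕ => s - 1 / ((m : ℝ≥0) + 1)) atTop (𝓝 (s - 0)) :=
    tendsto_const_nhds.sub tendsto_one_div_nnreal
  rw [tsub_zero] at h1
  exact tendsto_of_tendsto_of_tendsto_of_le_of_le h1 tendsto_const_nhds
    (fun m => tsub_le_iff_right.2 (le_leftGrid_add m h)) (fun m => (leftGrid_lt m h).le)

theorem measurable_leftGrid_index (a : ℝ≥0) (m : ℕ) :
    Measurable fun s : ℝ≥0 => (⌈((m : ℝ≥0) + 1) * (s - a)⌉₊ - 1 : ℕ) :=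
  (measurable_from_nat (f := fun k => k - 1)).comp (Nat.measurable_ceil.comp (by fun_prop))

/-- The points of the grid `a + ℕ / (m + 1)`, stopped at `b`. -/
def cutGrid (a b : ℝ≥0) (m k : ℕ) : ℝ≥0 := min (a + k / (m + 1)) b

theorem cutGrid_mono (a b : ℝ≥0) (m : ℕ) : Monotone (cutGrid a b m) := by
  intro k l hkl
  unfold cutGrid
  gcongr

theorem le_cutGrid {a b : ℝ≥0} (hab : a ≤ b) (m k : ℕ) : a ≤ cutGrid a b m k :=
  le_min (by simp) hab

theorem cutGrid_le (a b : ℝ≥0) (m k : ℕ) : cutGrid a b m k ≤ b := min_le_right _ _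

theorem cutGrid_succ_le (a b : ℝ≥0) (m k : ℕ) :
    cutGrid a b m (k + 1) ≤ cutGrid a b m k + 1 / (m + 1) := by
  unfold cutGrid
  rw [min_add]
  refine min_le_min (le_of_eq ?_) (by simp)
  push_cast
  ring

theorem pairwise_disjoint_cutGrid (a b : ℝ≥0) (m : ℕ) :
    Pairwise (Function.onFun Disjoint
      fun k => Ioc (cutGrid a b m k) (cutGrid a b m (k + 1))) :=
  (cutGrid_mono a b m).pairwise_disjoint_on_Ioc_succ

theorem iUnion_cutGrid {a b : ℝ≥0} (hab : a ≤ b) (m : ℕ) :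
    ⋃ k, Ioc (cutGrid a b m k) (cutGrid a b m (k + 1)) = Ioc a b := by
  ext s
  simp only [mem_iUnion, mem_Ioc]
  constructor
  · rintro ⟨k, h1, h2⟩
    exact ⟨(le_cutGrid hab m k).trans_lt h1, h2.trans (cutGrid_le _ _ _ _)⟩
  · rintro ⟨h1, h2⟩
    refine ⟨⌈((m : ℝ≥0) + 1) * (s - a)⌉₊ - 1, (min_le_left _ _).trans_lt (leftGrid_lt m h1),
      le_min ?_ h2⟩
    refine (le_leftGrid_add m h1).trans (le_of_eq ?_)
    rw [leftGrid]
    push_cast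
    ring

theorem leftGrid_eq {a b s : ℝ≥0} {m k : ℕ}
    (hs : s ∈ Ioc (cutGrid a b m k) (cutGrid a b m (k + 1))) :
    leftGrid a m s = cutGrid a b m k := by
  have hm : (0 : ℝ≥0) < m + 1 := by positivity
  have hb : s ≤ b := hs.2.trans (cutGrid_le _ _ _ _)
  have h1 : a + k / (m + 1) < s := by
    rcases min_lt_iff.1 hs.1 with h | h
    · exact h
    · exact absurd h (not_lt.2 hb)
  have h2 : s ≤ a + (k + 1 : ℕ) / (m + 1) := hs.2.trans (min_le_left _ _)
  have h3 : ⌈((m : ℝ≥0) + 1) * (s - a)⌉₊ = k + 1 := by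
    rw [Nat.ceil_eq_iff (by simp)]
    constructor
    · rw [← lt_tsub_iff_left, div_lt_iff₀ hm, mul_comm] at h1
      simpa using h1
    · rw [← tsub_le_iff_left, le_div_iff₀ hm, mul_comm] at h2
      exact h2
  rw [leftGrid, h3, cutGrid, min_eq_left (h1.le.trans hb)]
  simp

end Grid

/-! ### Pathwise limits along refining grids. -/

section Paths

variable {K Ω : Type*} [MeasurableSpace K] {X : ℝ≥0 → Ω → K} {t : ℝ≥0}

theorem pathJumps_null {K Ω : Type*} {X : ℝ≥0 → Ω → K} {ω : Ω} (hx : IsStepPath (X · ω)) (a b : ℝ≥0) :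
    ∀ᵐ s ∂(leb.restrict (Ioc a b)), s ∉ pathJumps (X · ω) := by
  rw [ae_restrict_iff' measurableSet_Ioc, ae_iff]
  refine measure_mono_null ?_ ((hx.finite_inter a b).measure_zero leb)
  intro s hs
  simp only [mem_ofPred_eq, not_forall, not_not] at hs
  exact ⟨hs.2, hs.1⟩

theorem tsum_cellCount_le {ω : Ω} (hx : IsStepPath (X · ω)) {a b : ℝ≥0} (hta : t ≤ a)
    (hab : a ≤ b) {A : Set K} (hA : MeasurableSet A) (m : ℕ) :
    ∑' k, cellCount X A (cutGrid a b m k) (cutGrid a b m (k + 1)) ω ≤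
      jumpPointMeasure X t ω (Ioc a b ×ˢ A) := by
  have h1 : Ioc a b ×ˢ A = ⋃ k, Ioc (cutGrid a b m k) (cutGrid a b m (k + 1)) ×ˢ A := by
    rw [← iUnion_prod_const, iUnion_cutGrid hab]
  rw [h1, measure_iUnion (fun i j hij => Set.disjoint_prod.2 (Or.inl (pairwise_disjoint_cutGrid a b m hij)))
    fun k => measurableSet_Ioc.prod hA]
  exact ENNReal.tsum_le_tsum fun k => cellCount_le t hx (hta.trans (le_cutGrid hab m k)) hA

/-- Once the mesh is smaller than every gap between the finitely many jumps in `(a,b]`, each cell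
contains at most one of them. -/
theorem eventually_tsum_cellCount {ω : Ω} (hx : IsStepPath (X · ω)) {a b : ℝ≥0} (hta : t ≤ a)
    (hab : a ≤ b) {A : Set K} (hA : MeasurableSet A) :
    ∀ᶠ m in atTop, ∑' k, cellCount X A (cutGrid a b m k) (cutGrid a b m (k + 1)) ω =
      jumpPointMeasure X t ω (Ioc a b ×ˢ A) := by
  have hfin := hx.finite_inter a b
  have hev : ∀ᶠ m : ℕ in atTop, ∀ s ∈ pathJumps (X · ω) ∩ Ioc a b,
      ∀ r ∈ pathJumps (X · ω) ∩ Ioc a b, s < r → s + 1 / ((m : ℝ≥0) + 1) < r := by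
    rw [eventually_all_finite hfin]
    intro s _
    rw [eventually_all_finite hfin]
    intro r _
    by_cases hsr : s < r
    · have : Tendsto (fun m : ℕ => s + 1 / ((m : ℝ≥0) + 1)) atTop (𝓝 (s + 0)) :=
        tendsto_const_nhds.add tendsto_one_div_nnreal
      rw [add_zero] at this
      filter_upwards [this.eventually_lt_const hsr] with m hm _ using hm
    · exact Eventually.of_forall fun m h => absurd h hsr
  filter_upwards [hev] with m hm
  have h1 : Ioc a b ×ˢ A = ⋃ k, Ioc (cutGrid a b m k) (cutGrid a b m (k + 1)) ×ˢ A := by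
    rw [← iUnion_prod_const, iUnion_cutGrid hab]
  rw [h1, measure_iUnion (fun i j hij => Set.disjoint_prod.2 (Or.inl (pairwise_disjoint_cutGrid a b m hij)))
    fun k => measurableSet_Ioc.prod hA]
  refine tsum_congr fun k => cellCount_eq t hx (hta.trans (le_cutGrid hab m k)) hA ?_
  have hsub : Ioc (cutGrid a b m k) (cutGrid a b m (k + 1)) ⊆ Ioc a b :=
    Ioc_subset_Ioc (le_cutGrid hab m k) (cutGrid_le _ _ _ _)
  have hlt : ∀ s ∈ pathJumps (X · ω) ∩ Ioc (cutGrid a b m k) (cutGrid a b m (k + 1)),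
      ∀ r ∈ pathJumps (X · ω) ∩ Ioc (cutGrid a b m k) (cutGrid a b m (k + 1)), ¬ s < r := by
    intro s hs r hr hsr
    have h2 := hm s ⟨hs.1, hsub hs.2⟩ r ⟨hr.1, hsub hr.2⟩ hsr
    have h3 := (hr.2.2.trans (cutGrid_succ_le a b m k)).trans
      (add_le_add_left hs.2.1.le (1 / ((m : ℝ≥0) + 1)))
    exact absurd h2 (not_lt.2 h3)
  intro s hs r hr
  exact le_antisymm (not_lt.1 (hlt r hr s hs)) (not_lt.1 (hlt s hs r hr))

/-- Away from the finitely many jump times the path is locally constant, so the integrand is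
eventually equal to its limit; the bound `Λ` dominates. -/
theorem tendsto_setLIntegral_leftGrid_path {ω : Ω} (hx : IsStepPath (X · ω)) {ν : Kernel (ℝ≥0 × K) K} {a b T Λ : ℝ≥0}
    (hm : ∀ m, Measurable fun s => X (leftGrid a m s) ω)
    (hbT : b ≤ T) (hΛ : ∀ s ≤ T, ∀ x, jumpRate ν s x ≤ Λ) {A : Set K} (hA : MeasurableSet A) :
    Tendsto (fun m => ∫⁻ s in Ioc a b, ν (s, X (leftGrid a m s) ω) A ∂leb) atTop
      (𝓝 (∫⁻ s in Ioc a b, ν (s, X s ω) A ∂leb)) := by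
  have hνA : Measurable fun q : ℝ≥0 × K => ν q A := Kernel.measurable_coe ν hA
  refine tendsto_lintegral_of_dominated_convergence (fun _ => (Λ : ℝ≥0∞)) (fun m => ?_)
    (fun m => ?_) ?_ ?_
  · exact hνA.comp (measurable_id.prodMk (hm m))
  · rw [EventuallyLE, ae_restrict_iff' measurableSet_Ioc]
    exact Eventually.of_forall fun s hs =>
      (measure_mono (subset_univ A)).trans (hΛ s (hs.2.trans hbT) _)
  · rw [lintegral_const]
    exact ENNReal.mul_ne_top ENNReal.coe_ne_top (measure_ne_top _ _)
  · filter_upwards [pathJumps_null hx a b, ae_restrict_mem measurableSet_Ioc] with s hs hs'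
    refine tendsto_const_nhds.congr' ?_
    filter_upwards [((tendsto_leftGrid hs'.1).mono_right nhdsWithin_le_nhds).eventually
      (hx.eventually_eq hs)] with m hm
    exact (congrArg (fun y => ν (s, y) A) hm).symm

end Paths

/-! ### The compensator formula on rectangles. -/

section Rectangles

variable {K Ω : Type*} [MeasurableSpace K] [MeasurableSpace Ω] {X : ℝ≥0 → Ω → K} {t : ℝ≥0}

theorem measurable_leftGrid_path (hX : ∀ s, t ≤ s → Measurable (X s)) {a : ℝ≥0} (hta : t ≤ a)
    (m : ℕ) : Measurable fun θ : Ω × ℝ≥0 => X (leftGrid a m θ.2) θ.1 :=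
  measurable_apply_nat (F := fun k (θ : Ω × ℝ≥0) => X (a + (k : ℝ≥0) / (m + 1)) θ.1)
    ((measurable_leftGrid_index a m).comp measurable_snd)
    fun _ => (hX _ (hta.trans le_self_add)).comp measurable_fst

theorem measurable_leftGrid_path_right (hX : ∀ s, t ≤ s → Measurable (X s)) {a : ℝ≥0}
    (hta : t ≤ a) (m : ℕ) (ω : Ω) : Measurable fun s => X (leftGrid a m s) ω := by
  have h := (measurable_leftGrid_path hX hta m).comp (measurable_prodMk_left (x := ω))
  exact h

/-- The cell bounds are summed over a grid. One inequality is Fatou's lemma; for the other, cell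
counts never exceed the true number of jumps and the factor `exp(-Λ/(m+1))` tends to `1`. -/
theorem lintegral_jumpPointMeasure_rect (hx : ∀ ω, IsStepPath (X · ω))
    (hX : ∀ s, t ≤ s → Measurable (X s))
    (hτ : ∀ u, t ≤ u → Measurable fun ω => jumpTime X u ω 1) {ν : Kernel (ℝ≥0 × K) K}
    (μ : Measure Ω) [IsFiniteMeasure μ] {a b T Λ : ℝ≥0} (hta : t ≤ a) (hab : a ≤ b) (hbT : b ≤ T)
    (hΛ : ∀ s ≤ T, ∀ x, jumpRate ν s x ≤ Λ) {A : Set K} (hA : MeasurableSet A)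
    (hle : ∀ c d, a ≤ c → c ≤ d → d ≤ b →
      ∫⁻ ω, cellCount X A c d ω ∂μ ≤ ∫⁻ ω, ∫⁻ s in Ioc c d, ν (s, X c ω) A ∂leb ∂μ)
    (hge : ∀ c d, a ≤ c → c ≤ d → d ≤ b →
      ENNReal.ofReal (Real.exp (-(Λ * (d - c : ℝ≥0)))) *
        ∫⁻ ω, ∫⁻ s in Ioc c d, ν (s, X c ω) A ∂leb ∂μ ≤ ∫⁻ ω, cellCount X A c d ω ∂μ) :
    ∫⁻ ω, jumpPointMeasure X t ω (Ioc a b ×ˢ A) ∂μ =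
      ∫⁻ ω, ∫⁻ s in Ioc a b, ν (s, X s ω) A ∂leb ∂μ := by
  let N : ℕ → Ω → ℝ≥0∞ := fun m ω =>
    ∑' k, cellCount X A (cutGrid a b m k) (cutGrid a b m (k + 1)) ω
  have hcell : ∀ m k, Measurable fun ω =>
      cellCount X A (cutGrid a b m k) (cutGrid a b m (k + 1)) ω := fun m k =>
    measurable_cellCount hx hX hτ hA (hta.trans (le_cutGrid hab m k))
  have hN : ∀ m, Measurable (N m) := fun m => Measurable.tsum fun k => hcell m k
  have hνA : Measurable fun q : ℝ≥0 × K => ν q A := Kernel.measurable_coe ν hA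
  have hνle : ∀ s ≤ T, ∀ y, ν (s, y) A ≤ Λ := fun s hs y =>
    (measure_mono (subset_univ A)).trans (hΛ s hs y)
  -- Conditioning at the left end of each cell freezes the state there, so the sum over cells is the
  -- rate integral with `X` sampled on the grid.
  let I : ℕ → ℝ≥0∞ := fun m => ∫⁻ ω, ∫⁻ s in Ioc a b, ν (s, X (leftGrid a m s) ω) A ∂leb ∂μ
  have hcellI : ∀ m, ∑' k, ∫⁻ ω, ∫⁻ s in Ioc (cutGrid a b m k) (cutGrid a b m (k + 1)),
      ν (s, X (cutGrid a b m k) ω) A ∂leb ∂μ = I m := by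
    intro m
    rw [← lintegral_tsum]
    · refine lintegral_congr fun ω => ?_
      conv_rhs => rw [← iUnion_cutGrid hab m]
      rw [lintegral_iUnion (fun k => measurableSet_Ioc)
        (pairwise_disjoint_cutGrid a b m)]
      refine tsum_congr fun k => setLIntegral_congr_fun measurableSet_Ioc fun s hs => ?_
      simp only [leftGrid_eq hs]
    · intro k
      have : Measurable fun θ : Ω × ℝ≥0 => ν (θ.2, X (cutGrid a b m k) θ.1) A :=
        hνA.comp (measurable_snd.prodMk
          ((hX _ (hta.trans (le_cutGrid hab m k))).comp measurable_fst))
      exact this.lintegral_prod_right'.aemeasurable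
  have hNle : ∀ m, ∫⁻ ω, N m ω ∂μ ≤ I m := by
    intro m
    rw [← hcellI, lintegral_tsum fun k => (hcell m k).aemeasurable]
    exact ENNReal.tsum_le_tsum fun k => hle _ _ (le_cutGrid hab m k)
      (cutGrid_mono a b m k.le_succ) (cutGrid_le _ _ _ _)
  have hNge : ∀ m : ℕ, ENNReal.ofReal (Real.exp (-(Λ * (1 / (m + 1) : ℝ≥0)))) * I m ≤
      ∫⁻ ω, N m ω ∂μ := by
    intro m
    rw [← hcellI, lintegral_tsum fun k => (hcell m k).aemeasurable, ← ENNReal.tsum_mul_left]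
    refine ENNReal.tsum_le_tsum fun k => le_trans ?_ (hge _ _ (le_cutGrid hab m k)
      (cutGrid_mono a b m k.le_succ) (cutGrid_le _ _ _ _))
    gcongr
    exact tsub_le_iff_left.2 (cutGrid_succ_le a b m k)
  have hI : Tendsto I atTop (𝓝 (∫⁻ ω, ∫⁻ s in Ioc a b, ν (s, X s ω) A ∂leb ∂μ)) := by
    refine tendsto_lintegral_of_dominated_convergence (fun _ => Λ * (b - a : ℝ≥0)) (fun m => ?_)
      (fun m => Eventually.of_forall fun ω => ?_) ?_ (Eventually.of_forall fun ω => ?_)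
    · have : Measurable fun θ : Ω × ℝ≥0 => ν (θ.2, X (leftGrid a m θ.2) θ.1) A :=
        hνA.comp (measurable_snd.prodMk (measurable_leftGrid_path hX hta m))
      exact this.lintegral_prod_right'
    · calc _ ≤ ∫⁻ s in Ioc a b, (Λ : ℝ≥0∞) ∂leb :=
            setLIntegral_mono' measurableSet_Ioc fun s hs => hνle s (hs.2.trans hbT) _
        _ = _ := by simp [leb_Ioc]
    · rw [lintegral_const]
      exact ENNReal.mul_ne_top (ENNReal.mul_ne_top ENNReal.coe_ne_top ENNReal.coe_ne_top)
        (measure_ne_top _ _)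
    · exact tendsto_setLIntegral_leftGrid_path (hx ω)
        (fun m => measurable_leftGrid_path_right hX hta m ω) hbT hΛ hA
  have hlim : ∀ ω, Tendsto (fun m => N m ω) atTop (𝓝 (jumpPointMeasure X t ω (Ioc a b ×ˢ A))) :=
    fun ω => tendsto_const_nhds.congr'
      ((eventually_tsum_cellCount (hx ω) hta hab hA).mono fun m hm => hm.symm)
  refine le_antisymm ?_ ?_
  · calc ∫⁻ ω, jumpPointMeasure X t ω (Ioc a b ×ˢ A) ∂μ
        = ∫⁻ ω, liminf (fun m => N m ω) atTop ∂μ := by simp_rw [fun ω => (hlim ω).liminf_eq]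
      _ ≤ liminf (fun m => ∫⁻ ω, N m ω ∂μ) atTop := lintegral_liminf_le hN
      _ ≤ liminf I atTop := liminf_le_liminf (Eventually.of_forall hNle)
      _ = _ := hI.liminf_eq
  · have hexp : Tendsto (fun m : ℕ => ENNReal.ofReal (Real.exp (-(Λ * (1 / (m + 1) : ℝ≥0)))))
        atTop (𝓝 1) := by
      have h1 : Tendsto (fun m : ℕ => Real.exp (-(Λ * ((1 / (m + 1) : ℝ≥0) : ℝ)))) atTop
          (𝓝 (Real.exp (-(Λ * ((0 : ℝ≥0) : ℝ))))) :=
        (Real.continuous_exp.tendsto _).comp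
          ((tendsto_const_nhds.mul (NNReal.tendsto_coe.2 tendsto_one_div_nnreal)).neg)
      simpa using ENNReal.tendsto_ofReal h1
    have h2 := ENNReal.Tendsto.mul hexp (Or.inl one_ne_zero) hI (Or.inr ENNReal.one_ne_top)
    rw [one_mul] at h2
    exact le_of_tendsto h2 (Eventually.of_forall fun m => (hNge m).trans
      (lintegral_mono fun ω => tsum_cellCount_le (hx ω) hta hab hA m))

end Rectangles

section Compensator

variable {K Ω : Type*} [MeasurableSpace K] {X : ℝ≥0 → Ω → K}
  {P : (t : ℝ≥0) → K → @Measure Ω (sigmaAlg X (Ici t))} {ν : Kernel (ℝ≥0 × K) K}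

theorem IsJumpMarkov.setLIntegral_jumpPointMeasure (h : IsJumpMarkov X P ν) {t a b T Λ : ℝ≥0}
    (hta : t ≤ a) (hab : a ≤ b) (hbT : b ≤ T) (hΛ : ∀ s ≤ T, ∀ x, jumpRate ν s x ≤ Λ) (x : K)
    {A : Set K} (hA : MeasurableSet A) {G : Set Ω} (hG : MeasurableSet[sigmaAlg X (Icc t a)] G) :
    ∫⁻ ω in G, jumpPointMeasure X t ω (Ioc a b ×ˢ A) ∂(P t x) =
      ∫⁻ ω in G, ∫⁻ s in Ioc a b, ν (s, X s ω) A ∂leb ∂(P t x) := by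
  have := h.isProbabilityMeasure t x
  -- The grid argument runs under the restriction to `G`; as `G` belongs to the past of `a`, it
  -- belongs to the past of every cell.
  have hfin : IsFiniteMeasure ((P t x).restrict G) := @isFiniteMeasureRestrict _ _ _ _ _
  refine @lintegral_jumpPointMeasure_rect _ _ _ (sigmaAlg X (Ici t)) _ _ h.isStepPath
    (fun s hs => measurable_sigmaAlg hs)
    (fun u hu => (h.measurable_firstJump u).mono (sigmaAlg_mono X (Ici_subset_Ici.2 hu)) le_rfl)
    _ _ hfin _ _ _ _ hta hab hbT hΛ _ hA (fun c d hac hcd hdb => ?_) (fun c d hac hcd hdb => ?_)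
  · rw [setLIntegral_cellCount h (hta.trans hac) x hA
      (sigmaAlg_mono X (Icc_subset_Icc_right hac) _ hG)]
    exact lintegral_mono fun ω => h.firstJump_Ioc_le hcd (hdb.trans hbT) hΛ _ hA
  · rw [setLIntegral_cellCount h (hta.trans hac) x hA
      (sigmaAlg_mono X (Icc_subset_Icc_right hac) _ hG),
      ← lintegral_const_mul' _ _ ENNReal.ofReal_ne_top]
    exact lintegral_mono fun ω => h.le_firstJump_Ioc hcd (hdb.trans hbT) hΛ _ hA

end Compensator

/-! ### Extension to the predictable σ-algebra. -/

section Predictable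

theorem predictable_le {Ω : Type*} {mΩ : MeasurableSpace Ω} {t : ℝ≥0}
    (𝓕 : Filtration (Ici t) mΩ) :
    𝓕.predictable ≤ (inferInstance : MeasurableSpace (Ici t × Ω)) :=
  measurableSpace_le_predictable_of_measurableSet
    (fun _ hA => (measurableSet_singleton _).prod (𝓕.le _ _ hA))
    (fun _ _ hA => measurableSet_Ioi.prod (𝓕.le _ _ hA))

theorem isPiSystem_predictable {Ω : Type*} {mΩ : MeasurableSpace Ω} {t : ℝ≥0}
    (𝓕 : Filtration (Ici t) mΩ) :
    IsPiSystem ({s | ∃ A, MeasurableSet[𝓕 ⊥] A ∧ s = {⊥} ×ˢ A} ∪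
      {s | ∃ i A, MeasurableSet[𝓕 i] A ∧ s = Set.Ioi i ×ˢ A}) := by
  have h0 : ∀ (i : Ici t) (A B : Set Ω),
      (∅ : Set (Ici t × Ω)) = ({⊥} ×ˢ A) ∩ (Ioi i ×ˢ B) := by
    intro i A B
    rw [prod_inter_prod, singleton_inter_eq_empty.2 (by simp), empty_prod]
  have h1 : (∅ : Set (Ici t × Ω)) = Ioi ⊥ ×ˢ (∅ : Set Ω) := by simp
  rintro _ (⟨A, hA, rfl⟩ | ⟨i, A, hA, rfl⟩) _ (⟨B, hB, rfl⟩ | ⟨j, B, hB, rfl⟩) hne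
  · exact Or.inl ⟨A ∩ B, hA.inter hB, by rw [prod_inter_prod, inter_self]⟩
  · rw [← h0] at hne; simp at hne
  · rw [inter_comm, ← h0] at hne; simp at hne
  · exact Or.inr ⟨i ⊔ j, A ∩ B, (𝓕.mono le_sup_left _ hA).inter (𝓕.mono le_sup_right _ hB), by
      rw [prod_inter_prod, Ioi_inter_Ioi]⟩

variable {K Ω : Type*} [MeasurableSpace K] {mΩ : MeasurableSpace Ω} {t : ℝ≥0}

/-- The map `(ω, (s, y)) ↦ ((s, ω), y)` into the domain of predictable integrands. -/
def toPredictable (t : ℝ≥0) (q : Ω × (ℝ≥0 × K)) : (Ici t × Ω) × K :=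
  ((⟨max t q.2.1, mem_Ici.2 (le_max_left _ _)⟩, q.1), q.2.2)

theorem measurable_toPredictable (𝓕 : Filtration (Ici t) mΩ) :
    @Measurable _ _ _ (𝓕.predictable.prod inferInstance)
      (toPredictable t : Ω × (ℝ≥0 × K) → (Ici t × Ω) × K) := by
  have h : Measurable (toPredictable t : Ω × (ℝ≥0 × K) → (Ici t × Ω) × K) :=
    (((by fun_prop : Measurable fun q : Ω × (ℝ≥0 × K) => max t q.2.1).subtype_mk).prodMk
      measurable_fst).prodMk (measurable_snd.comp measurable_snd)
  refine h.mono le_rfl ?_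
  exact sup_le_sup (MeasurableSpace.comap_mono (predictable_le 𝓕)) le_rfl

/-- Products of predictable rectangles with sets in `K` form a generating π-system, and `h` is
equality on those over `(a,∞)`. The rectangles over the initial time are null for both measures, and
`hfin` makes the uniqueness theorem applicable. -/
theorem map_toPredictable_eq (𝓕 : Filtration (Ici t) mΩ) (μ : Measure Ω) [IsFiniteMeasure μ]
    (κ η : Kernel Ω (ℝ≥0 × K)) [IsSFiniteKernel κ] [IsSFiniteKernel η]
    (hκ0 : ∀ ω, κ ω (Iic t ×ˢ univ) = 0) (hη0 : ∀ ω, η ω (Iic t ×ˢ univ) = 0)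
    (hfin : ∫⁻ ω, κ ω (Ioi t ×ˢ univ) ∂μ ≠ ∞)
    (h : ∀ a : Ici t, ∀ G, MeasurableSet[𝓕 a] G → ∀ A : Set K, MeasurableSet A →
      ∫⁻ ω in G, κ ω (Ioi (a : ℝ≥0) ×ˢ A) ∂μ = ∫⁻ ω in G, η ω (Ioi (a : ℝ≥0) ×ˢ A) ∂μ) :
    @Measure.map _ _ _ (𝓕.predictable.prod inferInstance) (toPredictable t) (μ ⊗ₘ κ) =
      @Measure.map _ _ _ (𝓕.predictable.prod inferInstance) (toPredictable t) (μ ⊗ₘ η) := by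
  have hle := predictable_le 𝓕
  let C : Set (Set (Ici t × Ω)) := {s | ∃ A, MeasurableSet[𝓕 ⊥] A ∧ s = {⊥} ×ˢ A} ∪
      {s | ∃ i A, MeasurableSet[𝓕 i] A ∧ s = Set.Ioi i ×ˢ A}
  have hpi : IsPiSystem (image2 (· ×ˢ ·) C {A : Set K | MeasurableSet A}) :=
    (isPiSystem_predictable 𝓕).prod MeasurableSpace.isPiSystem_measurableSet
  have hspan : IsCountablySpanning C := by
    refine ⟨fun n => if n = 0 then {⊥} ×ˢ univ else Ioi ⊥ ×ˢ univ, fun n => ?_, ?_⟩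
    · dsimp only
      split_ifs
      · exact Or.inl ⟨univ, MeasurableSet.univ, rfl⟩
      · exact Or.inr ⟨⊥, univ, MeasurableSet.univ, rfl⟩
    · refine eq_univ_of_forall fun q => mem_iUnion.2 ?_
      rcases eq_or_ne q.1 ⊥ with h | h
      · exact ⟨0, by simp [h]⟩
      · exact ⟨1, by simpa using bot_lt_iff_ne_bot.2 h⟩
  have hgen : (𝓕.predictable.prod inferInstance : MeasurableSpace ((Ici t × Ω) × K)) =
      MeasurableSpace.generateFrom (image2 (· ×ˢ ·) C {A : Set K | MeasurableSet A}) := by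
    have hK : IsCountablySpanning {A : Set K | MeasurableSet A} :=
      ⟨fun _ => univ, fun _ => MeasurableSet.univ, iUnion_const _⟩
    rw [← generateFrom_prod_eq hspan hK, MeasurableSpace.generateFrom_measurableSet]
    rfl
  -- `toPredictable` collapses all times up to `t` onto `t`, which is harmless because they carry no
  -- mass.
  have hcompl : ∀ κ' : Kernel Ω (ℝ≥0 × K), IsSFiniteKernel κ' → (∀ ω, κ' ω (Iic t ×ˢ univ) = 0) →
      ∀ A : Set K, (∀ ω, κ' ω (univ ×ˢ A) = κ' ω (Ioi t ×ˢ A)) := by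
    intro κ' _ hκ' A ω
    refine le_antisymm ?_ (measure_mono (prod_mono (subset_univ _) subset_rfl))
    calc κ' ω (univ ×ˢ A) ≤ κ' ω (Ioi t ×ˢ A ∪ Iic t ×ˢ univ) := by
          refine measure_mono fun q hq => ?_
          rcases lt_or_ge t q.1 with h | h
          · exact Or.inl ⟨h, hq.2⟩
          · exact Or.inr ⟨h, mem_univ _⟩
      _ ≤ κ' ω (Ioi t ×ˢ A) + 0 := (measure_union_le _ _).trans (by rw [hκ'])
      _ = _ := add_zero _
  have huniv : ∀ κ' : Kernel Ω (ℝ≥0 × K), IsSFiniteKernel κ' → (∀ ω, κ' ω (Iic t ×ˢ univ) = 0) →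
      @Measure.map _ _ _ (𝓕.predictable.prod inferInstance) (toPredictable t) (μ ⊗ₘ κ') univ =
        ∫⁻ ω, κ' ω (Ioi t ×ˢ univ) ∂μ := by
    intro κ' _ hκ'
    rw [@Measure.map_apply _ _ _ (𝓕.predictable.prod inferInstance) _ _
      (measurable_toPredictable 𝓕) _ MeasurableSet.univ, preimage_univ,
      Measure.compProd_apply MeasurableSet.univ]
    refine lintegral_congr fun ω => ?_
    rw [← hcompl κ' inferInstance hκ', preimage_univ, univ_prod_univ]
  have hbot : ∀ κ' : Kernel Ω (ℝ≥0 × K), IsSFiniteKernel κ' → (∀ ω, κ' ω (Iic t ×ˢ univ) = 0) →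
      ∀ (A : Set Ω) (B : Set K), MeasurableSet[𝓕 ⊥] A → MeasurableSet B →
      @Measure.map _ _ _ (𝓕.predictable.prod inferInstance) (toPredictable t) (μ ⊗ₘ κ')
        (({⊥} ×ˢ A) ×ˢ B) = 0 := by
    intro κ' _ hκ' A B hA hB
    have hm : @MeasurableSet _ (𝓕.predictable.prod inferInstance) (({⊥} ×ˢ A) ×ˢ B) :=
      @MeasurableSet.prod _ _ 𝓕.predictable _ _ _
        (measurableSet_predictable_singleton_bot_prod hA) hB
    rw [@Measure.map_apply _ _ _ (𝓕.predictable.prod inferInstance) _ _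
      (measurable_toPredictable 𝓕) _ hm,
      Measure.compProd_apply (measurable_toPredictable 𝓕 hm)]
    refine (lintegral_congr fun ω => ?_).trans lintegral_zero
    refine measure_mono_null ?_ (hκ' ω)
    rintro q ⟨⟨h1, -⟩, -⟩
    have := congrArg Subtype.val h1
    exact ⟨mem_Iic.2 (max_eq_left_iff.1 this), mem_univ _⟩
  have hioi : ∀ κ' : Kernel Ω (ℝ≥0 × K), IsSFiniteKernel κ' →
      ∀ (i : Ici t) (A : Set Ω) (B : Set K), MeasurableSet[𝓕 i] A → MeasurableSet B →
      @Measure.map _ _ _ (𝓕.predictable.prod inferInstance) (toPredictable t) (μ ⊗ₘ κ')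
        ((Ioi i ×ˢ A) ×ˢ B) = ∫⁻ ω in A, κ' ω (Ioi (i : ℝ≥0) ×ˢ B) ∂μ := by
    intro κ' _ i A B hA hB
    have hm : @MeasurableSet _ (𝓕.predictable.prod inferInstance) ((Ioi i ×ˢ A) ×ˢ B) :=
      @MeasurableSet.prod _ _ 𝓕.predictable _ _ _
        (measurableSet_predictable_Ioi_prod hA) hB
    rw [@Measure.map_apply _ _ _ (𝓕.predictable.prod inferInstance) _ _
      (measurable_toPredictable 𝓕) _ hm,
      Measure.compProd_apply (measurable_toPredictable 𝓕 hm),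
      ← lintegral_indicator (𝓕.le i _ hA)]
    refine lintegral_congr fun ω => ?_
    by_cases hω : ω ∈ A
    · rw [indicator_of_mem hω]
      congr 1
      ext q
      have : i < (⟨max t q.1, mem_Ici.2 (le_max_left _ _)⟩ : Ici t) ↔ (i : ℝ≥0) < q.1 := by
        rw [← Subtype.coe_lt_coe]
        simp only [lt_max_iff, or_iff_right_iff_imp]
        exact fun h => absurd h (not_lt.2 i.2)
      simp [toPredictable, hω, this]
    · rw [indicator_of_notMem hω]
      refine measure_mono_null ?_ (measure_empty (μ := κ' ω))
      rintro q ⟨⟨-, h1⟩, -⟩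
      exact absurd h1 hω
  have hfinite : @IsFiniteMeasure _ (𝓕.predictable.prod inferInstance)
      (@Measure.map _ _ _ (𝓕.predictable.prod inferInstance)
        (toPredictable t : Ω × (ℝ≥0 × K) → _) (μ ⊗ₘ κ)) := by
    refine @IsFiniteMeasure.mk _ (𝓕.predictable.prod inferInstance) _ ?_
    rw [huniv κ inferInstance hκ0]
    exact lt_top_iff_ne_top.2 hfin
  refine @ext_of_generate_finite _ (𝓕.predictable.prod inferInstance) _ _ _ hgen hpi hfinite ?_ ?_
  · rintro _ ⟨_, (⟨A, hA, rfl⟩ | ⟨i, A, hA, rfl⟩), B, hB, rfl⟩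
    · rw [hbot κ inferInstance hκ0 A B hA hB, hbot η inferInstance hη0 A B hA hB]
    · rw [hioi κ inferInstance i A B hA hB, hioi η inferInstance i A B hA hB, h i A hA B hB]
  · rw [huniv κ inferInstance hκ0, huniv η inferInstance hη0]
    have := h ⟨t, mem_Ici.2 le_rfl⟩ univ MeasurableSet.univ univ MeasurableSet.univ
    simpa using this

end Predictable

/-! ### The compensator as an equality of measures. -/

section Compensator

variable {K Ω : Type*} [MeasurableSpace K] [MeasurableSpace Ω] {X : ℝ≥0 → Ω → K} {t : ℝ≥0}

/-- The kernel `(ω, s) ↦ ν(s, X_s(ω), ·)`, with `s` projected to `[t,T]`. -/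
theorem exists_rateKernel (hx : ∀ ω, IsStepPath (X · ω)) (hX : ∀ s, t ≤ s → Measurable (X s))
    {T : ℝ≥0} (htT : t ≤ T) {ν : Kernel (ℝ≥0 × K) K} {Λ : ℝ≥0}
    (hΛ : ∀ s ≤ T, ∀ x, jumpRate ν s x ≤ Λ) :
    ∃ κ : Kernel (Ω × ℝ≥0) K, IsFiniteKernel κ ∧ (∀ θ, κ θ univ ≤ Λ) ∧
      ∀ ω, ∀ s ∈ Icc t T, κ (ω, s) = ν (s, X s ω) := by
  -- The rate is bounded only up to `T`, and `X` is measurable only from `t` on; clamping the time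
  -- gives a finite kernel everywhere.
  have hm : Measurable fun θ : Ω × ℝ≥0 => (max t (min T θ.2), X (max t (min T θ.2)) θ.1) :=
    (by fun_prop : Measurable fun θ : Ω × ℝ≥0 => max t (min T θ.2)).prodMk
      ((measurable_path hx hX).comp
        (by fun_prop : Measurable fun θ : Ω × ℝ≥0 => (θ.1, min T θ.2)))
  have hle : ∀ θ, ν.comap _ hm θ univ ≤ Λ := fun θ => by
    rw [Kernel.comap_apply]
    exact hΛ _ (max_le htT (min_le_left _ _)) _
  refine ⟨ν.comap _ hm, ⟨⟨Λ, ENNReal.coe_lt_top, hle⟩⟩, hle, fun ω s hs => ?_⟩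
  rw [Kernel.comap_apply]
  simp only [min_eq_right hs.2, max_eq_right hs.1]

theorem map_jumpKernel_eq (𝓕 : Filtration (Ici t) ‹MeasurableSpace Ω›) (μ : Measure Ω)
    [IsFiniteMeasure μ] {T Λ : ℝ≥0} (htT : t ≤ T) {ν : Kernel (ℝ≥0 × K) K}
    (κ : Kernel (Ω × ℝ≥0) K) [IsFiniteKernel κ] (hκΛ : ∀ θ, κ θ univ ≤ Λ)
    (hκ : ∀ ω, ∀ s ∈ Icc t T, κ (ω, s) = ν (s, X s ω))
    (p : Kernel Ω (ℝ≥0 × K)) [IsSFiniteKernel p]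
    (hp : ∀ ω, p ω = (jumpPointMeasure X t ω).restrict (Ioc t T ×ˢ univ))
    (h : ∀ a (hta : t ≤ a), a ≤ T → ∀ A : Set K, MeasurableSet A → ∀ G,
      MeasurableSet[𝓕 ⟨a, hta⟩] G → ∫⁻ ω in G, jumpPointMeasure X t ω (Ioc a T ×ˢ A) ∂μ =
        ∫⁻ ω in G, ∫⁻ s in Ioc a T, ν (s, X s ω) A ∂leb ∂μ) :
    @Measure.map _ _ _ (𝓕.predictable.prod inferInstance) (toPredictable t) (μ ⊗ₘ p) =
      @Measure.map _ _ _ (𝓕.predictable.prod inferInstance) (toPredictable t)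
        (μ ⊗ₘ (Kernel.const Ω (leb.restrict (Ioc t T)) ⊗ₖ κ)) := by
  have hp' : ∀ ω a (A : Set K), MeasurableSet A → t ≤ a →
      p ω (Ioi a ×ˢ A) = jumpPointMeasure X t ω (Ioc a T ×ˢ A) := by
    intro ω a A hA hta
    rw [hp, Measure.restrict_apply (measurableSet_Ioi.prod hA), prod_inter_prod, inter_univ,
      inter_comm, Ioc_inter_Ioi, max_eq_right hta]
  have hη : ∀ ω (a : ℝ≥0) (A : Set K), MeasurableSet A → t ≤ a →
      (Kernel.const Ω (leb.restrict (Ioc t T)) ⊗ₖ κ) ω (Ioi a ×ˢ A) =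
        ∫⁻ s in Ioc a T, ν (s, X s ω) A ∂leb := by
    intro ω a A hA hta
    rw [Kernel.compProd_apply_prod measurableSet_Ioi hA, Kernel.const_apply,
      Measure.restrict_restrict measurableSet_Ioi, inter_comm, Ioc_inter_Ioi, max_eq_right hta]
    refine setLIntegral_congr_fun measurableSet_Ioc fun s hs => ?_
    simp only [hκ ω s ⟨hta.trans hs.1.le, hs.2⟩]
  refine map_toPredictable_eq 𝓕 μ _ _ (fun ω => ?_) (fun ω => ?_) ?_ ?_
  · rw [hp, Measure.restrict_apply (measurableSet_Iic.prod .univ), prod_inter_prod,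
      inter_comm, Ioc_inter_Iic]
    simp
  · rw [Kernel.compProd_apply_prod measurableSet_Iic .univ, Kernel.const_apply,
      Measure.restrict_restrict measurableSet_Iic, inter_comm, Ioc_inter_Iic]
    simp
  · simp_rw [fun ω => hp' ω t univ .univ le_rfl]
    have := h t le_rfl htT univ .univ univ MeasurableSet.univ
    simp only [Measure.restrict_univ] at this
    rw [this]
    have hb : ∀ ω, ∫⁻ s in Ioc t T, ν (s, X s ω) univ ∂leb ≤ Λ * (T - t : ℝ≥0) := fun ω => by
      calc _ ≤ ∫⁻ s in Ioc t T, (Λ : ℝ≥0∞) ∂leb :=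
            setLIntegral_mono' measurableSet_Ioc fun s hs => by
              rw [← hκ ω s ⟨hs.1.le, hs.2⟩]; exact hκΛ _
        _ = _ := by simp [leb_Ioc]
    refine ne_top_of_le_ne_top ?_ (lintegral_mono hb)
    rw [lintegral_const]
    exact ENNReal.mul_ne_top (ENNReal.mul_ne_top ENNReal.coe_ne_top ENNReal.coe_ne_top)
      (measure_ne_top _ _)
  · rintro ⟨a, hta⟩ G hG A hA
    simp only
    simp_rw [fun ω => hp' ω a A hA hta, fun ω => hη ω a A hA hta]
    rcases le_or_gt a T with haT | haT
    · exact h a hta haT A hA G hG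
    · simp [Ioc_eq_empty_of_le haT.le]

theorem lintegral_comp_eq_of_map_eq {α β : Type*} {mα : MeasurableSpace α} {mβ : MeasurableSpace β}
    {m₁ m₂ : Measure α} {φ : α → β} (hφ : Measurable φ) (h : m₁.map φ = m₂.map φ)
    {F : β → ℝ≥0∞} (hF : Measurable F) : ∫⁻ q, F (φ q) ∂m₁ = ∫⁻ q, F (φ q) ∂m₂ := by
  rw [← lintegral_map hF hφ, h, lintegral_map hF hφ]

theorem integral_comp_eq_of_map_eq {α β : Type*} {mα : MeasurableSpace α} {mβ : MeasurableSpace β}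
    {m₁ m₂ : Measure α} {φ : α → β} (hφ : Measurable φ) (h : m₁.map φ = m₂.map φ)
    {F : β → ℝ} (hF : Measurable F) : ∫ q, F (φ q) ∂m₁ = ∫ q, F (φ q) ∂m₂ := by
  rw [← integral_map hφ.aemeasurable hF.aestronglyMeasurable, h,
    integral_map hφ.aemeasurable hF.aestronglyMeasurable]

/-- Predictable integrands have the same mean with respect to two measures that agree on the
predictable σ-algebra. -/
theorem lintegral_eq_of_map_eq {𝓕 : Filtration (Ici t) ‹MeasurableSpace Ω›}
    {m₁ m₂ : Measure (Ω × (ℝ≥0 × K))}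
    (h : @Measure.map _ _ _ (𝓕.predictable.prod inferInstance) (toPredictable t) m₁ =
      @Measure.map _ _ _ (𝓕.predictable.prod inferInstance) (toPredictable t) m₂)
    {F : (Ici t × Ω) × K → ℝ≥0∞} (hF : @Measurable _ _ (𝓕.predictable.prod inferInstance) _ F) :
    ∫⁻ q, F (toPredictable t q) ∂m₁ = ∫⁻ q, F (toPredictable t q) ∂m₂ :=
  @lintegral_comp_eq_of_map_eq _ _ _ (𝓕.predictable.prod inferInstance) _ _ _
    (measurable_toPredictable 𝓕) h _ hF

theorem integral_eq_of_map_eq {𝓕 : Filtration (Ici t) ‹MeasurableSpace Ω›}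
    {m₁ m₂ : Measure (Ω × (ℝ≥0 × K))}
    (h : @Measure.map _ _ _ (𝓕.predictable.prod inferInstance) (toPredictable t) m₁ =
      @Measure.map _ _ _ (𝓕.predictable.prod inferInstance) (toPredictable t) m₂)
    {F : (Ici t × Ω) × K → ℝ} (hF : @Measurable _ _ (𝓕.predictable.prod inferInstance) _ F) :
    ∫ q, F (toPredictable t q) ∂m₁ = ∫ q, F (toPredictable t q) ∂m₂ :=
  @integral_comp_eq_of_map_eq _ _ _ (𝓕.predictable.prod inferInstance) _ _ _
    (measurable_toPredictable 𝓕) h _ hF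

end Compensator

/-! ### Measurability of a generator composed with a random integrand. -/

section Generator

variable {Θ K : Type*} [MeasurableSpace Θ] [MeasurableSpace K]

variable (Θ K) in
/-- Measurable subsets of `Θ × K` with countably many different sections. -/
def sectionAlgebra : Set (Set (Θ × K)) :=
  {E | ∃ (ι : Θ → ℕ) (B : ℕ → Set K), Measurable ι ∧ (∀ n, MeasurableSet (B n)) ∧
    E = {q | q.2 ∈ B (ι q.1)}}

/-- Pairing the two indices keeps a union within countably many sections. Being an algebra is what
makes these sets dense in measure for a finite measure. -/
theorem isSetAlgebra_sectionAlgebra : IsSetAlgebra (sectionAlgebra Θ K) where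
  empty_mem := ⟨fun _ => 0, fun _ => ∅, measurable_const, fun _ => MeasurableSet.empty, by simp⟩
  compl_mem := by
    rintro _ ⟨ι, B, hι, hB, rfl⟩
    exact ⟨ι, fun n => (B n)ᶜ, hι, fun n => (hB n).compl, by ext; simp⟩
  union_mem := by
    rintro _ _ ⟨ι, B, hι, hB, rfl⟩ ⟨ι', B', hι', hB', rfl⟩
    refine ⟨fun θ => Nat.pair (ι θ) (ι' θ), fun n => B n.unpair.1 ∪ B' n.unpair.2, ?_,
      fun n => (hB _).union (hB' _), by ext; simp⟩
    exact (measurable_from_prod_countable_right (f := fun q : ℕ × ℕ => Nat.pair q.1 q.2)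
      fun _ => measurable_from_nat).comp (hι.prodMk hι')

theorem generateFrom_sectionAlgebra :
    (inferInstance : MeasurableSpace (Θ × K)) =
      MeasurableSpace.generateFrom (sectionAlgebra Θ K) := by
  refine le_antisymm ?_ (MeasurableSpace.generateFrom_le ?_)
  · change Prod.instMeasurableSpace ≤ _
    rw [← generateFrom_prod]
    refine MeasurableSpace.generateFrom_mono ?_
    rintro _ ⟨A, hA, B, hB, rfl⟩
    classical
    refine ⟨fun θ => if θ ∈ A then 1 else 0, fun n => if n = 1 then B else ∅,
      Measurable.ite hA measurable_const measurable_const, fun n => ?_, ?_⟩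
    · dsimp only
      split_ifs
      exacts [hB, MeasurableSet.empty]
    · ext ⟨θ, y⟩
      by_cases h : θ ∈ A <;> simp [h]
  · rintro _ ⟨ι, B, hι, hB, rfl⟩
    have : {q : Θ × K | q.2 ∈ B (ι q.1)} = ⋃ n, (ι ⁻¹' {n}) ×ˢ B n := by
      ext; simp
    rw [this]
    exact MeasurableSet.iUnion fun n => (hι (measurableSet_singleton n)).prod (hB n)

/-- Functions on `Θ × K` with countably many different sections, each of them bounded. -/
def IsElementary (H : Θ × K → ℝ) : Prop :=
  ∃ (ι : Θ → ℕ) (h : ℕ → K → ℝ), Measurable ι ∧ (∀ n, Measurable (h n)) ∧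
    (∀ n, ∃ B : ℝ, ∀ y, |h n y| ≤ B) ∧ H = fun q => h (ι q.1) q.2

theorem IsElementary.measurable {H : Θ × K → ℝ} (hH : IsElementary H) : Measurable H := by
  obtain ⟨ι, h, hι, hh, -, rfl⟩ := hH
  exact measurable_apply_nat (F := fun n (q : Θ × K) => h n q.2) (hι.comp measurable_fst)
    fun n => (hh n).comp measurable_snd

theorem IsElementary.add {H H' : Θ × K → ℝ} (hH : IsElementary H) (hH' : IsElementary H') :
    IsElementary (H + H') := by
  obtain ⟨ι, h, hι, hh, hb, rfl⟩ := hH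
  obtain ⟨ι', h', hι', hh', hb', rfl⟩ := hH'
  refine ⟨fun θ => Nat.pair (ι θ) (ι' θ), fun n => h n.unpair.1 + h' n.unpair.2,
    (measurable_from_prod_countable_right (f := fun q : ℕ × ℕ => Nat.pair q.1 q.2)
      fun _ => measurable_from_nat).comp (hι.prodMk hι'), fun n => (hh _).add (hh' _),
    fun n => ?_, by ext; simp⟩
  obtain ⟨B, hB⟩ := hb n.unpair.1
  obtain ⟨B', hB'⟩ := hb' n.unpair.2
  exact ⟨B + B', fun y => (abs_add_le _ _).trans (add_le_add (hB y) (hB' y))⟩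

theorem exists_isElementary_eLpNorm_le (ρ : Measure (Θ × K)) [IsFiniteMeasure ρ] {Z : Θ × K → ℝ}
    (hZ : MemLp Z 2 ρ) {ε : ℝ≥0∞} (hε : ε ≠ 0) :
    ∃ H, eLpNorm (Z - H) 2 ρ ≤ ε ∧ IsElementary H := by
  refine hZ.induction_dense (by simp) IsElementary (fun c s hs _ ε hε => ?_)
    (fun f g hf hg => hf.add hg) (fun f hf => hf.measurable.aestronglyMeasurable) hε
  have hdense := Measure.MeasureDense.of_generateFrom_isSetAlgebra_finite (μ := ρ)
    isSetAlgebra_sectionAlgebra generateFrom_sectionAlgebra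
  obtain ⟨η, hη, hle⟩ := exists_eLpNorm_indicator_le (p := 2) (μ := ρ) (by simp) c hε
  obtain ⟨E, hE, hlt⟩ := hdense.approx s hs (measure_ne_top _ _) η (by exact_mod_cast hη)
  refine ⟨E.indicator fun _ => c, ?_, ?_⟩
  · refine le_trans ?_ (hle (symmDiff s E) (by simpa using hlt.le))
    refine eLpNorm_mono fun q => ?_
    by_cases h1 : q ∈ s <;> by_cases h2 : q ∈ E <;> simp [indicator, symmDiff, h1, h2]
  · obtain ⟨ι, B, hι, hB, rfl⟩ := hE
    refine ⟨ι, fun n => (B n).indicator fun _ => c, hι, fun n => measurable_const.indicator (hB n),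
      fun n => ⟨|c|, fun y => ?_⟩, ?_⟩
    · by_cases h : y ∈ B n <;> simp [h]
    · ext q
      simp [indicator]

theorem lintegral_sq_eq_eLpNorm {α : Type*} {mα : MeasurableSpace α} (ρ : Measure α) (F : α → ℝ) :
    ∫⁻ q, ‖F q‖ₑ ^ 2 ∂ρ = eLpNorm F 2 ρ ^ 2 := by
  have := eLpNorm_nnreal_pow_eq_lintegral (μ := ρ) (f := F) (p := 2) (by simp)
  simpa using this.symm

theorem memLp_two_iff {α : Type*} {mα : MeasurableSpace α} {ρ : Measure α} {F : α → ℝ}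
    (hF : AEStronglyMeasurable F ρ) : MemLp F 2 ρ ↔ ∫⁻ q, ‖F q‖ₑ ^ 2 ∂ρ < ∞ := by
  rw [lintegral_sq_eq_eLpNorm, ENNReal.pow_lt_top_iff]
  simp [MemLp, hF]

theorem integral_abs_sq_eq {α : Type*} {mα : MeasurableSpace α} {ρ : Measure α} {F : α → ℝ}
    (hF : AEStronglyMeasurable F ρ) :
    ∫ q, |F q| ^ 2 ∂ρ = (∫⁻ q, ‖F q‖ₑ ^ 2 ∂ρ).toReal := by
  have hm : AEStronglyMeasurable (fun q => |F q| ^ 2) ρ := hF.norm.pow 2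
  rw [integral_eq_lintegral_of_nonneg_ae (Eventually.of_forall fun q => by positivity) hm]
  congr 1
  refine lintegral_congr fun q => ?_
  rw [ENNReal.ofReal_pow (abs_nonneg _), ← Real.norm_eq_abs, ofReal_norm]

theorem aemeasurable_apply_nat {m : Measure Θ} {ι : Θ → ℕ} (hι : Measurable ι) {F : ℕ → Θ → ℝ}
    (hF : ∀ k, AEMeasurable (F k) m) : AEMeasurable (fun θ => F (ι θ) θ) m := by
  refine ⟨fun θ => (hF (ι θ)).mk _ θ, measurable_apply_nat (F := fun k => (hF k).mk _) hι
    fun k => (hF k).measurable_mk, ?_⟩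
  filter_upwards [ae_all_iff.2 fun k => (hF k).ae_eq_mk] with θ hθ using hθ (ι θ)

/-- For an elementary integrand, composition with `Φ` selects one of countably many fixed bounded
`z`, where measurability is known. Elementary integrands are dense in `L²(m ⊗ₘ κ)`, and by the
Lipschitz condition the composition converges wherever the sections do. -/
theorem aemeasurable_generator (m : Measure Θ) [IsFiniteMeasure m] (κ : Kernel Θ K)
    [IsFiniteKernel κ] {Z : Θ × K → ℝ} (hZ : Measurable Z)
    (hZ2 : ∫⁻ θ, ∫⁻ y, ‖Z (θ, y)‖ₑ ^ 2 ∂(κ θ) ∂m < ∞) {Φ : Θ → (K → ℝ) → ℝ} {L : ℝ}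
    (hΦ : ∀ z : K → ℝ, Measurable z → (∃ B : ℝ, ∀ y, |z y| ≤ B) →
      AEMeasurable (fun θ => Φ θ z) m)
    (hL : ∀ᵐ θ ∂m, ∀ z z' : K → ℝ, MemLp z 2 (κ θ) → MemLp z' 2 (κ θ) →
      |Φ θ z - Φ θ z'| ≤ L * Real.sqrt (∫ y, |z y - z' y| ^ 2 ∂(κ θ))) :
    AEMeasurable (fun θ => Φ θ fun y => Z (θ, y)) m := by
  have hlint : ∀ {F : Θ × K → ℝ}, Measurable F →
      ∫⁻ q, ‖F q‖ₑ ^ 2 ∂(m ⊗ₘ κ) = ∫⁻ θ, ∫⁻ y, ‖F (θ, y)‖ₑ ^ 2 ∂(κ θ) ∂m := fun hF =>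
    Measure.lintegral_compProd (hF.enorm.pow_const 2)
  have hZρ : MemLp Z 2 (m ⊗ₘ κ) := by
    rw [memLp_two_iff hZ.aestronglyMeasurable, hlint hZ]
    exact hZ2
  -- Geometric errors make the squared section distances summable in mean, so the sections converge
  -- almost everywhere without passing to a subsequence.
  have hex : ∀ n : ℕ, ∃ H, eLpNorm (Z - H) 2 (m ⊗ₘ κ) ≤ (2⁻¹ : ℝ≥0∞) ^ n ∧ IsElementary H :=
    fun n => exists_isElementary_eLpNorm_le _ hZρ (pow_ne_zero _ (by simp))
  choose H hHle hHel using hex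
  have hHm : ∀ n, Measurable (Z - H n) := fun n => hZ.sub (hHel n).measurable
  let d : ℕ → Θ → ℝ≥0∞ := fun n θ => ∫⁻ y, ‖(Z - H n) (θ, y)‖ₑ ^ 2 ∂(κ θ)
  have hdm : ∀ n, Measurable (d n) := fun n =>
    Measurable.lintegral_kernel_prod_right' ((hHm n).enorm.pow_const 2)
  have hdle : ∀ n, ∫⁻ θ, d n θ ∂m ≤ (2⁻¹ : ℝ≥0∞) ^ n := by
    intro n
    rw [← hlint (hHm n), lintegral_sq_eq_eLpNorm]
    calc _ ≤ ((2⁻¹ : ℝ≥0∞) ^ n) ^ 2 := by gcongr; exact hHle n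
      _ ≤ (2⁻¹ : ℝ≥0∞) ^ n := by
        rw [← pow_mul]
        exact pow_le_pow_right_of_le_one' (by simp) (Nat.le_mul_of_pos_right n two_pos)
  have hsum : ∀ᵐ θ ∂m, ∑' n, d n θ < ∞ := by
    refine ae_lt_top (Measurable.tsum hdm) ?_
    rw [lintegral_tsum fun n => (hdm n).aemeasurable]
    refine ne_top_of_le_ne_top ?_ (ENNReal.tsum_le_tsum hdle)
    rw [ENNReal.tsum_geometric]
    simp
  have hZfin : ∀ᵐ θ ∂m, ∫⁻ y, ‖Z (θ, y)‖ₑ ^ 2 ∂(κ θ) < ∞ :=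
    ae_lt_top (Measurable.lintegral_kernel_prod_right' (hZ.enorm.pow_const 2)) hZ2.ne
  refine aemeasurable_of_tendsto_metrizable_ae (u := atTop)
    (f := fun n θ => Φ θ fun y => H n (θ, y)) (fun n => ?_) ?_
  · obtain ⟨ι, h, hι, hh, hb, heq⟩ := hHel n
    simp only [heq]
    exact aemeasurable_apply_nat (F := fun k θ => Φ θ (h k)) hι fun k => hΦ (h k) (hh k) (hb k)
  · filter_upwards [hsum, hZfin, hL] with θ h1 h2 h3
    have hZθ : Measurable fun y => Z (θ, y) := hZ.comp measurable_prodMk_left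
    have hmem : MemLp (fun y => Z (θ, y)) 2 (κ θ) :=
      (memLp_two_iff hZθ.aestronglyMeasurable).2 h2
    have hd0 := ENNReal.tendsto_atTop_zero_of_tsum_ne_top h1.ne
    have hdθ : ∀ n, MemLp (fun y => (Z - H n) (θ, y)) 2 (κ θ) := fun n =>
      (memLp_two_iff ((hHm n).comp measurable_prodMk_left).aestronglyMeasurable).2
        ((ENNReal.le_tsum n).trans_lt h1)
    have hmemH : ∀ n, MemLp (fun y => H n (θ, y)) 2 (κ θ) := fun n => by
      have := hmem.sub (hdθ n)
      refine this.ae_eq (Eventually.of_forall fun y => ?_)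
      simp
    have hbound : ∀ n, |Φ θ (fun y => H n (θ, y)) - Φ θ (fun y => Z (θ, y))| ≤
        L * Real.sqrt (d n θ).toReal := by
      intro n
      rw [abs_sub_comm]
      refine (h3 _ _ hmem (hmemH n)).trans (le_of_eq ?_)
      congr 2
      exact integral_abs_sq_eq (hdθ n).1
    rw [tendsto_iff_dist_tendsto_zero]
    refine squeeze_zero (fun n => dist_nonneg) hbound ?_
    have h4 : Tendsto (fun n => (d n θ).toReal) atTop (𝓝 (0 : ℝ≥0∞).toReal) :=
      (ENNReal.tendsto_toReal ENNReal.zero_ne_top).comp hd0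
    have h5 := (Real.continuous_sqrt.tendsto _).comp h4
    simpa using h5.const_mul L

end Generator

/-! ### Calculus for functions with finitely many jumps. -/

section FiniteVariation

/-- The square of a tail sum over distinct times. -/
theorem sum_sq_eq (J : Finset ℝ≥0) (z : ℝ≥0 → ℝ) :
    (∑ r ∈ J, z r) ^ 2 =
      ∑ r ∈ J, (2 * z r * ∑ q ∈ J with r < q, z q + z r ^ 2) := by
  induction J using Finset.induction_on_min with
  | empty => simp
  | insert a J ha ih =>
    have hna : a ∉ J := fun h => (ha a h).false
    rw [Finset.sum_insert hna, Finset.sum_insert hna, add_sq]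
    have h1 : Finset.filter (fun q => a < q) (insert a J) = J := by
      rw [Finset.filter_insert, if_neg (lt_irrefl a), Finset.filter_true_of_mem ha]
    have h2 : ∀ r ∈ J, Finset.filter (fun q => r < q) (insert a J) = Finset.filter (r < ·) J := by
      intro r hr
      rw [Finset.filter_insert, if_neg (not_lt.2 (ha r hr).le)]
    have h3 : ∑ r ∈ J, (2 * z r * ∑ q ∈ insert a J with r < q, z q + z r ^ 2) =
        ∑ r ∈ J, (2 * z r * ∑ q ∈ J with r < q, z q + z r ^ 2) :=
      Finset.sum_congr rfl fun r hr => by rw [h2 r hr]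
    rw [h1, h3, ← ih]
    ring

variable {s T : ℝ≥0} {h : ℝ≥0 → ℝ}

theorem setIntegral_Ioc_add {a b c : ℝ≥0} (hab : a ≤ b) (hbc : b ≤ c)
    (hh : IntegrableOn h (Ioc a c) leb) :
    ∫ r in Ioc a c, h r ∂leb = ∫ r in Ioc a b, h r ∂leb + ∫ r in Ioc b c, h r ∂leb := by
  rw [← Ioc_union_Ioc_eq_Ioc hab hbc]
  exact setIntegral_union (Ioc_disjoint_Ioc_of_le le_rfl) measurableSet_Ioc
    (hh.mono_set (Ioc_subset_Ioc_right hbc)) (hh.mono_set (Ioc_subset_Ioc_left hab))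

theorem setIntegral_Ioc_eq_indicator {r : ℝ≥0} (hr : s ≤ r) :
    ∫ q in Ioc r T, h q ∂leb = ∫ q in Ioc s T, (Ioi r).indicator h q ∂leb := by
  rw [setIntegral_indicator measurableSet_Ioi, Ioc_inter_Ioi, max_eq_right hr]

theorem integrable_mul_tail (hh : IntegrableOn h (Ioc s T) leb) :
    IntegrableOn (fun r => h r * ∫ q in Ioc r T, h q ∂leb) (Ioc s T) leb := by
  have hprod : Integrable (fun q : ℝ≥0 × ℝ≥0 => h q.1 * h q.2)
      ((leb.restrict (Ioc s T)).prod (leb.restrict (Ioc s T))) := hh.mul_prod hh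
  have hset : MeasurableSet {q : ℝ≥0 × ℝ≥0 | q.1 < q.2} :=
    measurableSet_lt measurable_fst measurable_snd
  have h1 := (hprod.indicator hset).integral_prod_left
  refine h1.congr ?_
  filter_upwards [ae_restrict_mem measurableSet_Ioc] with r hr
  rw [setIntegral_Ioc_eq_indicator hr.1.le, ← integral_const_mul]
  refine integral_congr_ae (Eventually.of_forall fun q => ?_)
  by_cases hq : r < q <;> simp [indicator, hq]

/-- By Fubini the square is an integral over a square domain; its diagonal is null and the two
triangles contribute equally. -/
theorem sq_setIntegral_eq (hh : IntegrableOn h (Ioc s T) leb) :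
    (∫ r in Ioc s T, h r ∂leb) ^ 2 =
      2 * ∫ r in Ioc s T, h r * ∫ q in Ioc r T, h q ∂leb ∂leb := by
  set m := leb.restrict (Ioc s T) with hm
  have hprod : Integrable (fun q : ℝ≥0 × ℝ≥0 => h q.1 * h q.2) (m.prod m) := hh.mul_prod hh
  have hset : MeasurableSet {q : ℝ≥0 × ℝ≥0 | q.1 < q.2} :=
    measurableSet_lt measurable_fst measurable_snd
  have hset' : MeasurableSet {q : ℝ≥0 × ℝ≥0 | q.2 < q.1} :=
    measurableSet_lt measurable_snd measurable_fst
  have h1 := hprod.indicator hset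
  have h2 := hprod.indicator hset'
  have hA : ∫ q, {q : ℝ≥0 × ℝ≥0 | q.1 < q.2}.indicator (fun q => h q.1 * h q.2) q ∂(m.prod m) =
      ∫ r, h r * ∫ q in Ioc r T, h q ∂leb ∂m := by
    rw [integral_prod _ h1]
    refine integral_congr_ae ?_
    filter_upwards [ae_restrict_mem measurableSet_Ioc] with r hr
    rw [setIntegral_Ioc_eq_indicator hr.1.le, ← integral_const_mul]
    refine integral_congr_ae (Eventually.of_forall fun q => ?_)
    by_cases hq : r < q <;> simp [indicator, hq]
  have hB : ∫ q, {q : ℝ≥0 × ℝ≥0 | q.2 < q.1}.indicator (fun q => h q.1 * h q.2) q ∂(m.prod m) =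
      ∫ r, h r * ∫ q in Ioc r T, h q ∂leb ∂m := by
    rw [← hA, ← integral_prod_swap]
    refine integral_congr_ae (Eventually.of_forall fun q => ?_)
    by_cases hq : q.1 < q.2 <;> simp [indicator, hq, mul_comm]
  have hdiag : ∀ᵐ q ∂(m.prod m), q.1 ≠ q.2 := by
    have hd : MeasurableSet {q : ℝ≥0 × ℝ≥0 | q.1 = q.2} :=
      measurableSet_eq_fun measurable_fst measurable_snd
    have : (m.prod m) {q : ℝ≥0 × ℝ≥0 | q.1 = q.2} = 0 := by
      rw [Measure.measure_prod_null hd]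
      refine Eventually.of_forall fun r => ?_
      have : Prod.mk r ⁻¹' {q : ℝ≥0 × ℝ≥0 | q.1 = q.2} = {r} := by
        ext q; simp [eq_comm]
      dsimp only
      rw [this]
      simp [hm]
    rw [ae_iff]
    simpa using this
  calc (∫ r, h r ∂m) ^ 2 = ∫ q, h q.1 * h q.2 ∂(m.prod m) := by
        rw [integral_prod_mul, sq]
    _ = ∫ q, ({q : ℝ≥0 × ℝ≥0 | q.1 < q.2}.indicator (fun q => h q.1 * h q.2) q +
        {q : ℝ≥0 × ℝ≥0 | q.2 < q.1}.indicator (fun q => h q.1 * h q.2) q) ∂(m.prod m) := by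
        refine integral_congr_ae ?_
        filter_upwards [hdiag] with q hq
        rcases lt_or_gt_of_ne hq with h | h <;> simp [indicator, h, h.le]
    _ = _ := by rw [integral_add h1 h2, hA, hB]; ring

theorem integrable_sum_tail (J : Finset ℝ≥0) (z : ℝ≥0 → ℝ) (hh : IntegrableOn h (Ioc s T) leb) :
    IntegrableOn (fun r => h r * ∑ q ∈ J with r < q, z q) (Ioc s T) leb := by
  have : ∀ r, h r * ∑ q ∈ J with r < q, z q = ∑ q ∈ J, z q * (Iio q).indicator h r := by
    intro r
    rw [Finset.sum_filter, Finset.mul_sum]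
    refine Finset.sum_congr rfl fun q _ => ?_
    by_cases hq : r < q <;> simp [indicator, hq, mul_comm]
  simp_rw [this]
  exact integrable_finsetSum _ fun q _ => (hh.indicator measurableSet_Iio).const_mul _

theorem setIntegral_sum_tail (J : Finset ℝ≥0) (z : ℝ≥0 → ℝ) (hJ : ∀ r ∈ J, r ≤ T)
    (hh : IntegrableOn h (Ioc s T) leb) :
    ∫ r in Ioc s T, h r * ∑ q ∈ J with r < q, z q ∂leb =
      ∑ q ∈ J, z q * ∫ r in Ioc s q, h r ∂leb := by
  have : ∀ r, h r * ∑ q ∈ J with r < q, z q = ∑ q ∈ J, z q * (Iio q).indicator h r := by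
    intro r
    rw [Finset.sum_filter, Finset.mul_sum]
    refine Finset.sum_congr rfl fun q _ => ?_
    by_cases hq : r < q <;> simp [indicator, hq, mul_comm]
  simp_rw [this]
  rw [integral_finsetSum _ fun q _ => (hh.indicator measurableSet_Iio).const_mul _]
  refine Finset.sum_congr rfl fun q hq => ?_
  rw [integral_const_mul, setIntegral_indicator measurableSet_Iio]
  congr 1
  refine setIntegral_congr_set ?_
  have : Ioc s T ∩ Iio q = Ioo s q := by
    ext r
    simp only [mem_inter_iff, mem_Ioc, mem_Iio, mem_Ioo]
    exact ⟨fun h => ⟨h.1.1, h.2⟩, fun h => ⟨⟨h.1, h.2.le.trans (hJ q hq)⟩, h.2⟩⟩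
  rw [this]
  exact Ioo_ae_eq_Ioc

variable {t : ℝ≥0} {u z : ℝ≥0 → ℝ} {ξ : ℝ} {J : Finset ℝ≥0}

/-- Functions on `[t,T]` that are the sum of an absolutely continuous function with derivative `-h`
and a step function with jump `z r` at each `r ∈ J`, with terminal value `ξ`. -/
def IsFiniteVariation (t T : ℝ≥0) (J : Finset ℝ≥0) (z h : ℝ≥0 → ℝ) (ξ : ℝ) (u : ℝ≥0 → ℝ) : Prop :=
  ∀ s ∈ Icc t T, u s = ξ + ∫ r in Ioc s T, h r ∂leb - ∑ r ∈ J with s < r, z r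

/-- The chain rule for the square of a function of finite variation. -/
theorem IsFiniteVariation.sq_eq (hu : IsFiniteVariation t T J z h ξ u)
    (hh : IntegrableOn h (Ioc t T) leb) (hJ : ∀ r ∈ J, t < r ∧ r ≤ T) {s : ℝ≥0}
    (hs : s ∈ Icc t T) :
    u s ^ 2 + ∑ r ∈ J with s < r, (2 * u r * z r - z r ^ 2) =
      ξ ^ 2 + 2 * ∫ r in Ioc s T, u r * h r ∂leb := by
  have hhs : IntegrableOn h (Ioc s T) leb := hh.mono_set (Ioc_subset_Ioc_left hs.1)
  set Js := J.filter (s < ·) with hJs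
  have hJsT : ∀ r ∈ Js, r ≤ T := fun r hr => (hJ r (Finset.mem_filter.1 hr).1).2
  have hJss : ∀ r ∈ Js, s < r := fun r hr => (Finset.mem_filter.1 hr).2
  have htail : ∀ r, s ≤ r → J.filter (r < ·) = Js.filter (r < ·) := by
    intro r hr
    ext q
    simp only [hJs, Finset.mem_filter]
    exact ⟨fun h => ⟨⟨h.1, hr.trans_lt h.2⟩, h.2⟩, fun h => ⟨h.1.1, h.2⟩⟩
  have hur : ∀ r ∈ Icc s T, u r = ξ + ∫ q in Ioc r T, h q ∂leb - ∑ q ∈ Js with r < q, z q := by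
    intro r hr
    rw [hu r ⟨hs.1.trans hr.1, hr.2⟩, htail r hr.1]
  have hadd : IntegrableOn (fun r => ξ * h r + h r * ∫ q in Ioc r T, h q ∂leb) (Ioc s T) leb :=
    (hhs.const_mul ξ).add (integrable_mul_tail hhs)
  have hint : ∫ r in Ioc s T, u r * h r ∂leb = ξ * ∫ r in Ioc s T, h r ∂leb +
      ∫ r in Ioc s T, h r * ∫ q in Ioc r T, h q ∂leb ∂leb -
      ∑ q ∈ Js, z q * ∫ r in Ioc s q, h r ∂leb := by
    rw [← setIntegral_sum_tail Js z hJsT hhs, ← integral_const_mul,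
      ← integral_add (hhs.const_mul ξ) (integrable_mul_tail hhs),
      ← integral_sub hadd (integrable_sum_tail Js z hhs)]
    refine setIntegral_congr_fun measurableSet_Ioc fun r hr => ?_
    rw [hur r ⟨hr.1.le, hr.2⟩]
    ring
  -- In the cross terms a jump at `r` meets `∫_r^T h`, whereas in `hint` it meets `∫_s^r h`;
  -- together they give the full integral over `(s,T]`. The products of jumps assemble into a square
  -- by `sum_sq_eq`.
  have hsum : ∑ r ∈ Js, (2 * u r * z r - z r ^ 2) =
      2 * ξ * ∑ r ∈ Js, z r + 2 * (∫ r in Ioc s T, h r ∂leb) * ∑ r ∈ Js, z r -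
        2 * ∑ r ∈ Js, z r * ∫ q in Ioc s r, h q ∂leb - (∑ r ∈ Js, z r) ^ 2 := by
    rw [sum_sq_eq, Finset.mul_sum, Finset.mul_sum, Finset.mul_sum, ← Finset.sum_add_distrib,
      ← Finset.sum_sub_distrib, ← Finset.sum_sub_distrib]
    refine Finset.sum_congr rfl fun r hr => ?_
    rw [hur r ⟨(hJss r hr).le, hJsT r hr⟩, setIntegral_Ioc_add (hJss r hr).le (hJsT r hr) hhs]
    ring
  rw [hsum, hint, hu s hs, ← hJs]
  linear_combination sq_setIntegral_eq hhs

/-- The integral part is continuous, while the sum over strictly later jumps includes the jump at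
`r` as soon as `s < r`. -/
theorem IsFiniteVariation.tendsto_left (hu : IsFiniteVariation t T J z h ξ u)
    (hh : IntegrableOn h (Ioc t T) leb) {r : ℝ≥0} (hr : r ∈ Ioc t T) :
    Tendsto u (𝓝[<] r) (𝓝 (u r - if r ∈ J then z r else 0)) := by
  have hev : ∀ᶠ s in 𝓝[<] r, s ∈ Ioo t r := Ioo_mem_nhdsLT hr.1
  have h1 : Tendsto (fun s => ∫ q in Ioc s T, h q ∂leb) (𝓝[<] r)
      (𝓝 (∫ q in Ioc r T, h q ∂leb)) := by
    rw [setIntegral_Ioc_eq_indicator hr.1.le]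
    have : Tendsto (fun s => ∫ q in Ioc t T, (Ioi s).indicator h q ∂leb) (𝓝[<] r)
        (𝓝 (∫ q in Ioc t T, (Ioi r).indicator h q ∂leb)) := by
      refine tendsto_integral_filter_of_dominated_convergence (fun q => ‖h q‖)
        (Eventually.of_forall fun s => hh.aestronglyMeasurable.indicator measurableSet_Ioi)
        (Eventually.of_forall fun s => Eventually.of_forall fun q => norm_indicator_le_norm_self _ _)
        hh.norm ?_
      have hne : ∀ᵐ q ∂(leb.restrict (Ioc t T)), q ≠ r := by
        rw [ae_iff]; simp
      filter_upwards [hne] with q hq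
      refine tendsto_const_nhds.congr' ?_
      rcases lt_or_gt_of_ne hq with hlt | hgt
      · filter_upwards [Ioo_mem_nhdsLT hlt] with s hs
        simp [indicator, hlt.not_gt, hs.1.not_gt]
      · filter_upwards [self_mem_nhdsWithin] with s hs
        simp [indicator, hgt, lt_trans (mem_Iio.1 hs) hgt]
    refine this.congr' ?_
    filter_upwards [hev] with s hs
    exact (setIntegral_Ioc_eq_indicator hs.1.le).symm
  have h2 : ∀ᶠ s in 𝓝[<] r, ∑ q ∈ J with s < q, z q =
      ∑ q ∈ J with r < q, z q + if r ∈ J then z r else 0 := by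
    have h3 : ∀ᶠ s in 𝓝[<] r, ∀ q ∈ J, q < r → q ≤ s := by
      rw [Finset.eventually_all]
      intro q _
      by_cases hq : q < r
      · filter_upwards [Ioo_mem_nhdsLT hq] with s hs _ using hs.1.le
      · exact Eventually.of_forall fun s h => absurd h hq
    filter_upwards [h3, self_mem_nhdsWithin] with s hs hsr
    rw [← Finset.sum_ite_eq' J r z, Finset.sum_filter, Finset.sum_filter,
      ← Finset.sum_add_distrib]
    refine Finset.sum_congr rfl fun q hq => ?_
    rcases lt_trichotomy q r with hlt | rfl | hgt
    · simp [hlt.ne, hlt.not_gt, (hs q hq hlt).not_gt]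
    · simp [mem_Iio.1 hsr]
    · simp [hgt.ne', hgt, lt_trans (mem_Iio.1 hsr) hgt]
  have h4 : Tendsto (fun s => ξ + ∫ q in Ioc s T, h q ∂leb -
      (∑ q ∈ J with r < q, z q + if r ∈ J then z r else 0)) (𝓝[<] r)
      (𝓝 (u r - if r ∈ J then z r else 0)) := by
    rw [hu r ⟨hr.1.le, hr.2⟩, sub_sub]
    exact (tendsto_const_nhds.add h1).sub tendsto_const_nhds
  refine h4.congr' ?_
  filter_upwards [hev, h2] with s hs hs2
  rw [hu s ⟨hs.1.le, hs.2.le.trans hr.2⟩, hs2]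

end FiniteVariation

/-! ### Left limits as predictable processes. -/

section LeftLimit

/-- The left limit of a process along a grid. -/
def leftLimit {Ω : Type*} (t : ℝ≥0) (U : ℝ≥0 → Ω → ℝ) (s : ℝ≥0) (ω : Ω) : ℝ :=
  -- A `limsup` preserves measurability without any convergence; it is the left limit on the paths
  -- that have one.
  limsup (fun m => U (leftGrid t m s) ω) atTop

theorem leftLimit_eq {Ω : Type*} {t T : ℝ≥0} {J : Finset ℝ≥0} {z h : ℝ≥0 → ℝ} {ξ : ℝ}
    {U : ℝ≥0 → Ω → ℝ} {ω : Ω} (hu : IsFiniteVariation t T J z h ξ (U · ω))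
    (hh : IntegrableOn h (Ioc t T) leb) {r : ℝ≥0} (hr : r ∈ Ioc t T) :
    leftLimit t U r ω = U r ω - if r ∈ J then z r else 0 :=
  ((hu.tendsto_left hh hr).comp (tendsto_leftGrid hr.1)).limsup_eq

/-- At each level of the grid the process is constant in time on left-open cells, with a value known
at the left endpoint; this is a countable union of predictable rectangles. -/
theorem measurable_leftLimit {Ω : Type*} {mΩ : MeasurableSpace Ω} {t : ℝ≥0}
    {𝓕 : Filtration (Ici t) mΩ} {U : ℝ≥0 → Ω → ℝ}
    (hU : ∀ s (hs : t ≤ s), Measurable[𝓕 ⟨s, hs⟩] (U s)) :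
    Measurable[𝓕.predictable] fun q : Ici t × Ω => leftLimit t U q.1 q.2 := by
  unfold leftLimit
  refine Measurable.limsup fun m => ?_
  have hle : ∀ k : ℕ, t ≤ t + (k : ℝ≥0) / (m + 1) := fun k => le_self_add
  let ι : Ici t → ℕ := fun s => ⌈((m : ℝ≥0) + 1) * (s - t)⌉₊ - 1
  let g : ℕ → Ici t := fun k => ⟨t + (k : ℝ≥0) / (m + 1), hle k⟩
  have hm : (0 : ℝ≥0) < m + 1 := by positivity
  have hcell : ∀ k (A : Set Ω), MeasurableSet[𝓕 (g k)] A →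
      MeasurableSet[𝓕.predictable] ((ι ⁻¹' {k}) ×ˢ A) := by
    intro k A hA
    have hIoc : ∀ s : Ici t, ⊥ < s → (ι s = k ↔ s ∈ Ioc (g k) (g (k + 1))) := by
      intro s hs
      have hts : t < s := hs
      have h1 := ceil_pos_of_lt m hts
      have h2 : ι s = k ↔ ⌈((m : ℝ≥0) + 1) * (s - t)⌉₊ = k + 1 := by
        simp only [ι]; omega
      rw [h2, Nat.ceil_eq_iff (by simp), mem_Ioc, ← Subtype.coe_lt_coe, ← Subtype.coe_le_coe]
      simp only [g, ← lt_tsub_iff_left, ← tsub_le_iff_left, div_lt_iff₀ hm, le_div_iff₀ hm]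
      rw [mul_comm ((s : ℝ≥0) - t)]
      simp
    -- At the initial time the ceiling is `0` and truncated subtraction yields index `0`, so the
    -- cell `k = 0` also contains the slice over `⊥`.
    have hset : (ι ⁻¹' {k}) ×ˢ A = (Ioc (g k) (g (k + 1)) ×ˢ A) ∪
        if k = 0 then {⊥} ×ˢ A else ∅ := by
      ext ⟨s, ω⟩
      simp only [mem_prod, mem_preimage, mem_singleton_iff, mem_union]
      rcases eq_or_ne s ⊥ with rfl | hs
      · have h0 : ι ⊥ = 0 := by
          have : ((⊥ : Ici t) : ℝ≥0) = t := rfl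
          simp [ι, this]
        rw [h0]
        rcases eq_or_ne k 0 with rfl | hk
        · simp
        · simp [hk, hk.symm]
      · rw [hIoc s (bot_lt_iff_ne_bot.2 hs)]
        split_ifs <;> simp [hs]
    rw [hset]
    refine @MeasurableSet.union _ 𝓕.predictable _ _ (measurableSet_predictable_Ioc_prod _ _ hA) ?_
    split_ifs with hk
    · refine measurableSet_predictable_singleton_bot_prod ?_
      have : g k = ⊥ := by
        rw [hk]; exact Subtype.ext (by simp [g])
      rwa [this] at hA
    · exact @MeasurableSet.empty _ 𝓕.predictable
  intro B hB
  have : (fun q : Ici t × Ω => U (leftGrid t m q.1) q.2) ⁻¹' B =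
      ⋃ k, (ι ⁻¹' {k}) ×ˢ (U (g k) ⁻¹' B) := by
    ext ⟨s, ω⟩
    simp [ι, g, leftGrid]
  rw [this]
  exact @MeasurableSet.iUnion _ _ 𝓕.predictable _ _ fun k => hcell k _ (hU _ _ hB)

end LeftLimit

/-! ### Pathwise integrals against the jump measure. -/

section PathIntegral

variable {K Ω : Type*} [MeasurableSpace K] {X : ℝ≥0 → Ω → K} {ω : Ω}

theorem filter_jumpFinset (hx : IsStepPath (X · ω)) {t s T : ℝ≥0} (hts : t ≤ s) :
    (jumpFinset hx t T).filter (s < ·) = jumpFinset hx s T := by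
  ext r
  simp only [Finset.mem_filter, mem_jumpFinset]
  exact ⟨fun h => ⟨h.1.1, h.2, h.1.2.2⟩, fun h => ⟨⟨h.1, hts.trans_lt h.2.1, h.2.2⟩, h.2.1⟩⟩

theorem integral_jumpPointMeasure [MeasurableSingletonClass K] (hx : IsStepPath (X · ω))
    {t a : ℝ≥0} (hta : t ≤ a) (b : ℝ≥0) (F : ℝ≥0 × K → ℝ) :
    ∫ q in Ioc a b ×ˢ univ, F q ∂(jumpPointMeasure X t ω) =
      ∑ r ∈ jumpFinset hx a b, F (r, X r ω) := by
  rw [jumpPointMeasure_restrict t hx hta, integral_finsetSum_measure fun r _ =>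
    integrable_dirac (by simp)]
  exact Finset.sum_congr rfl fun r _ => integral_dirac _ _

end PathIntegral

theorem enorm_integral_sq_le {α : Type*} {mα : MeasurableSpace α} {ρ : Measure α} {F : α → ℝ}
    (hF : AEStronglyMeasurable F ρ) :
    ‖∫ y, F y ∂ρ‖ₑ ^ 2 ≤ ρ univ * ∫⁻ y, ‖F y‖ₑ ^ 2 ∂ρ := by
  have h1 : ‖∫ y, F y ∂ρ‖ₑ ≤ eLpNorm F 1 ρ := by
    rw [eLpNorm_one_eq_lintegral_enorm]
    exact enorm_integral_le_lintegral_enorm _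
  have h2 := eLpNorm_le_eLpNorm_mul_rpow_measure_univ one_le_two hF
  rw [lintegral_sq_eq_eLpNorm]
  calc ‖∫ y, F y ∂ρ‖ₑ ^ 2 ≤ (eLpNorm F 2 ρ * ρ univ ^ (1 / 2 : ℝ)) ^ 2 := by
        refine pow_le_pow_left₀ zero_le (h1.trans (h2.trans_eq ?_)) 2
        norm_num
    _ = ρ univ * eLpNorm F 2 ρ ^ 2 := by
        rw [mul_pow, ← ENNReal.rpow_natCast (ρ univ ^ _), ← ENNReal.rpow_mul]
        norm_num [mul_comm]

theorem ae_prod_snd_mem {α β : Type*} {mα : MeasurableSpace α} {mβ : MeasurableSpace β}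
    (μ : Measure α) (m : Measure β) [SFinite m] {S : Set β} (hS : MeasurableSet S) :
    ∀ᵐ θ ∂(μ.prod (m.restrict S)), θ.2 ∈ S :=
  Measure.quasiMeasurePreserving_snd.ae (ae_restrict_mem hS)

/-! ### The linear backward equation and its energy identity. -/

section Energy

variable {K Ω : Type*} [MeasurableSpace K] [MeasurableSpace Ω] {t : ℝ≥0}

/-- The jump random measure of `X` on `(t,T]`, given by the kernel `p`, has compensator
`κ(ω,s,dy) ds` for the filtration `𝓕`. -/
structure HasCompensator (𝓕 : Filtration (Ici t) ‹MeasurableSpace Ω›) (μ : Measure Ω)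
    (X : ℝ≥0 → Ω → K) (ν : Kernel (ℝ≥0 × K) K) (T Λ : ℝ≥0)
    (κ : Kernel (Ω × ℝ≥0) K) (p : Kernel Ω (ℝ≥0 × K)) : Prop where
  isStepPath : ∀ ω, IsStepPath (X · ω)
  measurable_apply : ∀ s, t ≤ s → Measurable (X s)
  rate_le : ∀ θ, κ θ univ ≤ Λ
  rate_eq : ∀ ω, ∀ s ∈ Icc t T, κ (ω, s) = ν (s, X s ω)
  jump_eq : ∀ ω, p ω = (jumpPointMeasure X t ω).restrict (Ioc t T ×ˢ univ)
  map_eq : @Measure.map _ _ _ (𝓕.predictable.prod inferInstance) (toPredictable t) (μ ⊗ₘ p) =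
    @Measure.map _ _ _ (𝓕.predictable.prod inferInstance) (toPredictable t)
      (μ ⊗ₘ (Kernel.const Ω (leb.restrict (Ioc t T)) ⊗ₖ κ))

/-- `(U,H)` solves the backward equation with driver `D`, a given process, and terminal
value `ξ`. -/
structure IsLinearSolution (𝓕 : Filtration (Ici t) ‹MeasurableSpace Ω›) (μ : Measure Ω)
    (X : ℝ≥0 → Ω → K) (ν : Kernel (ℝ≥0 × K) K) (T : ℝ≥0) (κ : Kernel (Ω × ℝ≥0) K)
    (U : ℝ≥0 → Ω → ℝ) (H : ℝ≥0 → Ω → K → ℝ) (ξ : Ω → ℝ) (D : ℝ≥0 → Ω → ℝ) : Prop where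
  adapted : ∀ s (hs : t ≤ s), Measurable[𝓕 ⟨s, hs⟩] (U s)
  predictable : Measurable[𝓕.predictable.prod inferInstance]
    fun q : (Ici t × Ω) × K => H q.1.1 q.1.2 q.2
  memLp_terminal : MemLp ξ 2 μ
  memLp_driver : MemLp (fun θ : Ω × ℝ≥0 => D θ.2 θ.1) 2 (μ.prod (leb.restrict (Ioc t T)))
  memLp_left : MemLp (fun θ : Ω × ℝ≥0 => U θ.2 θ.1) 2 (μ.prod (leb.restrict (Ioc t T)))
  sq_lt_top : ∫⁻ θ, ∫⁻ y, ‖H (max t θ.2) θ.1 y‖ₑ ^ 2 ∂(κ θ)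
    ∂(μ.prod (leb.restrict (Ioc t T))) < ∞
  equation : ∀ᵐ ω ∂μ, ∀ s ∈ Icc t T,
    U s ω + compensatedIntegral X ν t H s T ω = ξ ω + ∫ r in Ioc s T, D r ω ∂leb

variable {𝓕 : Filtration (Ici t) ‹MeasurableSpace Ω›} {μ : Measure Ω} [IsProbabilityMeasure μ]
  {X : ℝ≥0 → Ω → K} {ν : Kernel (ℝ≥0 × K) K} {T Λ : ℝ≥0} {κ : Kernel (Ω × ℝ≥0) K}
  [IsFiniteKernel κ] {p : Kernel Ω (ℝ≥0 × K)} [IsSFiniteKernel p]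
  {U : ℝ≥0 → Ω → ℝ} {H : ℝ≥0 → Ω → K → ℝ} {ξ : Ω → ℝ} {D : ℝ≥0 → Ω → ℝ}

theorem measurable_of_predictable (hH : Measurable[𝓕.predictable.prod inferInstance]
      fun q : (Ici t × Ω) × K => H q.1.1 q.1.2 q.2) :
    Measurable fun q : (Ω × ℝ≥0) × K => H (max t q.1.2) q.1.1 q.2 := by
  have h1 : Measurable fun q : (Ω × ℝ≥0) × K => (q.1.1, (q.1.2, q.2)) := by fun_prop
  exact @Measurable.comp _ _ _ _ (𝓕.predictable.prod inferInstance) _ _ _ hH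
    ((measurable_toPredictable 𝓕).comp h1)

/-- The integral of `H` with respect to the jump rate. -/
def rateIntegral (κ : Kernel (Ω × ℝ≥0) K) (t : ℝ≥0) (H : ℝ≥0 → Ω → K → ℝ) (θ : Ω × ℝ≥0) : ℝ :=
  ∫ y, H (max t θ.2) θ.1 y ∂(κ θ)

/-- Cauchy–Schwarz in `y`, with total mass at most `Λ`. -/
theorem IsLinearSolution.memLp_rateIntegral (hS : IsLinearSolution 𝓕 μ X ν T κ U H ξ D)
    (hκ : ∀ θ, κ θ univ ≤ Λ) :
    MemLp (rateIntegral κ t H) 2 (μ.prod (leb.restrict (Ioc t T))) := by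
  have hm := measurable_of_predictable hS.predictable
  have h1 : StronglyMeasurable (rateIntegral κ t H) :=
    hm.stronglyMeasurable.integral_kernel_prod_right'
  rw [memLp_two_iff h1.aestronglyMeasurable]
  refine lt_of_le_of_lt (lintegral_mono fun θ =>
    (enorm_integral_sq_le (hm.comp measurable_prodMk_left).aestronglyMeasurable).trans
      (mul_le_mul_left (hκ θ) _)) ?_
  rw [lintegral_const_mul' _ _ ENNReal.coe_ne_top]
  exact ENNReal.mul_lt_top ENNReal.coe_lt_top hS.sq_lt_top

theorem IsLinearSolution.ae_isFiniteVariation [MeasurableSingletonClass K]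
    (hS : IsLinearSolution 𝓕 μ X ν T κ U H ξ D) (hC : HasCompensator 𝓕 μ X ν T Λ κ p) :
    ∀ᵐ ω ∂μ, IntegrableOn (fun r => D r ω + rateIntegral κ t H (ω, r)) (Ioc t T) leb ∧
      IsFiniteVariation t T (jumpFinset (hC.isStepPath ω) t T) (fun r => H r ω (X r ω))
        (fun r => D r ω + rateIntegral κ t H (ω, r)) (ξ ω) (U · ω) := by
  have hD := ((hS.memLp_driver.integrable (by norm_num)).prod_right_ae)
  have hb := (((hS.memLp_rateIntegral hC.rate_le).integrable (by norm_num)).prod_right_ae)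
  filter_upwards [hS.equation, hD, hb] with ω hω hDω hbω
  refine ⟨hDω.add hbω, fun s hs => ?_⟩
  have hsub : Ioc s T ⊆ Ioc t T := Ioc_subset_Ioc_left hs.1
  have h1 : ∫ r in Ioc s T, (∫ y, H r ω y ∂(ν (r, X r ω))) ∂leb =
      ∫ r in Ioc s T, rateIntegral κ t H (ω, r) ∂leb := by
    refine setIntegral_congr_fun measurableSet_Ioc fun r hr => ?_
    have hr' := hsub hr
    simp only [rateIntegral]
    rw [hC.rate_eq ω r ⟨hr'.1.le, hr'.2⟩, max_eq_right hr'.1.le]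
  have h2 := hω s hs
  rw [compensatedIntegral, integral_jumpPointMeasure (hC.isStepPath ω) hs.1 T
    (fun q => H q.1 ω q.2), h1] at h2
  rw [filter_jumpFinset _ hs.1, integral_add (IntegrableOn.mono_set hDω hsub)
    (IntegrableOn.mono_set hbω hsub)]
  linear_combination h2

/-- `U` jumps only where `X` does, so under `dr` the predictable left limit may be replaced by `U`
itself. -/
theorem IsLinearSolution.ae_leftLimit_eq [MeasurableSingletonClass K]
    (hS : IsLinearSolution 𝓕 μ X ν T κ U H ξ D) (hC : HasCompensator 𝓕 μ X ν T Λ κ p) :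
    ∀ᵐ ω ∂μ, ∀ᵐ r ∂(leb.restrict (Ioc t T)), leftLimit t U r ω = U r ω := by
  filter_upwards [hS.ae_isFiniteVariation hC] with ω hω
  filter_upwards [pathJumps_null (hC.isStepPath ω) t T, ae_restrict_mem measurableSet_Ioc]
    with r hr hrt
  rw [leftLimit_eq hω.2 hω.1 hrt, if_neg fun h => hr ((mem_jumpFinset _).1 h).1, sub_zero]

/-- The integrand of the jump measure in the equation for the square. -/
def squareIntegrand (s : ℝ≥0) (U : ℝ≥0 → Ω → ℝ) (H : ℝ≥0 → Ω → K → ℝ)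
    (q : (Ici t × Ω) × K) : ℝ :=
  {q : (Ici t × Ω) × K | s < q.1.1}.indicator
    (fun q => 2 * leftLimit t U q.1.1 q.1.2 * H q.1.1 q.1.2 q.2 + H q.1.1 q.1.2 q.2 ^ 2) q

theorem IsLinearSolution.measurable_squareIntegrand (hS : IsLinearSolution 𝓕 μ X ν T κ U H ξ D)
    {s : ℝ≥0} (hs : t ≤ s) :
    Measurable[𝓕.predictable.prod inferInstance]
      (squareIntegrand s U H : (Ici t × Ω) × K → ℝ) := by
  have h1 : MeasurableSet[𝓕.predictable.prod inferInstance]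
      {q : (Ici t × Ω) × K | s < q.1.1} := by
    have h2 : MeasurableSet[𝓕.predictable] (Ioi (⟨s, hs⟩ : Ici t) ×ˢ (univ : Set Ω)) :=
      measurableSet_predictable_Ioi_prod MeasurableSet.univ
    have h3 := @measurable_fst _ K 𝓕.predictable ‹_› _ h2
    have h4 : {q : (Ici t × Ω) × K | s < q.1.1} =
        Prod.fst ⁻¹' (Ioi (⟨s, hs⟩ : Ici t) ×ˢ (univ : Set Ω)) := by
      ext q
      simp [← Subtype.coe_lt_coe]
    rw [h4]
    exact h3
  have h2 : Measurable[𝓕.predictable.prod inferInstance]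
      fun q : (Ici t × Ω) × K => leftLimit t U q.1.1 q.1.2 :=
    (measurable_leftLimit hS.adapted).comp (@measurable_fst _ K 𝓕.predictable ‹_›)
  have h3 := hS.predictable
  exact Measurable.indicator (((measurable_const.mul h2).mul h3).add (h3.pow_const 2)) h1

end Energy

theorem enorm_square_increment_le (a b : ℝ) :
    ‖2 * a * b + b ^ 2‖ₑ ≤ ‖a‖ₑ ^ 2 + 2 * ‖b‖ₑ ^ 2 := by
  have h2 : (2 : ℝ≥0∞) = ENNReal.ofReal 2 := by simp
  rw [Real.enorm_eq_ofReal_abs, Real.enorm_eq_ofReal_abs, Real.enorm_eq_ofReal_abs,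
    ← ENNReal.ofReal_pow (abs_nonneg _), ← ENNReal.ofReal_pow (abs_nonneg _), h2,
    ← ENNReal.ofReal_mul zero_le_two, ← ENNReal.ofReal_add (by positivity) (by positivity)]
  refine ENNReal.ofReal_le_ofReal ?_
  rw [sq_abs, sq_abs, abs_le]
  constructor <;> nlinarith [sq_nonneg (a - b), sq_nonneg (a + b), sq_nonneg b]

section Energy

variable {K Ω : Type*} [MeasurableSpace K] [MeasurableSpace Ω] {t : ℝ≥0}
  {𝓕 : Filtration (Ici t) ‹MeasurableSpace Ω›} {μ : Measure Ω} [IsProbabilityMeasure μ]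
  {X : ℝ≥0 → Ω → K} {ν : Kernel (ℝ≥0 × K) K} {T Λ : ℝ≥0} {κ : Kernel (Ω × ℝ≥0) K}
  [IsFiniteKernel κ] {p : Kernel Ω (ℝ≥0 × K)} [IsSFiniteKernel p]
  {U : ℝ≥0 → Ω → ℝ} {H : ℝ≥0 → Ω → K → ℝ} {ξ : Ω → ℝ} {D : ℝ≥0 → Ω → ℝ}

theorem squareIntegrand_toPredictable {s r : ℝ≥0} (hr : t < r) (ω : Ω) (y : K) :
    squareIntegrand s U H (toPredictable t (ω, (r, y))) =
      if s < r then 2 * leftLimit t U r ω * H r ω y + H r ω y ^ 2 else 0 := by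
  have hmax : max t r = r := max_eq_right hr.le
  split_ifs with hsr
  · rw [squareIntegrand, indicator_of_mem (by simpa [toPredictable, hmax] using hsr)]
    simp only [toPredictable]
    rw [hmax]
  · rw [squareIntegrand, indicator_of_notMem (by simpa [toPredictable, hmax] using hsr)]

/-- The integral of `H²` with respect to the jump rate. -/
def sqRateIntegral (κ : Kernel (Ω × ℝ≥0) K) (t : ℝ≥0) (H : ℝ≥0 → Ω → K → ℝ) (θ : Ω × ℝ≥0) : ℝ :=
  ∫ y, H (max t θ.2) θ.1 y ^ 2 ∂(κ θ)

theorem sqRateIntegral_eq (hH : Measurable[𝓕.predictable.prod inferInstance]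
      fun q : (Ici t × Ω) × K => H q.1.1 q.1.2 q.2) (θ : Ω × ℝ≥0) :
    sqRateIntegral κ t H θ = (∫⁻ y, ‖H (max t θ.2) θ.1 y‖ₑ ^ 2 ∂(κ θ)).toReal := by
  have hm : AEStronglyMeasurable (fun y => H (max t θ.2) θ.1 y) (κ θ) :=
    ((measurable_of_predictable hH).comp measurable_prodMk_left).aestronglyMeasurable
  rw [← integral_abs_sq_eq hm]
  simp only [sq_abs]
  rfl

theorem measurable_lintegral_sq (hH : Measurable[𝓕.predictable.prod inferInstance]
      fun q : (Ici t × Ω) × K => H q.1.1 q.1.2 q.2) :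
    Measurable fun θ : Ω × ℝ≥0 => ∫⁻ y, ‖H (max t θ.2) θ.1 y‖ₑ ^ 2 ∂(κ θ) :=
  ((measurable_of_predictable hH).enorm.pow_const 2).lintegral_kernel_prod_right'

theorem integrable_sqRateIntegral {m : Measure (Ω × ℝ≥0)}
    (hH : Measurable[𝓕.predictable.prod inferInstance]
      fun q : (Ici t × Ω) × K => H q.1.1 q.1.2 q.2)
    (hH2 : ∫⁻ θ, ∫⁻ y, ‖H (max t θ.2) θ.1 y‖ₑ ^ 2 ∂(κ θ) ∂m < ∞) :
    Integrable (sqRateIntegral κ t H) m := by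
  have h : sqRateIntegral κ t H = fun θ =>
      (∫⁻ y, ‖H (max t θ.2) θ.1 y‖ₑ ^ 2 ∂(κ θ)).toReal := funext fun θ => sqRateIntegral_eq hH θ
  rw [h]
  exact integrable_toReal_of_lintegral_ne_top (measurable_lintegral_sq hH).aemeasurable hH2.ne

theorem ae_memLp_of_predictable {m : Measure (Ω × ℝ≥0)}
    (hH : Measurable[𝓕.predictable.prod inferInstance]
      fun q : (Ici t × Ω) × K => H q.1.1 q.1.2 q.2)
    (hH2 : ∫⁻ θ, ∫⁻ y, ‖H (max t θ.2) θ.1 y‖ₑ ^ 2 ∂(κ θ) ∂m < ∞) :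
    ∀ᵐ θ ∂m, MemLp (fun y => H (max t θ.2) θ.1 y) 2 (κ θ) := by
  filter_upwards [ae_lt_top (measurable_lintegral_sq hH) hH2.ne] with θ hθ
  exact (memLp_two_iff ((measurable_of_predictable hH).comp
    measurable_prodMk_left).aestronglyMeasurable).2 hθ

theorem IsLinearSolution.integrable_sqRateIntegral (hS : IsLinearSolution 𝓕 μ X ν T κ U H ξ D) :
    Integrable (sqRateIntegral κ t H) (μ.prod (leb.restrict (Ioc t T))) :=
  JumpBSDE.integrable_sqRateIntegral hS.predictable hS.sq_lt_top

theorem IsLinearSolution.ae_memLp (hS : IsLinearSolution 𝓕 μ X ν T κ U H ξ D) :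
    ∀ᵐ θ ∂(μ.prod (leb.restrict (Ioc t T))), MemLp (fun y => H (max t θ.2) θ.1 y) 2 (κ θ) :=
  ae_memLp_of_predictable hS.predictable hS.sq_lt_top

/-- The square increment is at most `U² + 2 H²` and the mass of `κ` is bounded, so mean square
integrability of `U` and `H` suffices. Hence no localisation is needed in the energy identity. -/
theorem IsLinearSolution.integrable_squareIntegrand [MeasurableSingletonClass K]
    (hS : IsLinearSolution 𝓕 μ X ν T κ U H ξ D) (hC : HasCompensator 𝓕 μ X ν T Λ κ p)
    {s : ℝ≥0} (hs : t ≤ s) :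
    Integrable (fun q => squareIntegrand s U H (toPredictable t q))
      (μ ⊗ₘ (Kernel.const Ω (leb.restrict (Ioc t T)) ⊗ₖ κ)) := by
  have hm : Measurable fun q : Ω × (ℝ≥0 × K) => squareIntegrand s U H (toPredictable t q) :=
    @Measurable.comp _ _ _ _ (𝓕.predictable.prod inferInstance) _ _ _
      (hS.measurable_squareIntegrand hs) (measurable_toPredictable 𝓕)
  refine ⟨hm.aestronglyMeasurable, ?_⟩
  rw [HasFiniteIntegral, Measure.lintegral_compProd hm.enorm]
  have hW : AEMeasurable (fun θ : Ω × ℝ≥0 => Λ * ‖U θ.2 θ.1‖ₑ ^ 2 +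
      2 * ∫⁻ y, ‖H (max t θ.2) θ.1 y‖ₑ ^ 2 ∂(κ θ)) (μ.prod (leb.restrict (Ioc t T))) :=
    ((hS.memLp_left.aestronglyMeasurable.enorm.pow_const 2).const_mul _).add
      ((measurable_lintegral_sq hS.predictable).aemeasurable.const_mul _)
  have hle : ∫⁻ ω, ∫⁻ q, ‖squareIntegrand s U H (toPredictable t (ω, q))‖ₑ
      ∂((Kernel.const Ω (leb.restrict (Ioc t T)) ⊗ₖ κ) ω) ∂μ ≤
      ∫⁻ θ, (Λ * ‖U θ.2 θ.1‖ₑ ^ 2 + 2 * ∫⁻ y, ‖H (max t θ.2) θ.1 y‖ₑ ^ 2 ∂(κ θ))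
        ∂(μ.prod (leb.restrict (Ioc t T))) := by
    rw [lintegral_prod _ hW]
    refine lintegral_mono_ae ?_
    filter_upwards [hS.ae_leftLimit_eq hC] with ω hω
    have hmω : Measurable fun q => ‖squareIntegrand s U H (toPredictable t (ω, q))‖ₑ :=
      hm.enorm.comp measurable_prodMk_left
    rw [Kernel.lintegral_compProd _ _ _ hmω, Kernel.const_apply]
    refine lintegral_mono_ae ?_
    filter_upwards [hω, ae_restrict_mem measurableSet_Ioc] with r hr hrt
    have hmax : max t r = r := max_eq_right hrt.1.le
    calc ∫⁻ y, ‖squareIntegrand s U H (toPredictable t (ω, (r, y)))‖ₑ ∂(κ (ω, r))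
        ≤ ∫⁻ y, (‖U r ω‖ₑ ^ 2 + 2 * ‖H (max t r) ω y‖ₑ ^ 2) ∂(κ (ω, r)) := by
          refine lintegral_mono fun y => ?_
          refine (enorm_indicator_le_enorm_self _ _).trans ?_
          simp only [toPredictable]
          rw [hmax, hr]
          exact enorm_square_increment_le _ _
      _ = κ (ω, r) univ * ‖U r ω‖ₑ ^ 2 + 2 * ∫⁻ y, ‖H (max t r) ω y‖ₑ ^ 2 ∂(κ (ω, r)) := by
          rw [lintegral_add_left measurable_const, lintegral_const, mul_comm,
            lintegral_const_mul' _ _ (by simp)]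
      _ ≤ _ := by gcongr; exact hC.rate_le _
  refine hle.trans_lt ?_
  rw [lintegral_add_right' _ ((measurable_lintegral_sq hS.predictable).aemeasurable.const_mul _),
    lintegral_const_mul' _ _ ENNReal.coe_ne_top, lintegral_const_mul' _ _ (by simp)]
  exact ENNReal.add_lt_top.2 ⟨ENNReal.mul_lt_top ENNReal.coe_lt_top
    ((memLp_two_iff hS.memLp_left.aestronglyMeasurable).1 hS.memLp_left),
    ENNReal.mul_lt_top (by simp) hS.sq_lt_top⟩

/-- The norm of the integrand is predictable, so its mean is the same under the jump measure and
under the compensator. -/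
theorem IsLinearSolution.integrable_squareIntegrand_jump [MeasurableSingletonClass K]
    (hS : IsLinearSolution 𝓕 μ X ν T κ U H ξ D) (hC : HasCompensator 𝓕 μ X ν T Λ κ p)
    {s : ℝ≥0} (hs : t ≤ s) :
    Integrable (fun q => squareIntegrand s U H (toPredictable t q)) (μ ⊗ₘ p) := by
  have hm : Measurable fun q : Ω × (ℝ≥0 × K) => squareIntegrand s U H (toPredictable t q) :=
    @Measurable.comp _ _ _ _ (𝓕.predictable.prod inferInstance) _ _ _
      (hS.measurable_squareIntegrand hs) (measurable_toPredictable 𝓕)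
  refine ⟨hm.aestronglyMeasurable, ?_⟩
  have hF : Measurable[𝓕.predictable.prod inferInstance]
      fun q : (Ici t × Ω) × K => ‖squareIntegrand s U H q‖ₑ :=
    measurable_enorm.comp (hS.measurable_squareIntegrand hs)
  rw [HasFiniteIntegral, lintegral_eq_of_map_eq hC.map_eq hF]
  exact (hS.integrable_squareIntegrand hC hs).2

/-- The mean of the jump part of the square. -/
theorem IsLinearSolution.integral_squareIntegrand [MeasurableSingletonClass K]
    (hS : IsLinearSolution 𝓕 μ X ν T κ U H ξ D) (hC : HasCompensator 𝓕 μ X ν T Λ κ p)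
    {s : ℝ≥0} (hs : s ∈ Icc t T) :
    ∫ q, squareIntegrand s U H (toPredictable t q)
      ∂(μ ⊗ₘ (Kernel.const Ω (leb.restrict (Ioc t T)) ⊗ₖ κ)) =
    2 * ∫ θ, U θ.2 θ.1 * rateIntegral κ t H θ ∂(μ.prod (leb.restrict (Ioc s T))) +
      ∫ θ, sqRateIntegral κ t H θ ∂(μ.prod (leb.restrict (Ioc s T))) := by
  have hI := hS.integrable_squareIntegrand hC hs.1
  have hmono : μ.prod (leb.restrict (Ioc s T)) ≤ μ.prod (leb.restrict (Ioc t T)) :=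
    Measure.prod_mono le_rfl (Measure.restrict_mono (Ioc_subset_Ioc_left hs.1) le_rfl)
  have hUb : Integrable (fun θ : Ω × ℝ≥0 => U θ.2 θ.1 * rateIntegral κ t H θ)
      (μ.prod (leb.restrict (Ioc s T))) :=
    (hS.memLp_left.integrable_mul (hS.memLp_rateIntegral hC.rate_le)).mono_measure hmono
  have hG := hS.integrable_sqRateIntegral.mono_measure hmono
  have hadd : Integrable (fun θ : Ω × ℝ≥0 =>
      2 * (U θ.2 θ.1 * rateIntegral κ t H θ) + sqRateIntegral κ t H θ)
      (μ.prod (leb.restrict (Ioc s T))) := (hUb.const_mul 2).add hG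
  rw [← integral_const_mul, ← integral_add (hUb.const_mul 2) hG, integral_prod _ hadd,
    Measure.integral_compProd hI]
  refine integral_congr_ae ?_
  filter_upwards [((Measure.integrable_compProd_iff hI.aestronglyMeasurable).1 hI).1,
    hS.ae_leftLimit_eq hC, Measure.ae_ae_of_ae_prod hS.ae_memLp] with ω hIω hω hHω
  rw [ProbabilityTheory.integral_compProd hIω, Kernel.const_apply,
    setIntegral_Ioc_eq_indicator hs.1]
  refine integral_congr_ae ?_
  filter_upwards [hω, hHω, ae_restrict_mem measurableSet_Ioc] with r hr hHr hrt
  have hmax : max t r = r := max_eq_right hrt.1.le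
  simp_rw [squareIntegrand_toPredictable hrt.1]
  by_cases hsr : s < r
  · simp only [if_pos hsr, hr]
    rw [hmax] at hHr
    rw [indicator_of_mem (mem_Ioi.2 hsr), integral_add
      ((hHr.integrable (by norm_num)).const_mul _) hHr.integrable_sq, integral_const_mul]
    simp only [rateIntegral, sqRateIntegral, hmax]
    ring
  · simp [hsr]

/-- The energy identity for the backward equation. -/
theorem IsLinearSolution.energy [MeasurableSingletonClass K]
    (hS : IsLinearSolution 𝓕 μ X ν T κ U H ξ D) (hC : HasCompensator 𝓕 μ X ν T Λ κ p)
    {s : ℝ≥0} (hs : s ∈ Icc t T) :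
    Integrable (fun ω => U s ω ^ 2) μ ∧
    ∫ ω, U s ω ^ 2 ∂μ + ∫ θ, sqRateIntegral κ t H θ ∂(μ.prod (leb.restrict (Ioc s T))) =
      ∫ ω, ξ ω ^ 2 ∂μ + 2 * ∫ θ, U θ.2 θ.1 * D θ.2 θ.1 ∂(μ.prod (leb.restrict (Ioc s T))) := by
  have hmono : μ.prod (leb.restrict (Ioc s T)) ≤ μ.prod (leb.restrict (Ioc t T)) :=
    Measure.prod_mono le_rfl (Measure.restrict_mono (Ioc_subset_Ioc_left hs.1) le_rfl)
  have hUb : Integrable (fun θ : Ω × ℝ≥0 => U θ.2 θ.1 * rateIntegral κ t H θ)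
      (μ.prod (leb.restrict (Ioc s T))) :=
    (hS.memLp_left.integrable_mul (hS.memLp_rateIntegral hC.rate_le)).mono_measure hmono
  have hUD : Integrable (fun θ : Ω × ℝ≥0 => U θ.2 θ.1 * D θ.2 θ.1)
      (μ.prod (leb.restrict (Ioc s T))) :=
    (hS.memLp_left.integrable_mul hS.memLp_driver).mono_measure hmono
  have hIp := hS.integrable_squareIntegrand_jump hC hs.1
  have hpath : ∀ᵐ ω ∂μ, U s ω ^ 2 = ξ ω ^ 2 +
      2 * (∫ r in Ioc s T, (U r ω * D r ω + U r ω * rateIntegral κ t H (ω, r)) ∂leb) -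
      ∫ q, squareIntegrand s U H (toPredictable t (ω, q)) ∂(p ω) := by
    filter_upwards [hS.ae_isFiniteVariation hC] with ω hω
    have h1 := hω.2.sq_eq hω.1 (fun r hr => ((mem_jumpFinset _).1 hr).2) hs
    -- At a jump `U₋ = U - H`, whence `2 U₋ H + H² = 2 U H - H²`: the predictable integrand
    -- reproduces the jump terms of the chain rule.
    have h2 : ∫ q, squareIntegrand s U H (toPredictable t (ω, q)) ∂(p ω) =
        ∑ r ∈ jumpFinset (hC.isStepPath ω) t T with s < r,
          (2 * U r ω * H r ω (X r ω) - H r ω (X r ω) ^ 2) := by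
      rw [hC.jump_eq, integral_jumpPointMeasure (hC.isStepPath ω) le_rfl T, Finset.sum_filter]
      refine Finset.sum_congr rfl fun r hr => ?_
      have hrt := ((mem_jumpFinset _).1 hr).2
      rw [squareIntegrand_toPredictable hrt.1, leftLimit_eq hω.2 hω.1 hrt, if_pos hr]
      split_ifs
      · ring
      · rfl
    have h3 : ∫ r in Ioc s T, U r ω * (D r ω + rateIntegral κ t H (ω, r)) ∂leb =
        ∫ r in Ioc s T, (U r ω * D r ω + U r ω * rateIntegral κ t H (ω, r)) ∂leb := by
      simp_rw [mul_add]
    rw [h3] at h1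
    rw [h2]
    linear_combination h1
  have hint1 : Integrable (fun ω => ∫ r in Ioc s T,
      (U r ω * D r ω + U r ω * rateIntegral κ t H (ω, r)) ∂leb) μ :=
    (hUD.add hUb).integral_prod_left
  have hint2 : Integrable (fun ω =>
      ∫ q, squareIntegrand s U H (toPredictable t (ω, q)) ∂(p ω)) μ := by
    have h := Integrable.integral_compProd (κ := Kernel.const Unit μ)
      (η := Kernel.prodMkLeft Unit p) (a := ()) hIp
    simpa using h
  have hξ := hS.memLp_terminal.integrable_sq
  have hadd : Integrable (fun ω => ξ ω ^ 2 + 2 * ∫ r in Ioc s T,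
      (U r ω * D r ω + U r ω * rateIntegral κ t H (ω, r)) ∂leb) μ := hξ.add (hint1.const_mul 2)
  have haddUb : Integrable (fun θ : Ω × ℝ≥0 =>
      U θ.2 θ.1 * D θ.2 θ.1 + U θ.2 θ.1 * rateIntegral κ t H θ)
      (μ.prod (leb.restrict (Ioc s T))) := hUD.add hUb
  have hsum := hadd.sub hint2
  refine ⟨hsum.congr (hpath.mono fun ω h => h.symm), ?_⟩
  have hE : ∫ ω, U s ω ^ 2 ∂μ = ∫ ω, ξ ω ^ 2 ∂μ +
      2 * (∫ θ, U θ.2 θ.1 * D θ.2 θ.1 ∂(μ.prod (leb.restrict (Ioc s T))) +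
        ∫ θ, U θ.2 θ.1 * rateIntegral κ t H θ ∂(μ.prod (leb.restrict (Ioc s T)))) -
      ∫ q, squareIntegrand s U H (toPredictable t q) ∂(μ ⊗ₘ p) := by
    rw [integral_congr_ae hpath, integral_sub hadd hint2,
      integral_add hξ (hint1.const_mul 2), integral_const_mul, Measure.integral_compProd hIp,
      ← integral_add hUD hUb, integral_prod _ haddUb]
  -- The jump measure is exchanged for its compensator; the terms `2 E ∫ U ∫ H dν dr` on both sides
  -- then cancel.
  rw [integral_eq_of_map_eq hC.map_eq (hS.measurable_squareIntegrand hs.1),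
    hS.integral_squareIntegrand hC hs] at hE
  linear_combination hE

end Energy

/-- A backward Gronwall inequality with an explicit constant. -/
theorem setIntegral_le_of_le_add_mul {t T c δ : ℝ≥0} (hδ : 2 * c * δ = 1) {A : ℝ}
    {φ : ℝ≥0 → ℝ} (hint : IntegrableOn φ (Ioc t T) leb) (h0 : ∀ s, 0 ≤ φ s) (hA : 0 ≤ A)
    (h : ∀ s ∈ Icc t T, φ s ≤ A + c * ∫ r in Ioc s T, φ r ∂leb) (k : ℕ) :
    ∀ s ∈ Icc t T, T ≤ s + k * δ →
      ∫ r in Ioc s T, φ r ∂leb + 2 * δ * A ≤ 2 ^ k * (2 * δ * A) := by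
  induction k with
  | zero =>
    intro s hs hT
    have : s = T := le_antisymm hs.2 (by simpa using hT)
    simp [this]
  | succ k ih =>
    intro s hs hT
    -- One step of length `δ = 1/(2c)`: writing `Φ(s)` for the integral over `(s,T]`, `Φ(s) ≤ Φ(s₁)
    -- + δ(A + c Φ(s))` with `δc = 1/2`, so `Φ(s) ≤ 2 Φ(s₁) + 2δA`. Adding `2δA` makes this an exact
    -- doubling.
    set s₁ := min (s + δ) T with hs₁
    have hss : s ≤ s₁ := le_min le_self_add hs.2
    have hsT : s₁ ≤ T := min_le_right _ _
    have h1 := ih s₁ ⟨hs.1.trans hss, hsT⟩ (by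
      rcases le_total (s + δ) T with h | h
      · rw [hs₁, min_eq_left h]
        refine hT.trans_eq ?_
        push_cast
        ring
      · rw [hs₁, min_eq_right h]
        exact le_self_add)
    have hs_int : IntegrableOn φ (Ioc s T) leb := hint.mono_set (Ioc_subset_Ioc_left hs.1)
    have h2 := setIntegral_Ioc_add hss hsT hs_int
    have hmono : ∀ r ∈ Icc s T, ∫ q in Ioc r T, φ q ∂leb ≤ ∫ q in Ioc s T, φ q ∂leb :=
      fun r hr => setIntegral_mono_set hs_int (Eventually.of_forall h0)
        (Ioc_subset_Ioc_left hr.1).eventuallyLE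
    have hΦ0 : 0 ≤ ∫ q in Ioc s T, φ q ∂leb := integral_nonneg h0
    have h3 : ∫ r in Ioc s s₁, φ r ∂leb ≤ δ * (A + c * ∫ r in Ioc s T, φ r ∂leb) := by
      calc ∫ r in Ioc s s₁, φ r ∂leb
          ≤ ∫ r in Ioc s s₁, (A + c * ∫ q in Ioc s T, φ q ∂leb) ∂leb := by
            refine setIntegral_mono_on (hs_int.mono_set (Ioc_subset_Ioc_right hsT))
              (integrable_const _) measurableSet_Ioc fun r hr => ?_
            refine (h r ⟨hs.1.trans hr.1.le, hr.2.trans hsT⟩).trans ?_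
            have := hmono r ⟨hr.1.le, hr.2.trans hsT⟩
            have hc := mul_le_mul_of_nonneg_left this (NNReal.coe_nonneg c)
            linarith
        _ = (s₁ - s : ℝ≥0) * (A + c * ∫ q in Ioc s T, φ q ∂leb) := by
            rw [setIntegral_const, Measure.real, leb_Ioc, smul_eq_mul, ENNReal.coe_toReal]
        _ ≤ _ := by
            refine mul_le_mul_of_nonneg_right ?_ (add_nonneg hA (mul_nonneg c.2 hΦ0))
            rw [NNReal.coe_le_coe, tsub_le_iff_left]
            exact min_le_left _ _
    have hδ' : (2 : ℝ) * c * δ = 1 := by exact_mod_cast hδ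
    have h4 : (δ : ℝ) * (c * ∫ r in Ioc s T, φ r ∂leb) = (∫ r in Ioc s T, φ r ∂leb) / 2 := by
      linear_combination (∫ r in Ioc s T, φ r ∂leb) / 2 * hδ'
    rw [mul_add, h4] at h3
    rw [pow_succ]
    linarith

theorem ofReal_integral_sq {α : Type*} {mα : MeasurableSpace α} {ρ : Measure α} {F : α → ℝ}
    (hF : MemLp F 2 ρ) : ENNReal.ofReal (∫ q, F q ^ 2 ∂ρ) = ∫⁻ q, ‖F q‖ₑ ^ 2 ∂ρ := by
  have h := integral_abs_sq_eq hF.aestronglyMeasurable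
  simp only [sq_abs] at h
  rw [h, ENNReal.ofReal_toReal ((memLp_two_iff hF.aestronglyMeasurable).1 hF).ne]

/-- Young's inequality weighted as `2L|u|√G ≤ 2L²u² + G/2`, so that only half of `G` has to be
absorbed. -/
theorem two_mul_le_of_abs_le {u d F G L L' : ℝ} (hG : 0 ≤ G)
    (h : |d| ≤ |F| + L' * |u| + L * √G) :
    2 * (u * d) ≤ F ^ 2 + (1 + 2 * L' + 2 * L ^ 2) * u ^ 2 + G / 2 := by
  have h1 : u * d ≤ |u| * (|F| + L' * |u| + L * √G) :=
    (le_abs_self _).trans ((abs_mul u d).trans_le (mul_le_mul_of_nonneg_left h (abs_nonneg _)))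
  have h2 := Real.sq_sqrt hG
  rw [← sq_abs F, ← sq_abs u]
  nlinarith [sq_nonneg (|u| - |F|), sq_nonneg (2 * L * |u| - √G)]

/-! ### The a priori estimate for the linear equation. -/

section Energy

variable {K Ω : Type*} [MeasurableSpace K] [MeasurableSpace Ω] {t : ℝ≥0}
  {𝓕 : Filtration (Ici t) ‹MeasurableSpace Ω›} {μ : Measure Ω} [IsProbabilityMeasure μ]
  {X : ℝ≥0 → Ω → K} {ν : Kernel (ℝ≥0 × K) K} {T Λ : ℝ≥0} {κ : Kernel (Ω × ℝ≥0) K}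
  [IsFiniteKernel κ] {p : Kernel Ω (ℝ≥0 × K)} [IsSFiniteKernel p]
  {U : ℝ≥0 → Ω → ℝ} {H : ℝ≥0 → Ω → K → ℝ} {ξ : Ω → ℝ} {D : ℝ≥0 → Ω → ℝ}

theorem sqRateIntegral_nonneg (θ : Ω × ℝ≥0) : 0 ≤ sqRateIntegral κ t H θ :=
  integral_nonneg fun _ => sq_nonneg _

theorem IsLinearSolution.energy_le [MeasurableSingletonClass K]
    (hS : IsLinearSolution 𝓕 μ X ν T κ U H ξ D) (hC : HasCompensator 𝓕 μ X ν T Λ κ p)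
    {F : Ω × ℝ≥0 → ℝ} (hF : MemLp F 2 (μ.prod (leb.restrict (Ioc t T)))) {L L' : ℝ≥0}
    (hD : ∀ᵐ θ ∂(μ.prod (leb.restrict (Ioc t T))),
      |D θ.2 θ.1| ≤ |F θ| + L' * |U θ.2 θ.1| + L * √(sqRateIntegral κ t H θ))
    {s : ℝ≥0} (hs : s ∈ Icc t T) :
    ∫ ω, U s ω ^ 2 ∂μ +
      1 / 2 * ∫ θ, sqRateIntegral κ t H θ ∂(μ.prod (leb.restrict (Ioc s T))) ≤
    (∫ ω, ξ ω ^ 2 ∂μ + ∫ θ, F θ ^ 2 ∂(μ.prod (leb.restrict (Ioc t T)))) +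
      (1 + 2 * L' + 2 * L ^ 2 : ℝ≥0) *
        ∫ θ, U θ.2 θ.1 ^ 2 ∂(μ.prod (leb.restrict (Ioc s T))) := by
  have hmono : μ.prod (leb.restrict (Ioc s T)) ≤ μ.prod (leb.restrict (Ioc t T)) :=
    Measure.prod_mono le_rfl (Measure.restrict_mono (Ioc_subset_Ioc_left hs.1) le_rfl)
  have hUD : Integrable (fun θ : Ω × ℝ≥0 => U θ.2 θ.1 * D θ.2 θ.1)
      (μ.prod (leb.restrict (Ioc s T))) :=
    (hS.memLp_left.integrable_mul hS.memLp_driver).mono_measure hmono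
  have hU2 := hS.memLp_left.integrable_sq.mono_measure hmono
  have hF2 := hF.integrable_sq.mono_measure hmono
  have hG := hS.integrable_sqRateIntegral.mono_measure hmono
  have hFle : ∫ θ, F θ ^ 2 ∂(μ.prod (leb.restrict (Ioc s T))) ≤
      ∫ θ, F θ ^ 2 ∂(μ.prod (leb.restrict (Ioc t T))) :=
    integral_mono_measure hmono (Eventually.of_forall fun _ => sq_nonneg _) hF.integrable_sq
  have hsum : Integrable (fun θ : Ω × ℝ≥0 => F θ ^ 2 +
      (1 + 2 * L' + 2 * L ^ 2 : ℝ) * U θ.2 θ.1 ^ 2) (μ.prod (leb.restrict (Ioc s T))) :=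
    hF2.add (hU2.const_mul _)
  have hmain : 2 * ∫ θ, U θ.2 θ.1 * D θ.2 θ.1 ∂(μ.prod (leb.restrict (Ioc s T))) ≤
      ∫ θ, F θ ^ 2 ∂(μ.prod (leb.restrict (Ioc s T))) + (1 + 2 * L' + 2 * L ^ 2 : ℝ) *
        ∫ θ, U θ.2 θ.1 ^ 2 ∂(μ.prod (leb.restrict (Ioc s T))) +
      (∫ θ, sqRateIntegral κ t H θ ∂(μ.prod (leb.restrict (Ioc s T)))) / 2 := by
    rw [← integral_const_mul, ← integral_const_mul, ← integral_div,
      ← integral_add hF2 (hU2.const_mul _), ← integral_add hsum (hG.div_const 2)]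
    refine integral_mono_ae (hUD.const_mul 2) (hsum.add (hG.div_const 2)) ?_
    filter_upwards [(Measure.absolutelyContinuous_of_le hmono).ae_le hD] with θ hθ
    exact two_mul_le_of_abs_le (sqRateIntegral_nonneg θ) hθ
  have he := (hS.energy hC hs).2
  push_cast
  linarith

/-- The a priori estimate for the linear backward equation. -/
theorem IsLinearSolution.apriori [MeasurableSingletonClass K] (htT : t ≤ T)
    (hS : IsLinearSolution 𝓕 μ X ν T κ U H ξ D) (hC : HasCompensator 𝓕 μ X ν T Λ κ p)
    {F : Ω × ℝ≥0 → ℝ} (hF : MemLp F 2 (μ.prod (leb.restrict (Ioc t T)))) {L L' : ℝ≥0}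
    (hD : ∀ᵐ θ ∂(μ.prod (leb.restrict (Ioc t T))),
      |D θ.2 θ.1| ≤ |F θ| + L' * |U θ.2 θ.1| + L * √(sqRateIntegral κ t H θ))
    {N : ℕ} (hN : 2 * (1 + 2 * L' + 2 * L ^ 2) * T ≤ N) :
    (⨆ s ∈ Icc t T, ∫⁻ ω, ‖U s ω‖ₑ ^ 2 ∂μ) +
      ∫⁻ θ, ‖U θ.2 θ.1‖ₑ ^ 2 ∂(μ.prod (leb.restrict (Ioc t T))) +
      ∫⁻ θ, ∫⁻ y, ‖H (max t θ.2) θ.1 y‖ₑ ^ 2 ∂(κ θ) ∂(μ.prod (leb.restrict (Ioc t T))) ≤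
    ((3 + 4 * 2 ^ N : ℝ≥0) : ℝ≥0∞) * (∫⁻ ω, ‖ξ ω‖ₑ ^ 2 ∂μ +
      ∫⁻ θ, ‖F θ‖ₑ ^ 2 ∂(μ.prod (leb.restrict (Ioc t T)))) := by
  set c : ℝ≥0 := 1 + 2 * L' + 2 * L ^ 2 with hc
  have hc1 : 1 ≤ c := by rw [hc, add_assoc]; exact le_self_add
  have hc0 : c ≠ 0 := (zero_lt_one.trans_le hc1).ne'
  set δ : ℝ≥0 := 1 / (2 * c) with hδdef
  have hδ : 2 * c * δ = 1 := by rw [hδdef]; field_simp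
  set A : ℝ := ∫ ω, ξ ω ^ 2 ∂μ + ∫ θ, F θ ^ 2 ∂(μ.prod (leb.restrict (Ioc t T))) with hAdef
  have hA : 0 ≤ A := add_nonneg (integral_nonneg fun _ => sq_nonneg _)
    (integral_nonneg fun _ => sq_nonneg _)
  set φ : ℝ≥0 → ℝ := fun s => ∫ ω, U s ω ^ 2 ∂μ with hφ
  have hU2 := hS.memLp_left.integrable_sq
  have hφint : IntegrableOn φ (Ioc t T) leb := hU2.integral_prod_right
  have hφ0 : ∀ s, 0 ≤ φ s := fun s => integral_nonneg fun _ => sq_nonneg _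
  have hΦ : ∀ s ∈ Icc t T, ∫ θ, U θ.2 θ.1 ^ 2 ∂(μ.prod (leb.restrict (Ioc s T))) =
      ∫ r in Ioc s T, φ r ∂leb := by
    intro s hs
    exact integral_prod_symm _ (hU2.mono_measure (Measure.prod_mono le_rfl
      (Measure.restrict_mono (Ioc_subset_Ioc_left hs.1) le_rfl)))
  have hG0 : ∀ s, 0 ≤ ∫ θ, sqRateIntegral κ t H θ ∂(μ.prod (leb.restrict (Ioc s T))) :=
    fun s => integral_nonneg fun θ => sqRateIntegral_nonneg θ
  have hen : ∀ s ∈ Icc t T, φ s +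
      1 / 2 * ∫ θ, sqRateIntegral κ t H θ ∂(μ.prod (leb.restrict (Ioc s T))) ≤
        A + c * ∫ r in Ioc s T, φ r ∂leb := by
    intro s hs
    rw [← hΦ s hs]
    exact hS.energy_le hC hF hD hs
  have hTN : ∀ s, T ≤ s + N * δ := fun s => by
    calc T = 2 * c * T * δ := by rw [mul_right_comm, hδ, one_mul]
      _ ≤ N * δ := by gcongr
      _ ≤ _ := le_add_self
  -- `N ≥ 2cT` steps of length `δ = 1/(2c)` cover `[s,T]`; multiplication by `c` turns `2δA` into
  -- `A`.
  have hbound : ∀ s ∈ Icc t T, c * ∫ r in Ioc s T, φ r ∂leb ≤ 2 ^ N * A := by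
    intro s hs
    have h1 := setIntegral_le_of_le_add_mul hδ hφint hφ0 hA
      (fun s hs => by have := hen s hs; have := hG0 s; linarith) N s hs (hTN s)
    have hδ' : (2 : ℝ) * c * δ = 1 := by exact_mod_cast hδ
    have h2 : (c : ℝ) * (∫ r in Ioc s T, φ r ∂leb + 2 * δ * A) ≤ c * (2 ^ N * (2 * δ * A)) :=
      mul_le_mul_of_nonneg_left h1 c.2
    have h3 : (c : ℝ) * (2 ^ N * (2 * δ * A)) = 2 ^ N * A := by
      linear_combination 2 ^ N * A * hδ'
    have h4 : (0 : ℝ) ≤ c * (2 * δ * A) := by positivity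
    linarith
  have htt : t ∈ Icc t T := ⟨le_rfl, htT⟩
  have hsup : ∀ s ∈ Icc t T, φ s ≤ (1 + 2 ^ N) * A := fun s hs => by
    have := hen s hs; have := hG0 s; have := hbound s hs; linarith
  have hΦt : ∫ θ, U θ.2 θ.1 ^ 2 ∂(μ.prod (leb.restrict (Ioc t T))) ≤ 2 ^ N * A := by
    rw [hΦ t htt]
    refine le_trans ?_ (hbound t htt)
    exact le_mul_of_one_le_left (integral_nonneg hφ0) (by exact_mod_cast hc1)
  have hGt : ∫ θ, sqRateIntegral κ t H θ ∂(μ.prod (leb.restrict (Ioc t T))) ≤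
      2 * ((1 + 2 ^ N) * A) := by
    have := hen t htt; have := hφ0 t; have := hbound t htt; linarith
  have hA' : ENNReal.ofReal A = ∫⁻ ω, ‖ξ ω‖ₑ ^ 2 ∂μ +
      ∫⁻ θ, ‖F θ‖ₑ ^ 2 ∂(μ.prod (leb.restrict (Ioc t T))) := by
    rw [hAdef, ENNReal.ofReal_add (integral_nonneg fun _ => sq_nonneg _)
      (integral_nonneg fun _ => sq_nonneg _), ofReal_integral_sq hS.memLp_terminal,
      ofReal_integral_sq hF]
  have e1 : (⨆ s ∈ Icc t T, ∫⁻ ω, ‖U s ω‖ₑ ^ 2 ∂μ) ≤ ENNReal.ofReal ((1 + 2 ^ N) * A) := by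
    refine iSup₂_le fun s hs => ?_
    have hm : MemLp (U s) 2 μ := by
      refine (memLp_two_iff_integrable_sq ?_).2 (hS.energy hC hs).1
      exact ((hS.adapted s hs.1).mono (𝓕.le _) le_rfl).aestronglyMeasurable
    rw [← ofReal_integral_sq hm]
    exact ENNReal.ofReal_le_ofReal (hsup s hs)
  have e2 : ∫⁻ θ, ‖U θ.2 θ.1‖ₑ ^ 2 ∂(μ.prod (leb.restrict (Ioc t T))) ≤
      ENNReal.ofReal (2 ^ N * A) := by
    rw [← ofReal_integral_sq hS.memLp_left]
    exact ENNReal.ofReal_le_ofReal hΦt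
  have e3 : ∫⁻ θ, ∫⁻ y, ‖H (max t θ.2) θ.1 y‖ₑ ^ 2 ∂(κ θ) ∂(μ.prod (leb.restrict (Ioc t T))) ≤
      ENNReal.ofReal (2 * ((1 + 2 ^ N) * A)) := by
    have h1 : ∫ θ, sqRateIntegral κ t H θ ∂(μ.prod (leb.restrict (Ioc t T))) =
        (∫⁻ θ, ∫⁻ y, ‖H (max t θ.2) θ.1 y‖ₑ ^ 2 ∂(κ θ)
          ∂(μ.prod (leb.restrict (Ioc t T)))).toReal := by
      simp_rw [sqRateIntegral_eq hS.predictable]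
      exact integral_toReal (measurable_lintegral_sq hS.predictable).aemeasurable
        (ae_lt_top (measurable_lintegral_sq hS.predictable) hS.sq_lt_top.ne)
    rw [← ENNReal.ofReal_toReal hS.sq_lt_top.ne, ← h1]
    exact ENNReal.ofReal_le_ofReal hGt
  -- The constant is the sum of `1 + 2^N` for the supremum, `2^N` for the time integral (as `c ≥
  -- 1`), and `2(1 + 2^N)` for the `H` term.
  refine (add_le_add (add_le_add e1 e2) e3).trans_eq ?_
  rw [← ENNReal.ofReal_add (by positivity) (by positivity),
    ← ENNReal.ofReal_add (by positivity) (by positivity), ← hA',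
    ← ENNReal.ofReal_coe_nnreal, ← ENNReal.ofReal_mul (NNReal.coe_nonneg _)]
  congr 1
  push_cast
  ring

end Energy

/-! ### Differences of linear solutions. -/

section Difference

variable {K Ω : Type*} [MeasurableSpace K] [MeasurableSpace Ω] {t : ℝ≥0}
  {𝓕 : Filtration (Ici t) ‹MeasurableSpace Ω›} {μ : Measure Ω} [IsProbabilityMeasure μ]
  {X : ℝ≥0 → Ω → K} {ν : Kernel (ℝ≥0 × K) K} {T Λ : ℝ≥0} {κ : Kernel (Ω × ℝ≥0) K}
  [IsFiniteKernel κ] {p : Kernel Ω (ℝ≥0 × K)}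
  {U₁ U₂ : ℝ≥0 → Ω → ℝ} {H₁ H₂ : ℝ≥0 → Ω → K → ℝ} {ξ₁ ξ₂ : Ω → ℝ} {D₁ D₂ : ℝ≥0 → Ω → ℝ}

theorem lintegral_sub_sq_lt_top {m : Measure (Ω × ℝ≥0)} [SFinite m]
    (h₁ : Measurable[𝓕.predictable.prod inferInstance]
      fun q : (Ici t × Ω) × K => H₁ q.1.1 q.1.2 q.2)
    (h₂ : Measurable[𝓕.predictable.prod inferInstance]
      fun q : (Ici t × Ω) × K => H₂ q.1.1 q.1.2 q.2)
    (h₁' : ∫⁻ θ, ∫⁻ y, ‖H₁ (max t θ.2) θ.1 y‖ₑ ^ 2 ∂(κ θ) ∂m < ∞)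
    (h₂' : ∫⁻ θ, ∫⁻ y, ‖H₂ (max t θ.2) θ.1 y‖ₑ ^ 2 ∂(κ θ) ∂m < ∞) :
    ∫⁻ θ, ∫⁻ y, ‖H₁ (max t θ.2) θ.1 y - H₂ (max t θ.2) θ.1 y‖ₑ ^ 2 ∂(κ θ) ∂m < ∞ := by
  have m₁ := measurable_of_predictable h₁
  have m₂ := measurable_of_predictable h₂
  rw [← Measure.lintegral_compProd (m₁.enorm.pow_const 2)] at h₁'
  rw [← Measure.lintegral_compProd (m₂.enorm.pow_const 2)] at h₂'
  have m₁₂ : Measurable fun q : (Ω × ℝ≥0) × K =>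
      H₁ (max t q.1.2) q.1.1 q.2 - H₂ (max t q.1.2) q.1.1 q.2 := m₁.sub m₂
  rw [← Measure.lintegral_compProd (m₁₂.enorm.pow_const 2)]
  exact (memLp_two_iff m₁₂.aestronglyMeasurable).1
    (((memLp_two_iff m₁.aestronglyMeasurable).2 h₁').sub
      ((memLp_two_iff m₂.aestronglyMeasurable).2 h₂'))

/-- The jump part is a finite sum, hence linear without conditions; the compensator part is linear
only where the integrals converge, which is almost surely. -/
theorem ae_compensatedIntegral_sub [MeasurableSingletonClass K]
    (hC : HasCompensator 𝓕 μ X ν T Λ κ p)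
    (h₁ : IsLinearSolution 𝓕 μ X ν T κ U₁ H₁ ξ₁ D₁)
    (h₂ : IsLinearSolution 𝓕 μ X ν T κ U₂ H₂ ξ₂ D₂) :
    ∀ᵐ ω ∂μ, ∀ s ∈ Icc t T,
      compensatedIntegral X ν t (fun r ω y => H₁ r ω y - H₂ r ω y) s T ω =
        compensatedIntegral X ν t H₁ s T ω - compensatedIntegral X ν t H₂ s T ω := by
  have b₁ := (((h₁.memLp_rateIntegral hC.rate_le).integrable (by norm_num)).prod_right_ae)
  have b₂ := (((h₂.memLp_rateIntegral hC.rate_le).integrable (by norm_num)).prod_right_ae)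
  filter_upwards [b₁, b₂, Measure.ae_ae_of_ae_prod h₁.ae_memLp,
    Measure.ae_ae_of_ae_prod h₂.ae_memLp] with ω hb₁ hb₂ hm₁ hm₂ s hs
  have hsub : Ioc s T ⊆ Ioc t T := Ioc_subset_Ioc_left hs.1
  have hrate : ∀ H : ℝ≥0 → Ω → K → ℝ, ∀ r ∈ Ioc t T,
      ∫ y, H r ω y ∂(ν (r, X r ω)) = rateIntegral κ t H (ω, r) := by
    intro H r hr
    simp only [rateIntegral]
    rw [hC.rate_eq ω r ⟨hr.1.le, hr.2⟩, max_eq_right hr.1.le]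
  have hdr : ∫ r in Ioc s T, (∫ y, (H₁ r ω y - H₂ r ω y) ∂(ν (r, X r ω))) ∂leb =
      ∫ r in Ioc s T, rateIntegral κ t H₁ (ω, r) ∂leb -
        ∫ r in Ioc s T, rateIntegral κ t H₂ (ω, r) ∂leb := by
    rw [← integral_sub (IntegrableOn.mono_set hb₁ hsub) (IntegrableOn.mono_set hb₂ hsub)]
    refine integral_congr_ae ?_
    filter_upwards [ae_restrict_mem measurableSet_Ioc, ae_restrict_of_ae_restrict_of_subset hsub hm₁,
      ae_restrict_of_ae_restrict_of_subset hsub hm₂] with r hr hr₁ hr₂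
    rw [hrate (fun r ω y => H₁ r ω y - H₂ r ω y) r (hsub hr)]
    exact integral_sub (hr₁.integrable (by norm_num)) (hr₂.integrable (by norm_num))
  have hν : ∀ H : ℝ≥0 → Ω → K → ℝ, ∫ r in Ioc s T, (∫ y, H r ω y ∂(ν (r, X r ω))) ∂leb =
      ∫ r in Ioc s T, rateIntegral κ t H (ω, r) ∂leb := fun H =>
    setIntegral_congr_fun measurableSet_Ioc fun r hr => hrate H r (hsub hr)
  have hp : ∀ H : ℝ≥0 → Ω → K → ℝ,
      ∫ q in Ioc s T ×ˢ univ, H q.1 ω q.2 ∂(jumpPointMeasure X t ω) =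
        ∑ r ∈ jumpFinset (hC.isStepPath ω) s T, H r ω (X r ω) := fun H =>
    integral_jumpPointMeasure (hC.isStepPath ω) hs.1 T fun q => H q.1 ω q.2
  simp only [compensatedIntegral]
  rw [hp H₁, hp H₂, hp fun r ω y => H₁ r ω y - H₂ r ω y, hdr, hν H₁, hν H₂,
    Finset.sum_sub_distrib]
  ring

theorem IsLinearSolution.sub [MeasurableSingletonClass K]
    (hC : HasCompensator 𝓕 μ X ν T Λ κ p)
    (h₁ : IsLinearSolution 𝓕 μ X ν T κ U₁ H₁ ξ₁ D₁)
    (h₂ : IsLinearSolution 𝓕 μ X ν T κ U₂ H₂ ξ₂ D₂) :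
    IsLinearSolution 𝓕 μ X ν T κ (fun s ω => U₁ s ω - U₂ s ω)
      (fun s ω y => H₁ s ω y - H₂ s ω y) (fun ω => ξ₁ ω - ξ₂ ω)
      (fun s ω => D₁ s ω - D₂ s ω) where
  adapted s hs := (h₁.adapted s hs).sub (h₂.adapted s hs)
  predictable := h₁.predictable.sub h₂.predictable
  memLp_terminal := h₁.memLp_terminal.sub h₂.memLp_terminal
  memLp_driver := h₁.memLp_driver.sub h₂.memLp_driver
  memLp_left := h₁.memLp_left.sub h₂.memLp_left
  sq_lt_top := lintegral_sub_sq_lt_top h₁.predictable h₂.predictable h₁.sq_lt_top h₂.sq_lt_top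
  equation := by
    have i₁ := (h₁.memLp_driver.integrable (by norm_num)).prod_right_ae
    have i₂ := (h₂.memLp_driver.integrable (by norm_num)).prod_right_ae
    filter_upwards [h₁.equation, h₂.equation, ae_compensatedIntegral_sub hC h₁ h₂, i₁, i₂]
      with ω e₁ e₂ e₃ j₁ j₂ s hs
    have hsub : Ioc s T ⊆ Ioc t T := Ioc_subset_Ioc_left hs.1
    rw [e₃ s hs, integral_sub (IntegrableOn.mono_set j₁ hsub) (IntegrableOn.mono_set j₂ hsub)]
    linear_combination e₁ s hs - e₂ s hs

end Difference

/-! ### From nonlinear generators to given drivers. -/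

section Generator

variable {K Ω : Type*} [MeasurableSpace K] [MeasurableSpace Ω] {t : ℝ≥0}

/-- The standing assumptions on the generator. -/
structure IsGenerator (μ : Measure Ω) (X : ℝ≥0 → Ω → K) (ν : Kernel (ℝ≥0 × K) K) (t T : ℝ≥0)
    (L L' : ℝ≥0) (f : ℝ≥0 → K → ℝ → (K → ℝ) → ℝ) : Prop where
  measurable : ∀ z : K → ℝ, Measurable z → (∃ B : ℝ, ∀ y, |z y| ≤ B) →
    Measurable fun q : Icc (0 : ℝ≥0) T × K × ℝ => f q.1 q.2.1 q.2.2 z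
  lipschitz : ∀ s ≤ T, ∀ (x : K) (r r' : ℝ) (z z' : K → ℝ),
    MemLp z 2 (ν (s, x)) → MemLp z' 2 (ν (s, x)) →
    |f s x r z - f s x r' z'| ≤ L' * |r - r'| + L * √(∫ y, |z y - z' y| ^ 2 ∂(ν (s, x)))
  sq_lt_top : ∫⁻ ω, (∫⁻ s in Icc t T, ‖f s (X s ω) 0 0‖ₑ ^ 2 ∂leb) ∂μ < ∞

variable {𝓕 : Filtration (Ici t) ‹MeasurableSpace Ω›} {μ : Measure Ω} [IsProbabilityMeasure μ]
  {X : ℝ≥0 → Ω → K} {ν : Kernel (ℝ≥0 × K) K} {T Λ L L' : ℝ≥0} {κ : Kernel (Ω × ℝ≥0) K}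
  [IsFiniteKernel κ] {p : Kernel Ω (ℝ≥0 × K)}
  {f : ℝ≥0 → K → ℝ → (K → ℝ) → ℝ} {Y : ℝ≥0 → Ω → ℝ} {Z : ℝ≥0 → Ω → K → ℝ}

theorem lintegral_lintegral_Icc {F : Ω × ℝ≥0 → ℝ≥0∞}
    (hF : AEMeasurable F (μ.prod (leb.restrict (Ioc t T)))) :
    ∫⁻ ω, ∫⁻ s in Icc t T, F (ω, s) ∂leb ∂μ = ∫⁻ θ, F θ ∂(μ.prod (leb.restrict (Ioc t T))) := by
  rw [leb_restrict_Icc, lintegral_prod _ hF]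

/-- Progressive measurability at the single time `T` gives joint measurability on `[t,T]`; clamping
the time changes nothing there. -/
theorem aemeasurable_of_progressive (htT : t ≤ T)
    (hY : IsStronglyProgressive 𝓕 fun s : Ici t => Y s) :
    AEMeasurable (fun θ : Ω × ℝ≥0 => Y θ.2 θ.1) (μ.prod (leb.restrict (Ioc t T))) := by
  have h1 := (hY ⟨T, htT⟩).measurable
  have hle : ∀ s : ℝ≥0, max t (min T s) ≤ T := fun s => max_le htT (min_le_left _ _)
  have hι : Measurable fun s : ℝ≥0 => (⟨⟨max t (min T s), mem_Ici.2 (le_max_left _ _)⟩, hle s⟩ :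
      Iic (⟨T, htT⟩ : Ici t)) :=
    Measurable.subtype_mk (Measurable.subtype_mk (by fun_prop))
  have h2 : @Measurable _ _ _ (Subtype.instMeasurableSpace.prod (𝓕 ⟨T, htT⟩))
      fun θ : Ω × ℝ≥0 => ((⟨⟨max t (min T θ.2), mem_Ici.2 (le_max_left _ _)⟩, hle θ.2⟩ :
        Iic (⟨T, htT⟩ : Ici t)), θ.1) := by
    refine ((hι.comp measurable_snd).prodMk measurable_fst).mono le_rfl ?_
    exact sup_le_sup le_rfl (MeasurableSpace.comap_mono (𝓕.le _))
  have h3 := @Measurable.comp _ _ _ _ (Subtype.instMeasurableSpace.prod (𝓕 ⟨T, htT⟩)) _ _ _ h1 h2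
  refine h3.aemeasurable.congr ?_
  filter_upwards [ae_prod_snd_mem μ leb measurableSet_Ioc] with θ hθ
  simp [min_eq_right hθ.2, max_eq_right hθ.1.le]

theorem memLp_of_progressive (htT : t ≤ T)
    (hY : IsStronglyProgressive 𝓕 fun s : Ici t => Y s)
    (hY2 : ∫⁻ ω, ∫⁻ s in Icc t T, ‖Y s ω‖ₑ ^ 2 ∂leb ∂μ < ∞) :
    MemLp (fun θ : Ω × ℝ≥0 => Y θ.2 θ.1) 2 (μ.prod (leb.restrict (Ioc t T))) := by
  have hm := aemeasurable_of_progressive (μ := μ) htT hY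
  rw [memLp_two_iff hm.aestronglyMeasurable]
  rwa [← lintegral_lintegral_Icc (hm.enorm.pow_const 2)]

theorem HasCompensator.lintegral_Icc_rate (hC : HasCompensator 𝓕 μ X ν T Λ κ p)
    (hZ : Measurable[𝓕.predictable.prod inferInstance]
      fun q : (Ici t × Ω) × K => Z q.1.1 q.1.2 q.2) :
    ∫⁻ ω, ∫⁻ s in Icc t T, ∫⁻ y, ‖Z s ω y‖ₑ ^ 2 ∂(ν (s, X s ω)) ∂leb ∂μ =
      ∫⁻ θ, ∫⁻ y, ‖Z (max t θ.2) θ.1 y‖ₑ ^ 2 ∂(κ θ) ∂(μ.prod (leb.restrict (Ioc t T))) := by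
  rw [← lintegral_lintegral_Icc (measurable_lintegral_sq hZ).aemeasurable]
  refine lintegral_congr fun ω => setLIntegral_congr_fun measurableSet_Icc fun s hs => ?_
  simp only [hC.rate_eq ω s hs, max_eq_right hs.1]

theorem IsGenerator.aemeasurable_apply (hf : IsGenerator μ X ν t T L L' f)
    (hC : HasCompensator 𝓕 μ X ν T Λ κ p)
    (hY : AEMeasurable (fun θ : Ω × ℝ≥0 => Y θ.2 θ.1) (μ.prod (leb.restrict (Ioc t T))))
    {z : K → ℝ} (hz : Measurable z) (hzb : ∃ B : ℝ, ∀ y, |z y| ≤ B) :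
    AEMeasurable (fun θ : Ω × ℝ≥0 => f θ.2 (X θ.2 θ.1) (Y θ.2 θ.1) z)
      (μ.prod (leb.restrict (Ioc t T))) := by
  have hX : Measurable fun θ : Ω × ℝ≥0 => X (max t (min T θ.2)) θ.1 :=
    (measurable_path hC.isStepPath hC.measurable_apply).comp
      (by fun_prop : Measurable fun θ : Ω × ℝ≥0 => (θ.1, min T θ.2))
  have hs : Measurable fun θ : Ω × ℝ≥0 =>
      (⟨min T θ.2, zero_le, min_le_left _ _⟩ : Icc (0 : ℝ≥0) T) :=
    Measurable.subtype_mk (by fun_prop)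
  have h1 : AEMeasurable (fun θ : Ω × ℝ≥0 =>
      ((⟨min T θ.2, zero_le, min_le_left _ _⟩ : Icc (0 : ℝ≥0) T),
        X (max t (min T θ.2)) θ.1, Y θ.2 θ.1)) (μ.prod (leb.restrict (Ioc t T))) :=
    hs.aemeasurable.prodMk (hX.aemeasurable.prodMk hY)
  refine ((hf.measurable z hz hzb).comp_aemeasurable h1).congr ?_
  filter_upwards [ae_prod_snd_mem μ leb measurableSet_Ioc] with θ hθ
  simp [min_eq_right hθ.2, max_eq_right hθ.1.le]

theorem IsGenerator.aemeasurable (hf : IsGenerator μ X ν t T L L' f)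
    (hC : HasCompensator 𝓕 μ X ν T Λ κ p)
    (hY : AEMeasurable (fun θ : Ω × ℝ≥0 => Y θ.2 θ.1) (μ.prod (leb.restrict (Ioc t T))))
    (hZ : Measurable[𝓕.predictable.prod inferInstance]
      fun q : (Ici t × Ω) × K => Z q.1.1 q.1.2 q.2)
    (hZ2 : ∫⁻ θ, ∫⁻ y, ‖Z (max t θ.2) θ.1 y‖ₑ ^ 2 ∂(κ θ) ∂(μ.prod (leb.restrict (Ioc t T))) < ∞) :
    AEMeasurable (fun θ : Ω × ℝ≥0 => f θ.2 (X θ.2 θ.1) (Y θ.2 θ.1) (Z θ.2 θ.1))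
      (μ.prod (leb.restrict (Ioc t T))) := by
  have h := aemeasurable_generator (μ.prod (leb.restrict (Ioc t T))) κ
    (Z := fun q => Z (max t q.1.2) q.1.1 q.2) (measurable_of_predictable hZ) hZ2
    (Φ := fun θ z => f θ.2 (X θ.2 θ.1) (Y θ.2 θ.1) z) (L := L)
    (fun z hz hzb => hf.aemeasurable_apply hC hY hz hzb) (by
      filter_upwards [ae_prod_snd_mem μ leb measurableSet_Ioc] with θ hθ z z' hz hz'
      have hκ := hC.rate_eq θ.1 θ.2 ⟨hθ.1.le, hθ.2⟩
      rw [Prod.mk.eta] at hκ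
      rw [hκ] at hz hz' ⊢
      simpa using hf.lipschitz θ.2 hθ.2 (X θ.2 θ.1) (Y θ.2 θ.1) (Y θ.2 θ.1) z z' hz hz')
  refine h.congr ?_
  filter_upwards [ae_prod_snd_mem μ leb measurableSet_Ioc] with θ hθ
  simp [max_eq_right hθ.1.le]

theorem IsGenerator.abs_sub_le (hf : IsGenerator μ X ν t T L L' f)
    (hC : HasCompensator 𝓕 μ X ν T Λ κ p) {Y' : ℝ≥0 → Ω → ℝ} {Z' : ℝ≥0 → Ω → K → ℝ}
    {θ : Ω × ℝ≥0} (hθ : θ.2 ∈ Ioc t T) (hz : MemLp (fun y => Z (max t θ.2) θ.1 y) 2 (κ θ))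
    (hz' : MemLp (fun y => Z' (max t θ.2) θ.1 y) 2 (κ θ)) :
    |f θ.2 (X θ.2 θ.1) (Y θ.2 θ.1) (Z θ.2 θ.1) - f θ.2 (X θ.2 θ.1) (Y' θ.2 θ.1) (Z' θ.2 θ.1)| ≤
      L' * |Y θ.2 θ.1 - Y' θ.2 θ.1| +
        L * √(sqRateIntegral κ t (fun s ω y => Z s ω y - Z' s ω y) θ) := by
  have hκ := hC.rate_eq θ.1 θ.2 ⟨hθ.1.le, hθ.2⟩
  rw [Prod.mk.eta] at hκ
  have hmax : max t θ.2 = θ.2 := max_eq_right hθ.1.le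
  rw [hκ, hmax] at hz hz'
  have h := hf.lipschitz θ.2 hθ.2 (X θ.2 θ.1) (Y θ.2 θ.1) (Y' θ.2 θ.1) _ _ hz hz'
  simp only [sq_abs] at h
  simpa only [sqRateIntegral, hκ, hmax] using h

/-- Comparison with `f(s,X_s,0,0)` through the Lipschitz condition. This makes the generator along a
solution an admissible driver of a linear equation. -/
theorem IsGenerator.memLp (hf : IsGenerator μ X ν t T L L' f)
    (hC : HasCompensator 𝓕 μ X ν T Λ κ p)
    (hY : MemLp (fun θ : Ω × ℝ≥0 => Y θ.2 θ.1) 2 (μ.prod (leb.restrict (Ioc t T))))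
    (hZ : Measurable[𝓕.predictable.prod inferInstance]
      fun q : (Ici t × Ω) × K => Z q.1.1 q.1.2 q.2)
    (hZ2 : ∫⁻ θ, ∫⁻ y, ‖Z (max t θ.2) θ.1 y‖ₑ ^ 2 ∂(κ θ) ∂(μ.prod (leb.restrict (Ioc t T))) < ∞) :
    MemLp (fun θ : Ω × ℝ≥0 => f θ.2 (X θ.2 θ.1) (Y θ.2 θ.1) (Z θ.2 θ.1)) 2
      (μ.prod (leb.restrict (Ioc t T))) := by
  have hf0m : AEMeasurable (fun θ : Ω × ℝ≥0 => f θ.2 (X θ.2 θ.1) 0 0)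
      (μ.prod (leb.restrict (Ioc t T))) :=
    hf.aemeasurable_apply (Y := fun _ _ => 0) hC aemeasurable_const measurable_const
      ⟨0, by simp⟩
  have hf0 : MemLp (fun θ : Ω × ℝ≥0 => f θ.2 (X θ.2 θ.1) 0 0) 2
      (μ.prod (leb.restrict (Ioc t T))) := by
    rw [memLp_two_iff hf0m.aestronglyMeasurable,
      ← lintegral_lintegral_Icc (hf0m.enorm.pow_const 2)]
    exact hf.sq_lt_top
  have hGi := integrable_sqRateIntegral hZ hZ2
  have hG : MemLp (fun θ => √(sqRateIntegral κ t Z θ)) 2 (μ.prod (leb.restrict (Ioc t T))) := by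
    rw [memLp_two_iff_integrable_sq
      (Real.continuous_sqrt.comp_aestronglyMeasurable hGi.aestronglyMeasurable)]
    refine hGi.congr (Eventually.of_forall fun θ => ?_)
    exact (Real.sq_sqrt (sqRateIntegral_nonneg θ)).symm
  refine ((hf0.norm.add (hY.norm.const_mul (L' : ℝ))).add (hG.const_mul (L : ℝ))).mono
    (hf.aemeasurable hC hY.aestronglyMeasurable.aemeasurable hZ hZ2).aestronglyMeasurable ?_
  filter_upwards [ae_prod_snd_mem μ leb measurableSet_Ioc, ae_memLp_of_predictable hZ hZ2]
    with θ hθ hz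
  have h := hf.abs_sub_le hC (Y := Y) (Z := Z) (Y' := fun _ _ => 0) (Z' := fun _ _ _ => 0) hθ hz
    MemLp.zero
  simp only [sub_zero] at h
  rw [Real.norm_eq_abs]
  refine le_trans ?_ (le_abs_self _)
  simp only [Pi.add_apply, Real.norm_eq_abs]
  have h2 := abs_sub_abs_le_abs_sub (f θ.2 (X θ.2 θ.1) (Y θ.2 θ.1) (Z θ.2 θ.1))
    (f θ.2 (X θ.2 θ.1) 0 0)
  have h3 : (0 : K → ℝ) = fun _ => 0 := rfl
  rw [← h3] at h
  linarith

/-- The a priori estimate for the difference of two solutions. -/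
theorem apriori_sub [IsSFiniteKernel p] [MeasurableSingletonClass K] (htT : t ≤ T)
    (hC : HasCompensator 𝓕 μ X ν T Λ κ p) {f₁ f₂ : ℝ≥0 → K → ℝ → (K → ℝ) → ℝ}
    {Y₁ Y₂ : ℝ≥0 → Ω → ℝ} {Z₁ Z₂ : ℝ≥0 → Ω → K → ℝ} {ξ₁ ξ₂ : Ω → ℝ}
    (hf₁ : IsGenerator μ X ν t T L L' f₁)
    (h₁ : IsLinearSolution 𝓕 μ X ν T κ Y₁ Z₁ ξ₁ fun s ω => f₁ s (X s ω) (Y₁ s ω) (Z₁ s ω))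
    (h₂ : IsLinearSolution 𝓕 μ X ν T κ Y₂ Z₂ ξ₂ fun s ω => f₂ s (X s ω) (Y₂ s ω) (Z₂ s ω))
    {N : ℕ} (hN : 2 * (1 + 2 * L' + 2 * L ^ 2) * T ≤ N) :
    (⨆ s ∈ Icc t T, ∫⁻ ω, ‖Y₁ s ω - Y₂ s ω‖ₑ ^ 2 ∂μ) +
        (∫⁻ ω, (∫⁻ s in Icc t T, ‖Y₁ s ω - Y₂ s ω‖ₑ ^ 2 ∂leb) ∂μ) +
        (∫⁻ ω, (∫⁻ s in Icc t T,
          (∫⁻ y, ‖Z₁ s ω y - Z₂ s ω y‖ₑ ^ 2 ∂(ν (s, X s ω))) ∂leb) ∂μ) ≤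
      ((3 + 4 * 2 ^ N : ℝ≥0) : ℝ≥0∞) * ((∫⁻ ω, ‖ξ₁ ω - ξ₂ ω‖ₑ ^ 2 ∂μ) +
        ∫⁻ ω, (∫⁻ s in Icc t T,
          ‖f₁ s (X s ω) (Y₂ s ω) (Z₂ s ω) - f₂ s (X s ω) (Y₂ s ω) (Z₂ s ω)‖ₑ ^ 2 ∂leb) ∂μ) := by
  have hS := IsLinearSolution.sub hC h₁ h₂
  have hF : MemLp (fun θ : Ω × ℝ≥0 => f₁ θ.2 (X θ.2 θ.1) (Y₂ θ.2 θ.1) (Z₂ θ.2 θ.1) -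
      f₂ θ.2 (X θ.2 θ.1) (Y₂ θ.2 θ.1) (Z₂ θ.2 θ.1)) 2 (μ.prod (leb.restrict (Ioc t T))) :=
    (hf₁.memLp hC h₂.memLp_left h₂.predictable h₂.sq_lt_top).sub h₂.memLp_driver
  -- The difference of the drivers is split at `f₁(s,X_s,Y₂,Z₂)`: one part is Lipschitz in the
  -- difference of the solutions, the other is the given term `F`. Only the Lipschitz constants of
  -- `f₁` matter.
  have hmain := hS.apriori htT hC hF (L := L) (L' := L') (by
    filter_upwards [ae_prod_snd_mem μ leb measurableSet_Ioc, h₁.ae_memLp, h₂.ae_memLp]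
      with θ hθ hz₁ hz₂
    have h3 := hf₁.abs_sub_le hC (Y := Y₁) (Y' := Y₂) hθ hz₁ hz₂
    have h4 := abs_sub_le (f₁ θ.2 (X θ.2 θ.1) (Y₁ θ.2 θ.1) (Z₁ θ.2 θ.1))
      (f₁ θ.2 (X θ.2 θ.1) (Y₂ θ.2 θ.1) (Z₂ θ.2 θ.1))
      (f₂ θ.2 (X θ.2 θ.1) (Y₂ θ.2 θ.1) (Z₂ θ.2 θ.1))
    linarith) hN
  have e := hC.lintegral_Icc_rate (Z := fun s ω y => Z₁ s ω y - Z₂ s ω y) hS.predictable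
  beta_reduce at e
  rw [← e,
    ← lintegral_lintegral_Icc (hS.memLp_left.aestronglyMeasurable.enorm.pow_const 2),
    ← lintegral_lintegral_Icc (hF.aestronglyMeasurable.enorm.pow_const 2)] at hmain
  exact hmain

end Generator

/-! ### The estimate for the jump Markov process. -/

section Main

variable {K Ω : Type*} [MeasurableSpace K] {X : ℝ≥0 → Ω → K}
  {P : (t : ℝ≥0) → K → @Measure Ω (sigmaAlg X (Ici t))} {ν : Kernel (ℝ≥0 × K) K}
  {t T L L' : ℝ≥0}

theorem IsData.isGenerator {μ : @Measure Ω (sigmaAlg X (Ici t))}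
    {f : ℝ≥0 → K → ℝ → (K → ℝ) → ℝ} {g : K → ℝ} (hd : IsData X ν t T μ L L' f g) :
    @IsGenerator _ _ _ (sigmaAlg X (Ici t)) μ X ν t T L L' f :=
  let _ : MeasurableSpace Ω := sigmaAlg X (Ici t)
  { measurable := hd.measurable_generator
    lipschitz := hd.lipschitz
    sq_lt_top := hd.generator_sq_integrable }

/-- The generator evaluated along the solution is frozen and regarded as a given driver. -/
theorem IsSolution.isLinearSolution {μ : @Measure Ω (sigmaAlg X (Ici t))}
    (hμ : IsProbabilityMeasure μ) {Λ : ℝ≥0}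
    {κ : @Kernel (Ω × ℝ≥0) K (@Prod.instMeasurableSpace _ _ (sigmaAlg X (Ici t)) _) _}
    (hκ : @IsFiniteKernel _ _ (@Prod.instMeasurableSpace _ _ (sigmaAlg X (Ici t)) _) _ κ)
    {p : @Kernel Ω (ℝ≥0 × K) (sigmaAlg X (Ici t)) _}
    (hC : @HasCompensator _ _ _ (sigmaAlg X (Ici t)) t (natFiltration X t) μ X ν T Λ κ p)
    (htT : t ≤ T) {f : ℝ≥0 → K → ℝ → (K → ℝ) → ℝ} {g : K → ℝ} {Y : ℝ≥0 → Ω → ℝ}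
    {Z : ℝ≥0 → Ω → K → ℝ} (hd : IsData X ν t T μ L L' f g) (hs : IsSolution X ν t T μ f g Y Z) :
    @IsLinearSolution _ _ _ (sigmaAlg X (Ici t)) t (natFiltration X t) μ X ν T κ Y Z
      (fun ω => g (X T ω)) (fun s ω => f s (X s ω) (Y s ω) (Z s ω)) := by
  let _ : MeasurableSpace Ω := sigmaAlg X (Ici t)
  have hlt := ENNReal.add_lt_top.1 hs.memM.normSq_lt_top
  have hY := memLp_of_progressive htT hs.memM.progressive hlt.1
  have hZ2 := hlt.2
  rw [hC.lintegral_Icc_rate hs.memM.predictable] at hZ2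
  have hg : Measurable fun ω => g (X T ω) :=
    hd.measurable_final.comp (measurable_sigmaAlg (mem_Ici.2 htT))
  exact
    { adapted := fun s hts => (hs.memM.progressive.stronglyAdapted ⟨s, hts⟩).measurable
      predictable := hs.memM.predictable
      memLp_terminal := (memLp_two_iff hg.aestronglyMeasurable).2 hd.final_sq_integrable
      memLp_driver := hd.isGenerator.memLp hC hY hs.memM.predictable hZ2
      memLp_left := hY
      sq_lt_top := hZ2
      equation := hs.equation }

/-- The a priori estimate for the difference of two solutions of the backward equation. -/
theorem IsJumpMarkov.apriori_sub [MeasurableSingletonClass K] (h : IsJumpMarkov X P ν)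
    (hν : IsRateMeasure ν T) (htT : t ≤ T) (x : K)
    {f₁ f₂ : ℝ≥0 → K → ℝ → (K → ℝ) → ℝ} {g₁ g₂ : K → ℝ}
    {Y₁ Y₂ : ℝ≥0 → Ω → ℝ} {Z₁ Z₂ : ℝ≥0 → Ω → K → ℝ}
    (hd₁ : IsData X ν t T (P t x) L L' f₁ g₁) (hd₂ : IsData X ν t T (P t x) L L' f₂ g₂)
    (hs₁ : IsSolution X ν t T (P t x) f₁ g₁ Y₁ Z₁) (hs₂ : IsSolution X ν t T (P t x) f₂ g₂ Y₂ Z₂)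
    {N : ℕ} (hN : 2 * (1 + 2 * L' + 2 * L ^ 2) * T ≤ N) :
    (⨆ s ∈ Icc t T, ∫⁻ ω, ‖Y₁ s ω - Y₂ s ω‖ₑ ^ 2 ∂(P t x)) +
        (∫⁻ ω, (∫⁻ s in Icc t T, ‖Y₁ s ω - Y₂ s ω‖ₑ ^ 2 ∂leb) ∂(P t x)) +
        (∫⁻ ω, (∫⁻ s in Icc t T,
          (∫⁻ y, ‖Z₁ s ω y - Z₂ s ω y‖ₑ ^ 2 ∂(ν (s, X s ω))) ∂leb) ∂(P t x)) ≤
      ((3 + 4 * 2 ^ N : ℝ≥0) : ℝ≥0∞) * ((∫⁻ ω, ‖g₁ (X T ω) - g₂ (X T ω)‖ₑ ^ 2 ∂(P t x)) +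
        ∫⁻ ω, (∫⁻ s in Icc t T,
          ‖f₁ s (X s ω) (Y₂ s ω) (Z₂ s ω) - f₂ s (X s ω) (Y₂ s ω) (Z₂ s ω)‖ₑ ^ 2 ∂leb)
          ∂(P t x)) := by
  obtain ⟨Λ, hΛ⟩ := hν.bounded
  let _ : MeasurableSpace Ω := sigmaAlg X (Ici t)
  have hμ := h.isProbabilityMeasure t x
  have hX : ∀ s, t ≤ s → Measurable (X s) := fun s hs => measurable_sigmaAlg (mem_Ici.2 hs)
  have hτ : ∀ u, t ≤ u → Measurable fun ω => jumpTime X u ω 1 := fun u hu =>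
    (h.measurable_firstJump u).mono (sigmaAlg_mono X (Ici_subset_Ici.2 hu)) le_rfl
  obtain ⟨κ, hκ, hκΛ, hκν⟩ := exists_rateKernel h.isStepPath hX htT hΛ
  obtain ⟨p, hp, hpX⟩ := exists_jumpKernel h.isStepPath hX hτ T
  have hC : HasCompensator (natFiltration X t) (P t x) X ν T Λ κ p :=
    { isStepPath := h.isStepPath
      measurable_apply := hX
      rate_le := hκΛ
      rate_eq := hκν
      jump_eq := hpX
      map_eq := map_jumpKernel_eq (natFiltration X t) (P t x) htT κ hκΛ hκν p hpX
        fun a hta haT A hA G hG => h.setLIntegral_jumpPointMeasure hta haT le_rfl hΛ x hA hG }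
  exact JumpBSDE.apriori_sub htT hC hd₁.isGenerator
    (hs₁.isLinearSolution hμ hκ hC htT hd₁) (hs₂.isLinearSolution hμ hκ hC htT hd₂) hN

theorem isData_zero (μ : @Measure Ω (sigmaAlg X (Ici t))) :
    IsData X ν t T μ L L' (fun _ _ _ _ => 0) (fun _ => 0) where
  measurable_final := measurable_const
  final_sq_integrable := by simp
  measurable_generator _ _ _ := measurable_const
  lipschitz s _ x r r' z z' _ _ := by simp only [sub_self, abs_zero]; positivity
  generator_sq_integrable := by simp

/-- The comparison solution that turns the difference estimate into the bound for a single solution.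
-/
theorem isSolution_zero (μ : @Measure Ω (sigmaAlg X (Ici t))) :
    IsSolution X ν t T μ (fun _ _ _ _ => 0) (fun _ => 0) (fun _ _ => 0) (fun _ _ _ => 0) where
  memM :=
    { progressive := isStronglyProgressive_const _ _
      predictable := measurable_const
      normSq_lt_top := by simp [normSq] }
  equation := by simp [compensatedIntegral]

end Main

end JumpBSDE

end

open JumpBSDE
theorem proposition3p1 (T : ℝ≥0) (hT : 0 < T) (L L' : ℝ≥0) :
    ∃ C : ℝ≥0, 0 < C ∧
      ∀ (K Ω : Type*) [MeasurableSpace K] [MeasurableSingletonClass K]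
        (ν : Kernel (ℝ≥0 × K) K) (X : ℝ≥0 → Ω → K)
        (P : (t : ℝ≥0) → K → @Measure Ω (sigmaAlg X (Ici t))),
        IsRateMeasure ν T → IsJumpMarkov X P ν →
        ∀ t ≤ T, ∀ x : K,
          -- the a priori estimates for the difference of two solutions
          (∀ (f₁ f₂ : ℝ≥0 → K → ℝ → (K → ℝ) → ℝ) (g₁ g₂ : K → ℝ)
              (Y₁ Y₂ : ℝ≥0 → Ω → ℝ) (Z₁ Z₂ : ℝ≥0 → Ω → K → ℝ),
            IsData X ν t T (P t x) L L' f₁ g₁ → IsData X ν t T (P t x) L L' f₂ g₂ →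
            IsSolution X ν t T (P t x) f₁ g₁ Y₁ Z₁ → IsSolution X ν t T (P t x) f₂ g₂ Y₂ Z₂ →
            (⨆ s ∈ Icc t T, ∫⁻ ω, ‖Y₁ s ω - Y₂ s ω‖ₑ ^ 2 ∂(P t x)) +
                (∫⁻ ω, (∫⁻ s in Icc t T, ‖Y₁ s ω - Y₂ s ω‖ₑ ^ 2 ∂leb) ∂(P t x)) +
                (∫⁻ ω, (∫⁻ s in Icc t T,
                  (∫⁻ y, ‖Z₁ s ω y - Z₂ s ω y‖ₑ ^ 2 ∂(ν (s, X s ω))) ∂leb) ∂(P t x)) ≤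
              C * ((∫⁻ ω, ‖g₁ (X T ω) - g₂ (X T ω)‖ₑ ^ 2 ∂(P t x)) +
                ∫⁻ ω, (∫⁻ s in Icc t T,
                  ‖f₁ s (X s ω) (Y₂ s ω) (Z₂ s ω) - f₂ s (X s ω) (Y₂ s ω) (Z₂ s ω)‖ₑ ^ 2 ∂leb)
                  ∂(P t x))) ∧
          -- the resulting bound for a single solution
          (∀ (f : ℝ≥0 → K → ℝ → (K → ℝ) → ℝ) (g : K → ℝ)
              (Y : ℝ≥0 → Ω → ℝ) (Z : ℝ≥0 → Ω → K → ℝ),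
            IsData X ν t T (P t x) L L' f g → IsSolution X ν t T (P t x) f g Y Z →
            normSq X ν t T (P t x) Y Z ≤
              C * ((∫⁻ ω, ‖g (X T ω)‖ₑ ^ 2 ∂(P t x)) +
                ∫⁻ ω, (∫⁻ s in Icc t T, ‖f s (X s ω) 0 0‖ₑ ^ 2 ∂leb) ∂(P t x))) := by
  -- The number of Gronwall steps depends only on `T`, `L`, `L'`, and so does the constant built
  -- from it.
  set N : ℕ := ⌈2 * (1 + 2 * L' + 2 * L ^ 2) * T⌉₊ with hNdef
  have hN : 2 * (1 + 2 * L' + 2 * L ^ 2) * T ≤ N := Nat.le_ceil _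
  refine ⟨3 + 4 * 2 ^ N, by positivity, ?_⟩
  intro K Ω _ _ ν X P hν h t htT x
  refine ⟨fun f₁ f₂ g₁ g₂ Y₁ Y₂ Z₁ Z₂ hd₁ hd₂ hs₁ hs₂ =>
    h.apriori_sub hν htT x hd₁ hd₂ hs₁ hs₂ hN, fun f g Y Z hd hs => ?_⟩
  -- With zero as second solution, `F` becomes `f(s,X_s,0,0)`; the supremum term is then dropped.
  have hmain := h.apriori_sub hν htT x hd (isData_zero _) hs (isSolution_zero _) hN
  simp only [sub_zero] at hmain
  refine le_trans ?_ hmain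
  rw [normSq, add_assoc]
  exact le_add_self
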